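/- For $\alpha\in[0,1)$ let $T_\alpha:[0,1]\to[0,1]$ be the intermittent map $T_\alpha(x)=x(1+2^\alpha x^\alpha)$ for $x\in[0,1/2)$ and $T_\alpha(x)=2x-1$ for $x\in[1/2,1]$. For $\beta>0$ let $\mathcal C_*(\beta)$ be the set of integrable continuous functions $\varphi:(0,1]\to[0,\infty)$ such that $\varphi$ is non-increasing, $x\mapsto x^{\beta+1}\varphi(x)$ is non-decreasing, and $\varphi(x)\le 2^{\beta}(2+\beta)x^{-\beta}\int_0^1\varphi\,dm$ for all $x\in(0,1]$, where $m$ is Lebesgue measure. Let $0<\beta_*<1/3$, let $(\alpha_n)_{n\ge1}$ be a sequence with $0\le\alpha_n\le\beta_*$ for all $n\ge 1$, and put $\widetilde T_n=T_{\alpha_n}\circ\cdots\circ T_{\alpha_1}$, $\widetilde T_0=\mathrm{id}$. Let $\mu$ be a Borel probability measure on $[0,1]$ having a density (with respect to $m$) that belongs to $\mathcal C_*(\beta_*)$, and let $f:[0,1]\to\mathbb R$ be Lipschitz continuous. For $N\ge1$ let $$W=W(N)=\frac1{\sqrt N}\sum_{i=0}^{N-1}\Big(f\circ\widetilde T_i-\int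 f\circ\widetilde T_i\,d\mu\Big),\qquad \sigma_N\ge 0,\quad \sigma_N^2=\int W(N)^2\,d\mu .$$ Let $Z\sim\mathcal N(0,1)$, and for random variables $Y_1,Y_2$ let $d_{\mathscr W}(Y_1,Y_2)=\sup_h|\mathbb E\,h(Y_1)-\mathbb E\,h(Y_2)|$, the supremum being over all $h:\mathbb R\to\mathbb R$ with $|h(x)-h(y)|\le|x-y|$ for all $x,y$; here $W$ is regarded as a random variable on $([0,1],\mu)$. Then there is a constant $C>0$, independent of $N$, such that for every integer $N\ge2$ with $\sigma_N>0$, $$d_{\mathscr W}(W,\sigma_NZ)\le C\,\max\{1,\sigma_N^{-2}\}\,N^{\beta_*-\frac12}(\log N)^{\frac1{\beta_*}} .$$ -/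

import Mathlib

open MeasureTheory ProbabilityTheory

noncomputable section

namespace Intermittent

/-- The intermittent (Liverani–Saussol–Vaienti) map `T_α`. It is used only on `[0,1]`, which it maps
to itself when `0 ≤ α`; for `α = 0` it is the angle-doubling map. -/
def map (α : ℝ) (x : ℝ) : ℝ :=
  if x < 1 / 2 then x * (1 + 2 ^ α * x ^ α) else 2 * x - 1

/-- The composition `T_{α_n} ∘ ⋯ ∘ T_{α_1}` (the identity for `n = 0`); the value `α 0` is
never used. -/
def comp (α : ℕ → ℝ) : ℕ → ℝ → ℝ
  | 0 => id
  | n + 1 => map (α (n + 1)) ∘ comp α n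

/-- A sequence of intermittent maps, given by its parameters `α_n`, `n ≥ 1`, is admissible
for `β` if all the parameters lie in `[0, β]`. -/
def Admissible (β : ℝ) (α : ℕ → ℝ) : Prop :=
  ∀ n, 1 ≤ n → 0 ≤ α n ∧ α n ≤ β

/-- Membership in the convex cone `C_*(a)` of functions on `(0,1]`; monotonicity is non-strict,
and values of `φ` outside `(0,1]` play no role. -/
structure InCone (a : ℝ) (φ : ℝ → ℝ) : Prop where
  continuousOn : ContinuousOn φ (Set.Ioc 0 1)
  integrableOn : IntegrableOn φ (Set.Ioc 0 1) volume
  nonneg : ∀ x ∈ Set.Ioc (0 : ℝ) 1, 0 ≤ φ x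
  antitoneOn : AntitoneOn φ (Set.Ioc 0 1)
  monotoneOn : MonotoneOn (fun x => x ^ (a + 1) * φ x) (Set.Ioc 0 1)
  le_rpow : ∀ x ∈ Set.Ioc (0 : ℝ) 1,
    φ x ≤ 2 ^ a * (2 + a) * x ^ (-a) * ∫ y in Set.Ioc (0 : ℝ) 1, φ y

/-- `μ` is the measure on `[0,1]` with density `φ` with respect to Lebesgue measure `m`. -/
def HasDensity (μ : Measure ℝ) (φ : ℝ → ℝ) : Prop :=
  μ = (volume.restrict (Set.Ioc (0 : ℝ) 1)).withDensity (fun x => ENNReal.ofReal (φ x))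

/-- The centred and normalized Birkhoff sum `W = W(N)`. -/
def W (α : ℕ → ℝ) (μ : Measure ℝ) (f : ℝ → ℝ) (N : ℕ) (x : ℝ) : ℝ :=
  (1 / √(N : ℝ)) *
    ∑ i ∈ Finset.range N, (f (comp α i x) - ∫ y, f (comp α i y) ∂μ)

/-- The standard deviation `σ_N` of `W(N)`, that is, `σ_N ≥ 0` and `σ_N² = μ(W²)`. -/
def sigma (α : ℕ → ℝ) (μ : Measure ℝ) (f : ℝ → ℝ) (N : ℕ) : ℝ :=
  √(∫ x, W α μ f N x ^ 2 ∂μ)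

end Intermittent

/-- The Wasserstein distance between (integrable) real random variables `X` and `Y`, living on
possibly different probability spaces: the supremum over all `1`-Lipschitz `h : ℝ → ℝ` of
`|E h(X) - E h(Y)|`, taken in `[0,∞]`. -/
def wassersteinDist {Ω Ω' : Type*} [MeasurableSpace Ω] [MeasurableSpace Ω']
    (X : Ω → ℝ) (P : Measure Ω) (Y : Ω' → ℝ) (Q : Measure Ω') : ENNReal :=
  ⨆ (h : ℝ → ℝ) (_ : LipschitzWith 1 h),
    ENNReal.ofReal |(∫ ω, h (X ω) ∂P) - ∫ ω, h (Y ω) ∂Q|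

end

/-! The proof is Stein's method with a time window, fed by a coupling argument that forgets initial
densities with a pointwise bound.

Stein side. Solving Stein's equation reduces the distance to bounding the expectation of `σ² A'(W) -
W A(W)`, where `A` is bounded with bounded, Lipschitz derivative (`exists_stein_solution`,
`wassersteinDist_le_of_stein`). In `abs_integral_stein_le` each summand `X n` is separated from the
summands within time distance `K` of it. A Taylor expansion at `W` leaves four errors: the
fluctuation of a local quadratic form, controlled by covariances of pairs; the tail of the
correlations beyond `K`; a quadratic remainder; and the expectation of `X n * A (U n)`, where `U n`
omits the window around `n`.

Memory loss. The transfer operators preserve a cone of decreasing densities bounded by a multiple of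
`x ^ (-β)`. On the right branch a constant can be subtracted without leaving the shape conditions of
the cone, so two densities of equal mass can shed a common constant at every step. If `m` is the
remaining mass, the shed constant is at least of order `m ^ (1 / (1 - β))`, whence `m` is at most of
order `n ^ (-(1 / β - 1))` (`exists_residual`). Monotonicity turns this mass bound into the
pointwise bound `m / x` (`exists_memory_loss`). Integrating the pointwise bound costs a logarithm,
but it then applies to integrands that also depend on the image point (`exists_decayBound`), and
correlation bounds of first and second order follow.

The term `X n * A (U n)` couples past and future nonlinearly. The future enters only through the
point at time `n + K`. Once it is frozen, the past is carried by `pastDensity`. The Lipschitz errors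
created at each step are absorbed by the expansion of both branches measured in `x ^ (1 - β)`
(`left_expansion`, `right_expansion`), so that this density is a difference of cone functions with a
bound independent of time. Memory loss on the two gaps of length `K` around `n` makes the term of
order `rate β K` (`Observables.abs_integral_gap_le`).

With `K = ⌈N ^ β⌉` the terms `√N * rate β K` and `K / √N` are of order `N ^ (β - 1 / 2)` up to one
logarithm, and the correlation tail is bounded by the same power. The single logarithm is absorbed
in `log N ^ (1 / β)`. -/

open Filter Topology

/-! ### Stein's equation and the Wasserstein distance. -/

/-- Gaussian barrier: a function vanishing at infinity whose derivative is dominated by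
`(p t + B) exp (-t²/2)` is dominated by `(p + B / t) exp (-t²/2)`. -/
lemma le_gaussian_of_deriv_ge {u k : ℝ → ℝ} {p B : ℝ} (hB : 0 ≤ B)
    (hu : ∀ t, 0 < t → HasDerivAt u (k t) t)
    (hk : ∀ t, 0 < t → -((p * t + B) * Real.exp (-t ^ 2 / 2)) ≤ k t)
    (hlim : Tendsto u atTop (𝓝 0)) {t : ℝ} (ht : 0 < t) :
    u t ≤ (p + B / t) * Real.exp (-t ^ 2 / 2) := by
  set b : ℝ → ℝ := fun t => (p + B / t) * Real.exp (-t ^ 2 / 2) with hb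
  have hexp : ∀ s : ℝ, HasDerivAt (fun t => Real.exp (-t ^ 2 / 2))
      (Real.exp (-s ^ 2 / 2) * (-s)) s := by
    intro s
    exact (((hasDerivAt_pow 2 s).fun_neg).div_const 2).exp.congr_deriv (by
      simp only [Nat.cast_ofNat, Nat.add_one_sub_one, pow_one]; ring)
  have hbd : ∀ s, 0 < s → HasDerivAt b
      (B * (-(s ^ 2)⁻¹) * Real.exp (-s ^ 2 / 2)
        + (p + B / s) * (Real.exp (-s ^ 2 / 2) * (-s))) s := by
    intro s hs
    have h1 : HasDerivAt (fun t => p + B / t) (B * (-(s ^ 2)⁻¹)) s := by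
      simpa [div_eq_mul_inv] using ((hasDerivAt_inv hs.ne').const_mul B).const_add p
    exact h1.mul (hexp s)
  -- The derivative of the barrier `b` lies below the lower bound on `k`, by the margin `B / t²`
  -- times the Gaussian. So `u - b` increases to its limit `0` and is nonpositive.
  have hmono : MonotoneOn (fun t => u t - b t) (Set.Ioi 0) := by
    apply monotoneOn_of_deriv_nonneg (convex_Ioi 0)
    · intro s hs
      exact ((hu s hs).fun_sub (hbd s hs)).continuousAt.continuousWithinAt
    · intro s hs
      rw [interior_Ioi] at hs
      exact ((hu s hs).fun_sub (hbd s hs)).differentiableAt.differentiableWithinAt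
    · intro s hs
      rw [interior_Ioi] at hs
      have hs' : 0 < s := hs
      rw [((hu s hs).fun_sub (hbd s hs)).deriv]
      have h1 := hk s hs
      have h2 : B * (-(s ^ 2)⁻¹) * Real.exp (-s ^ 2 / 2)
          + (p + B / s) * (Real.exp (-s ^ 2 / 2) * (-s))
          = -((p * s + B) * Real.exp (-s ^ 2 / 2)) - B * (s ^ 2)⁻¹ * Real.exp (-s ^ 2 / 2) := by
        field_simp; ring
      have h3 : 0 ≤ B * (s ^ 2)⁻¹ * Real.exp (-s ^ 2 / 2) := by positivity
      linarith
  have hblim : Tendsto b atTop (𝓝 0) := by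
    have h1 : Tendsto (fun t : ℝ => p + B / t) atTop (𝓝 (p + 0)) :=
      tendsto_const_nhds.add (tendsto_const_nhds.div_atTop tendsto_id)
    have h2 : Tendsto (fun t : ℝ => Real.exp (-t ^ 2 / 2)) atTop (𝓝 0) := by
      apply Real.tendsto_exp_atBot.comp
      have : Tendsto (fun t : ℝ => -(t ^ 2 / 2)) atTop atBot :=
        tendsto_neg_atTop_atBot.comp
          ((tendsto_pow_atTop (two_ne_zero)).atTop_div_const (by norm_num))
      simpa [neg_div] using this
    simpa using h1.mul h2
  have : u t - b t ≤ 0 := by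
    have hl : Tendsto (fun t => u t - b t) atTop (𝓝 0) := by simpa using hlim.sub hblim
    apply ge_of_tendsto hl
    filter_upwards [eventually_ge_atTop t] with s hs
    exact hmono ht (lt_of_lt_of_le ht hs) hs
  linarith

/-- The one-sided barrier is applied to `u` and `-u`, and to their reflections for negative `t`. -/
lemma abs_le_gaussian_of_abs_deriv_le {u k : ℝ → ℝ} {p B : ℝ} (hB : 0 ≤ B)
    (hu : ∀ t, HasDerivAt u (k t) t)
    (hk : ∀ t, |k t| ≤ (p * |t| + B) * Real.exp (-t ^ 2 / 2))
    (hlim : Tendsto u atTop (𝓝 0)) (hlim' : Tendsto u atBot (𝓝 0)) {t : ℝ} (ht : t ≠ 0) :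
    |u t| ≤ (p + B / |t|) * Real.exp (-t ^ 2 / 2) := by
  have key : ∀ (v l : ℝ → ℝ), (∀ t, HasDerivAt v (l t) t) →
      (∀ t, |l t| ≤ (p * |t| + B) * Real.exp (-t ^ 2 / 2)) → Tendsto v atTop (𝓝 0) →
      ∀ t, 0 < t → |v t| ≤ (p + B / |t|) * Real.exp (-t ^ 2 / 2) := by
    intro v l hv hl hlim t ht
    rw [abs_of_pos ht]
    refine abs_le'.2 ⟨?_, ?_⟩
    · refine le_gaussian_of_deriv_ge hB (fun s _ => hv s) (fun s hs => ?_) hlim ht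
      have := hl s
      rw [abs_of_pos hs] at this
      exact neg_le_of_abs_le this
    · refine le_gaussian_of_deriv_ge (u := fun s => -v s) hB (fun s _ => (hv s).neg)
        (fun s hs => ?_) (by simpa using hlim.neg) ht
      have := hl s
      rw [abs_of_pos hs] at this
      exact neg_le_neg (le_of_abs_le this)
  rcases lt_or_gt_of_ne ht with h | h
  · have := key (fun s => u (-s)) (fun s => -k (-s)) (fun s => ?_) (fun s => ?_) ?_ (-t)
      (by linarith)
    · simpa using this
    · exact ((hu (-s)).comp s (hasDerivAt_neg s)).congr_deriv (by ring)
    · simpa using hk (-s)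
    · exact hlim'.comp tendsto_neg_atTop_atBot
  · exact key u k hu hk hlim t h

lemma integral_abs_gaussianReal_le_one : ∫ x, |x| ∂(gaussianReal 0 1) ≤ 1 := by
  have h2 : MemLp (id : ℝ → ℝ) 2 (gaussianReal 0 1) := memLp_id_gaussianReal 2
  have hInt : Integrable (fun x : ℝ => x ^ 2) (gaussianReal 0 1) := h2.integrable_sq
  have hv : ∫ x, x ^ 2 ∂(gaussianReal 0 1) = 1 := by
    have := variance_eq_sub h2
    rw [variance_id_gaussianReal] at this
    simp only [Pi.pow_apply, id] at this
    rw [integral_id_gaussianReal] at this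
    simpa using this.symm
  calc ∫ x, |x| ∂(gaussianReal 0 1) ≤ ∫ x, (1 + x ^ 2) / 2 ∂(gaussianReal 0 1) := by
        apply integral_mono
        · exact (h2.integrable (by norm_num)).abs
        · exact ((integrable_const 1).add hInt).div_const 2
        · intro x
          have := sq_nonneg (|x| - 1)
          have h3 := sq_abs x
          simp only
          nlinarith
    _ = 1 := by
        rw [integral_div, integral_add (integrable_const 1) hInt, hv]
        simp

lemma LipschitzWith.integrable_comp {Ω : Type*} [MeasurableSpace Ω] {ν : Measure Ω}
    [IsFiniteMeasure ν] {V : Ω → ℝ} {l : ℝ → ℝ} (hl : LipschitzWith 1 l) (hV : Integrable V ν) :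
    Integrable (fun x => l (V x)) ν := by
  refine Integrable.mono' (g := fun x => |l 0| + |V x|) ((integrable_const _).add hV.abs)
    (hl.continuous.comp_aestronglyMeasurable hV.aestronglyMeasurable)
    (Eventually.of_forall fun x => ?_)
  have := hl.dist_le_mul (V x) 0
  simp only [Real.dist_eq, NNReal.coe_one, one_mul, sub_zero] at this
  rw [Real.norm_eq_abs]
  calc |l (V x)| = |l (V x) - l 0 + l 0| := by ring_nf
    _ ≤ |l (V x) - l 0| + |l 0| := abs_add_le _ _
    _ ≤ _ := by linarith

lemma LipschitzWith.integrable_gaussianReal {h : ℝ → ℝ} (hh : LipschitzWith 1 h) :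
    Integrable h (gaussianReal 0 1) :=
  hh.integrable_comp (V := id) ((memLp_id_gaussianReal 1).integrable le_rfl)

lemma LipschitzWith.abs_sub_integral_gaussianReal_le {h : ℝ → ℝ} (hh : LipschitzWith 1 h) (t : ℝ) :
    |h t - ∫ x, h x ∂(gaussianReal 0 1)| ≤ |t| + 1 := by
  have h1 : Integrable (id : ℝ → ℝ) (gaussianReal 0 1) :=
    (memLp_id_gaussianReal 1).integrable le_rfl
  have hi := hh.integrable_gaussianReal
  have : h t - ∫ x, h x ∂(gaussianReal 0 1) = ∫ x, (h t - h x) ∂(gaussianReal 0 1) := by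
    rw [integral_sub (integrable_const _) hi]; simp
  rw [this]
  calc |∫ x, (h t - h x) ∂(gaussianReal 0 1)| ≤ ∫ x, |h t - h x| ∂(gaussianReal 0 1) :=
        abs_integral_le_integral_abs
    _ ≤ ∫ x, (|t| + |x|) ∂(gaussianReal 0 1) := by
        apply integral_mono ((integrable_const _).sub hi).abs ((integrable_const _).add h1.abs)
        intro x
        have := hh.dist_le_mul t x
        simp only [Real.dist_eq, NNReal.coe_one, one_mul] at this
        exact this.trans (abs_sub _ _)
    _ ≤ |t| + 1 := by
        have h2 : Integrable (fun x : ℝ => |x|) (gaussianReal 0 1) := h1.abs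
        rw [integral_add (integrable_const _) h2]
        have := integral_abs_gaussianReal_le_one
        simpa using this

/-- Solution of Stein's equation for a differentiable `1`-Lipschitz function, together with
the bounds on the solution and its first two derivatives. -/
theorem exists_stein_solution {h h' : ℝ → ℝ} (hd : ∀ x, HasDerivAt h (h' x) x)
    (hh' : ∀ x, |h' x| ≤ 1) :
    ∃ f f' : ℝ → ℝ, (∀ x, HasDerivAt f (f' x) x) ∧
      (∀ x, f' x - x * f x = h x - ∫ y, h y ∂(gaussianReal 0 1)) ∧
      (∀ x, |f x| ≤ 26) ∧ (∀ x, |f' x| ≤ 26) ∧ LipschitzWith 26 f' := by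
  have hlip : LipschitzWith 1 h :=
    lipschitzWith_of_nnnorm_deriv_le (fun x => (hd x).differentiableAt) (fun x => by
      rw [(hd x).deriv, ← NNReal.coe_le_coe]; simpa using hh' x)
  set c := ∫ y, h y ∂(gaussianReal 0 1) with hc
  set k : ℝ → ℝ := fun t => (h t - c) * Real.exp (-t ^ 2 / 2) with hk
  have hkc : Continuous k := by
    have := hlip.continuous
    fun_prop
  have hbd : ∀ t, |h t - c| ≤ |t| + 1 := hlip.abs_sub_integral_gaussianReal_le
  have hpdf : ∀ x, gaussianPDFReal 0 1 x = (√(2 * Real.pi))⁻¹ * Real.exp (-x ^ 2 / 2) := by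
    intro x; simp [gaussianPDFReal]
  have hs : (√(2 * Real.pi)) ≠ 0 := by positivity
  have hkint : Integrable k := by
    have h1 : Integrable (fun x => h x - c) (gaussianReal 0 1) :=
      hlip.integrable_gaussianReal.sub (integrable_const _)
    rw [gaussianReal_of_var_ne_zero 0 one_ne_zero] at h1
    have hfd : gaussianPDF 0 1 = fun x => ((gaussianPDFReal 0 1 x).toNNReal : ENNReal) := rfl
    rw [hfd, integrable_withDensity_iff_integrable_smul
      (measurable_gaussianPDFReal 0 1).real_toNNReal] at h1
    have h2 := h1.const_mul (√(2 * Real.pi))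
    refine h2.congr (Eventually.of_forall fun x => ?_)
    simp only [NNReal.smul_def, smul_eq_mul, Real.coe_toNNReal _ (gaussianPDFReal_nonneg 0 1 x)]
    simp only [hpdf, hk]
    field_simp
  -- Centring by the Gaussian mean makes the primitive `u` vanish at both ends, as the barrier
  -- requires.
  have hk0 : ∫ t, k t = 0 := by
    have h1 : ∫ x, (h x - c) ∂(gaussianReal 0 1) = 0 := by
      rw [integral_sub hlip.integrable_gaussianReal (integrable_const _)]; simp [hc]
    rw [integral_gaussianReal_eq_integral_smul one_ne_zero] at h1
    simp only [hpdf, smul_eq_mul, mul_assoc] at h1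
    rw [integral_const_mul] at h1
    have h2 := (mul_eq_zero.1 h1).resolve_left (inv_ne_zero hs)
    rw [← h2]
    exact integral_congr_ae (Eventually.of_forall fun x => by simp only [hk]; ring)
  set u : ℝ → ℝ := fun w => ∫ t in Set.Iic w, k t with hu
  have hueq : ∀ w, u w = u 0 + ∫ t in (0 : ℝ)..w, k t := by
    intro w
    rw [← intervalIntegral.integral_Iic_sub_Iic hkint.integrableOn hkint.integrableOn]
    simp only [hu]; ring
  have hud : ∀ w, HasDerivAt u (k w) w := by
    intro w
    have h1 : HasDerivAt (fun w => u 0 + ∫ t in (0 : ℝ)..w, k t) (k w) w :=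
      (intervalIntegral.integral_hasDerivAt_right (hkc.intervalIntegrable _ _)
        (hkc.stronglyMeasurableAtFilter _ _) hkc.continuousAt).const_add _
    exact h1.congr_of_eventuallyEq (Eventually.of_forall hueq)
  have hutop : Tendsto u atTop (𝓝 0) := by
    have h1 := intervalIntegral_tendsto_integral_Ioi (0 : ℝ) hkint.integrableOn tendsto_id
    have h2 : u 0 + ∫ t in Set.Ioi (0 : ℝ), k t = 0 := by
      rw [← hk0]; exact intervalIntegral.integral_Iic_add_Ioi hkint.integrableOn hkint.integrableOn
    rw [← h2]
    refine (h1.const_add (u 0)).congr fun w => (hueq w).symm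
  have hubot : Tendsto u atBot (𝓝 0) := by
    have h1 := intervalIntegral_tendsto_integral_Iic (0 : ℝ) hkint.integrableOn
      (tendsto_id (α := ℝ) (x := atBot))
    have h2 := h1.const_sub (u 0)
    simp only [hu, sub_self] at h2
    refine h2.congr fun w => ?_
    have := hueq w
    rw [intervalIntegral.integral_symm] at this
    simp only [hu, id] at this ⊢
    linarith
  have hkabs : ∀ t, |k t| ≤ (1 * |t| + 1) * Real.exp (-t ^ 2 / 2) := by
    intro t
    simp only [hk, abs_mul, abs_of_pos (Real.exp_pos _), one_mul]
    exact mul_le_mul_of_nonneg_right (hbd t) (Real.exp_pos _).le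
  have hexp : ∀ s : ℝ, HasDerivAt (fun t => Real.exp (t ^ 2 / 2))
      (Real.exp (s ^ 2 / 2) * s) s := by
    intro s
    have := ((hasDerivAt_pow 2 s).div_const 2).exp
    convert this using 1
    simp only [Nat.cast_ofNat, Nat.add_one_sub_one, pow_one]; ring
  have hexpn : ∀ s : ℝ, HasDerivAt (fun t => Real.exp (-t ^ 2 / 2))
      (Real.exp (-s ^ 2 / 2) * (-s)) s := by
    intro s
    exact (((hasDerivAt_pow 2 s).fun_neg).div_const 2).exp.congr_deriv (by
      simp only [Nat.cast_ofNat, Nat.add_one_sub_one, pow_one]; ring)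
  have hee : ∀ t : ℝ, Real.exp (t ^ 2 / 2) * Real.exp (-t ^ 2 / 2) = 1 := by
    intro t; rw [← Real.exp_add]; simp [neg_div]
  set f : ℝ → ℝ := fun w => Real.exp (w ^ 2 / 2) * u w with hf
  set g : ℝ → ℝ := fun w => w * f w + (h w - c) with hg
  have hfu : ∀ w, f w * Real.exp (-w ^ 2 / 2) = u w := by
    intro w
    simp only [hf]
    rw [mul_right_comm, hee, one_mul]
  have hfd : ∀ w, HasDerivAt f (g w) w := by
    intro w
    refine ((hexp w).fun_mul (hud w)).congr_deriv ?_
    simp only [hg, hf, hk]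
    linear_combination (h w - c) * hee w
  -- For `1 ≤ |w|` the barrier gives `2`. Inside `[-1, 1]` the derivative of `u` is at most `2`, so
  -- `|u| ≤ 2 + 2 * 2 = 6`, and the factor `exp (w² / 2) ≤ 2` gives `12`.
  have hfb : ∀ w, |f w| ≤ 12 := by
    have hfar : ∀ w, 1 ≤ |w| → |f w| ≤ 2 := by
      intro w hw
      have hw0 : w ≠ 0 := by rintro rfl; simp at hw; linarith
      have h1 := abs_le_gaussian_of_abs_deriv_le zero_le_one hud hkabs hutop hubot hw0
      rw [← hfu, abs_mul, abs_of_pos (Real.exp_pos _)] at h1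
      have h2 := le_of_mul_le_mul_right h1 (Real.exp_pos _)
      have h3 : 1 / |w| ≤ 1 := by rw [div_le_one (by linarith)]; exact hw
      linarith
    intro w
    rcases le_total 1 |w| with hw | hw
    · linarith [hfar w hw]
    · have hw' := abs_le.1 hw
      have h1 : |u w - u 1| ≤ 2 * |w - 1| := by
        have hconv := Convex.norm_image_sub_le_of_norm_hasDerivWithin_le (f := u) (f' := k) (C := 2)
          (s := Set.Icc (-1) 1) (x := 1) (y := w)
          (fun x _ => (hud x).hasDerivWithinAt) (fun x hx => ?_) (convex_Icc _ _)
          (by simp) hw'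
        · simpa using hconv
        · rw [Real.norm_eq_abs]
          refine (hkabs x).trans ?_
          have hx1 : |x| ≤ 1 := abs_le.2 hx
          have hx2 : Real.exp (-x ^ 2 / 2) ≤ 1 := by
            rw [Real.exp_le_one_iff]; nlinarith [sq_nonneg x]
          nlinarith [Real.exp_pos (-x ^ 2 / 2), abs_nonneg x]
      have h2 : |u 1| ≤ 2 := by
        rw [← hfu, abs_mul, abs_of_pos (Real.exp_pos _)]
        have h3 := hfar 1 (by simp)
        have hx2 : Real.exp (-(1 : ℝ) ^ 2 / 2) ≤ 1 := by
          rw [Real.exp_le_one_iff]; norm_num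
        nlinarith [Real.exp_pos (-(1 : ℝ) ^ 2 / 2), abs_nonneg (f 1)]
      have h4 : |w - 1| ≤ 2 := by rw [abs_le]; constructor <;> linarith [hw'.1, hw'.2]
      have h5 : |u w| ≤ 6 := by
        have := abs_sub_abs_le_abs_sub (u w) (u 1)
        linarith
      have h6 : Real.exp (w ^ 2 / 2) ≤ 2 := by
        have h7 : w ^ 2 / 2 ≤ 1 / 2 := by nlinarith [sq_abs w, abs_nonneg w]
        have h8 : Real.exp (1 / 2) ≤ 2 := by
          have h9 : Real.exp (1 / 2) * Real.exp (1 / 2) = Real.exp 1 := by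
            rw [← Real.exp_add]; norm_num
          have h10 := Real.exp_one_lt_d9
          nlinarith [Real.exp_pos (1 / 2)]
        exact (Real.exp_le_exp.2 h7).trans h8
      simp only [hf, abs_mul, abs_of_pos (Real.exp_pos _)]
      nlinarith [Real.exp_pos (w ^ 2 / 2), abs_nonneg (u w)]
  have hgd : ∀ w, HasDerivAt g (f w + w * g w + h' w) w := by
    intro w
    refine (((hasDerivAt_id w).fun_mul (hfd w)).fun_add ((hd w).sub_const c)).congr_deriv ?_
    simp
  -- Differentiating `g exp (-w² / 2)` cancels the term `w * g w`, so the barrier applies once more,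
  -- now with `p = 0`. It bounds `w * g w`, the only dangerous term of the second derivative of `f`.
  set v : ℝ → ℝ := fun w => g w * Real.exp (-w ^ 2 / 2) with hv
  have hvd : ∀ w, HasDerivAt v ((f w + h' w) * Real.exp (-w ^ 2 / 2)) w := by
    intro w
    refine ((hgd w).fun_mul (hexpn w)).congr_deriv ?_
    ring
  have hvle : ∀ w, |v w| ≤ 13 * ((|w| + 1) * Real.exp (-w ^ 2 / 2)) := by
    intro w
    simp only [hv]
    rw [abs_mul, abs_of_pos (Real.exp_pos _), ← mul_assoc]
    refine mul_le_mul_of_nonneg_right ?_ (Real.exp_pos _).le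
    calc |w * f w + (h w - c)| ≤ |w * f w| + |h w - c| := abs_add_le _ _
      _ ≤ |w| * 12 + (|w| + 1) := by
        rw [abs_mul]
        exact add_le_add (mul_le_mul_of_nonneg_left (hfb w) (abs_nonneg w)) (hbd w)
      _ ≤ 13 * (|w| + 1) := by linarith [abs_nonneg w]
  have hdec : Tendsto (fun w : ℝ => 13 * ((|w| + 1) * Real.exp (-w ^ 2 / 2))) atTop (𝓝 0) := by
    have h1 : Tendsto (fun x : ℝ => x ^ 1 * Real.exp (-x)) atTop (𝓝 0) :=
      Real.tendsto_pow_mul_exp_neg_atTop_nhds_zero 1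
    have h2 : Tendsto (fun x : ℝ => Real.exp (-x)) atTop (𝓝 0) :=
      Real.tendsto_exp_neg_atTop_nhds_zero
    have h3 : Tendsto (fun x : ℝ => 26 * (x ^ 1 * Real.exp (-x) + Real.exp (-x))) atTop (𝓝 0) := by
      simpa using (h1.add h2).const_mul 26
    refine squeeze_zero' (Eventually.of_forall fun w => by positivity) ?_ h3
    filter_upwards [eventually_ge_atTop (2 : ℝ)] with w hw
    have h4 : Real.exp (-w ^ 2 / 2) ≤ Real.exp (-w) := by
      apply Real.exp_le_exp.2; nlinarith
    rw [abs_of_pos (by linarith)]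
    nlinarith [Real.exp_pos (-w), Real.exp_pos (-w ^ 2 / 2)]
  have hvtop : Tendsto v atTop (𝓝 0) :=
    squeeze_zero_norm (fun w => by rw [Real.norm_eq_abs]; exact hvle w) hdec
  have hvbot : Tendsto v atBot (𝓝 0) := by
    refine squeeze_zero_norm (a := fun w => 13 * ((|w| + 1) * Real.exp (-w ^ 2 / 2)))
      (fun w => by rw [Real.norm_eq_abs]; exact hvle w) ?_
    refine (hdec.comp tendsto_neg_atBot_atTop).congr fun w => ?_
    simp
  have hH : ∀ w, |f w + h' w| ≤ 13 := fun w =>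
    (abs_add_le _ _).trans (by linarith [hfb w, hh' w])
  have hwg : ∀ w, |w * g w| ≤ 13 := by
    intro w
    rcases eq_or_ne w 0 with rfl | hw
    · simp
    · have h1 := abs_le_gaussian_of_abs_deriv_le (p := 0) (B := 13) (by norm_num) hvd
        (fun t => by
          rw [abs_mul, abs_of_pos (Real.exp_pos _), zero_mul, zero_add]
          exact mul_le_mul_of_nonneg_right (hH t) (Real.exp_pos _).le) hvtop hvbot hw
      simp only [hv, abs_mul, abs_of_pos (Real.exp_pos _)] at h1
      have h2 := le_of_mul_le_mul_right h1 (Real.exp_pos _)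
      rw [zero_add, le_div_iff₀ (abs_pos.2 hw)] at h2
      rw [abs_mul, mul_comm]; exact h2
  refine ⟨f, g, hfd, fun x => by simp only [hg]; ring, fun x => (hfb x).trans (by norm_num), ?_, ?_⟩
  · intro w
    rcases le_total 1 |w| with hw | hw
    · have h1 := hwg w
      rw [abs_mul] at h1
      nlinarith [abs_nonneg (g w)]
    · have h1 : |g w| ≤ |w * f w| + |h w - c| := abs_add_le _ _
      rw [abs_mul] at h1
      have := hbd w
      have := hfb w
      nlinarith [abs_nonneg (f w), abs_nonneg w]
  · refine lipschitzWith_of_nnnorm_deriv_le (fun x => (hgd x).differentiableAt) (fun x => ?_)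
    rw [(hgd x).deriv, ← NNReal.coe_le_coe]
    simp only [coe_nnnorm, Real.norm_eq_abs]
    calc |f x + x * g x + h' x| = |(f x + h' x) + x * g x| := by ring_nf
      _ ≤ |f x + h' x| + |x * g x| := abs_add_le _ _
      _ ≤ 26 := by linarith [hH x, hwg x]

/-- A `1`-Lipschitz function is uniformly approximated by differentiable ones. -/
lemma LipschitzWith.exists_hasDerivAt_approx {h : ℝ → ℝ} (hh : LipschitzWith 1 h) {ε : ℝ}
    (hε : 0 < ε) :
    ∃ k k' : ℝ → ℝ, (∀ x, HasDerivAt k (k' x) x) ∧ (∀ x, |k' x| ≤ 1) ∧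
      ∀ x, |k x - h x| ≤ ε := by
  have hc := hh.continuous
  have hl : ∀ x y, |h x - h y| ≤ |x - y| := fun x y => by
    simpa [Real.dist_eq] using hh.dist_le_mul x y
  have hF : ∀ x, HasDerivAt (fun x => ∫ t in (0 : ℝ)..x, h t) (h x) x := fun x =>
    intervalIntegral.integral_hasDerivAt_right (hc.intervalIntegrable _ _)
        (hc.stronglyMeasurableAtFilter _ _) hc.continuousAt
  -- The approximation is the average of `h` over `[x, x + ε]`.
  refine ⟨fun x => ε⁻¹ * ((∫ t in (0 : ℝ)..(x + ε), h t) - ∫ t in (0 : ℝ)..x, h t),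
    fun x => ε⁻¹ * (h (x + ε) - h x), fun x => ?_, fun x => ?_, fun x => ?_⟩
  · have h1 : HasDerivAt (fun x => ∫ t in (0 : ℝ)..(x + ε), h t) (h (x + ε)) x :=
      (hF (x + ε)).comp_add_const x ε
    exact (h1.fun_sub (hF x)).const_mul ε⁻¹
  · rw [abs_mul, abs_of_pos (inv_pos.2 hε), inv_mul_le_iff₀ hε, mul_one]
    simpa [abs_of_pos hε] using hl (x + ε) x
  · have h1 : (∫ t in (0 : ℝ)..(x + ε), h t) - ∫ t in (0 : ℝ)..x, h t = ∫ t in x..(x + ε), h t :=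
      intervalIntegral.integral_interval_sub_left (hc.intervalIntegrable _ _)
        (hc.intervalIntegrable _ _)
    have h2 : ε⁻¹ * (∫ t in x..(x + ε), h t) - h x = ε⁻¹ * ∫ t in x..(x + ε), (h t - h x) := by
      rw [intervalIntegral.integral_sub (hc.intervalIntegrable _ _) (by simp)]
      simp only [intervalIntegral.integral_const, add_sub_cancel_left, smul_eq_mul]
      field_simp
    have h3 : ‖∫ t in x..(x + ε), (h t - h x)‖ ≤ ε * |x + ε - x| := by
      apply intervalIntegral.norm_integral_le_of_norm_le_const
      intro t ht
      rw [Set.uIoc_of_le (by linarith)] at ht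
      rw [Real.norm_eq_abs]
      refine (hl t x).trans ?_
      rw [abs_of_pos (by linarith [ht.1])]
      linarith [ht.2]
    simp only [h1]
    rw [h2, abs_mul, abs_of_pos (inv_pos.2 hε), inv_mul_le_iff₀ hε]
    simpa [abs_of_pos hε] using h3

/-- Stein's method: the Wasserstein distance to `σ Z` is controlled by the expectation of
`σ² A'(W) - W A(W)` for test functions `A` with controlled derivatives. -/
theorem wassersteinDist_le_of_stein {Ω Ω' : Type*} [MeasurableSpace Ω] [MeasurableSpace Ω']
    {P : Measure Ω} [IsProbabilityMeasure P] {Z : Ω → ℝ} (hZ : HasLaw Z (gaussianReal 0 1) P)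
    {μ : Measure Ω'} [IsProbabilityMeasure μ] {W : Ω' → ℝ} (hW : Integrable W μ)
    {σ : ℝ} (hσ : 0 < σ) {D : ℝ}
    (hD : ∀ A A' : ℝ → ℝ, (∀ x, HasDerivAt A (A' x) x) → (∀ x, |A x| ≤ 26) →
      (∀ x, |A' x| ≤ 26 / σ) → (∀ x y, |A' x - A' y| ≤ 26 / σ ^ 2 * |x - y|) →
      |∫ x, (σ ^ 2 * A' (W x) - W x * A (W x)) ∂μ| ≤ D) :
    wassersteinDist W μ (fun ω => σ * Z ω) P ≤ ENNReal.ofReal D := by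
  unfold wassersteinDist
  refine iSup₂_le fun h hh => ENNReal.ofReal_le_ofReal ?_
  refine le_of_forall_pos_le_add fun ε hε => ?_
  -- Stein's equation is solved for the rescaled function `σ⁻¹ k (σ x)`, again with derivative at
  -- most `1`. Undoing the scaling in the solution produces the factors `1 / σ` and `1 / σ²` in the
  -- bounds on `A'`.
  obtain ⟨k, k', hk, hk', hkh⟩ := hh.exists_hasDerivAt_approx (half_pos hε)
  obtain ⟨f, f', hf, hst, hf0, hf1, hf2⟩ := exists_stein_solution
    (h := fun x => σ⁻¹ * k (σ * x)) (h' := fun x => k' (σ * x))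
    (fun x => by
      have h1 : HasDerivAt (fun x => k (σ * x)) (k' (σ * x) * σ) x :=
        (hk (σ * x)).comp x (((hasDerivAt_id x).const_mul σ).congr_deriv (by ring))
      exact (h1.const_mul σ⁻¹).congr_deriv (by field_simp))
    (fun x => hk' _)
  have hklip : LipschitzWith 1 k :=
    lipschitzWith_of_nnnorm_deriv_le (fun x => (hk x).differentiableAt) (fun x => by
      rw [(hk x).deriv, ← NNReal.coe_le_coe]; simpa using hk' x)
  have hZint : Integrable (fun ω => σ * Z ω) P := by
    have h1 : Integrable (id : ℝ → ℝ) (P.map Z) := by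
      rw [hZ.map_eq]; exact (memLp_id_gaussianReal 1).integrable le_rfl
    exact (h1.comp_aemeasurable hZ.aemeasurable).const_mul σ
  have hZk : ∫ y, σ⁻¹ * k (σ * y) ∂(gaussianReal 0 1) = σ⁻¹ * ∫ ω, k (σ * Z ω) ∂P := by
    rw [← hZ.map_eq, integral_map hZ.aemeasurable, integral_const_mul]
    have := hklip.continuous
    exact (Continuous.aestronglyMeasurable (by fun_prop))
  have hmain : |(∫ x, k (W x) ∂μ) - ∫ ω, k (σ * Z ω) ∂P| ≤ D := by
    have h1 := hD (fun x => f (x / σ)) (fun x => f' (x / σ) / σ)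
      (fun x => (((hf (x / σ)).comp x ((hasDerivAt_id x).div_const σ)).congr_deriv (by ring)))
      (fun x => hf0 _)
      (fun x => by
        rw [abs_div, abs_of_pos hσ]; exact div_le_div_of_nonneg_right (hf1 _) hσ.le)
      (fun x y => by
        rw [← sub_div, abs_div, abs_of_pos hσ]
        have := hf2.dist_le_mul (x / σ) (y / σ)
        simp only [Real.dist_eq, NNReal.coe_ofNat, ← sub_div, abs_div, abs_of_pos hσ] at this
        calc _ ≤ 26 * (|x - y| / σ) / σ := div_le_div_of_nonneg_right this hσ.le
          _ = _ := by field_simp)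
    have h2 : ∀ x, σ ^ 2 * (f' (W x / σ) / σ) - W x * f (W x / σ)
        = k (W x) - ∫ ω, k (σ * Z ω) ∂P := by
      intro x
      have := hst (W x / σ)
      rw [hZk, mul_div_cancel₀ _ hσ.ne'] at this
      have h3 : σ ^ 2 * (f' (W x / σ) / σ) - W x * f (W x / σ)
          = σ * (f' (W x / σ) - W x / σ * f (W x / σ)) := by field_simp
      rw [h3, this]; field_simp
    simp only [h2] at h1
    rw [integral_sub (hklip.integrable_comp hW) (integrable_const _)] at h1
    simpa using h1
  have e1 : |(∫ x, h (W x) ∂μ) - ∫ x, k (W x) ∂μ| ≤ ε / 2 := by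
    rw [← integral_sub (hh.integrable_comp hW) (hklip.integrable_comp hW)]
    have := norm_integral_le_of_norm_le_const (μ := μ) (f := fun x => h (W x) - k (W x))
      (C := ε / 2) (Eventually.of_forall fun x => by
        rw [Real.norm_eq_abs, abs_sub_comm]; exact hkh _)
    simpa using this
  have e2 : |(∫ ω, k (σ * Z ω) ∂P) - ∫ ω, h (σ * Z ω) ∂P| ≤ ε / 2 := by
    rw [← integral_sub (hklip.integrable_comp hZint) (hh.integrable_comp hZint)]
    have := norm_integral_le_of_norm_le_const (μ := P)
      (f := fun ω => k (σ * Z ω) - h (σ * Z ω))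
      (C := ε / 2) (Eventually.of_forall fun x => by rw [Real.norm_eq_abs]; exact hkh _)
    simpa using this
  calc _ = |((∫ x, h (W x) ∂μ) - ∫ x, k (W x) ∂μ)
        + ((∫ x, k (W x) ∂μ) - ∫ ω, k (σ * Z ω) ∂P)
        + ((∫ ω, k (σ * Z ω) ∂P) - ∫ ω, h (σ * Z ω) ∂P)| := by ring_nf
    _ ≤ _ := by
      refine (abs_add_three _ _ _).trans ?_
      linarith

/-! ### Abstract normal approximation under decay of correlations. -/

lemma abs_sub_sub_mul_le_of_lipschitz_deriv {A A' : ℝ → ℝ} {a : ℝ}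
    (hA : ∀ x, HasDerivAt A (A' x) x)
    (hA' : ∀ x y, |A' x - A' y| ≤ a * |x - y|) (w v : ℝ) :
    |A w - A (w - v) - A' w * v| ≤ a * v ^ 2 := by
  have ha : 0 ≤ a := by simpa using (abs_nonneg _).trans (hA' 1 0)
  have h1 := Convex.norm_image_sub_le_of_norm_hasDerivWithin_le
    (f := fun x => A x - A' w * x) (f' := fun x => A' x - A' w) (C := a * |v|)
    (s := Set.uIcc (w - v) w) (x := w - v) (y := w)
    (fun x _ => ((hA x).fun_sub (((hasDerivAt_id x).const_mul (A' w)).congr_deriv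
      (by ring))).hasDerivWithinAt)
    (fun x hx => by
      rw [Real.norm_eq_abs]
      refine (hA' x w).trans (mul_le_mul_of_nonneg_left ?_ ha)
      have := Set.abs_sub_right_of_mem_uIcc hx
      rw [abs_sub_comm]
      simpa using this)
    (convex_uIcc _ _) Set.left_mem_uIcc Set.right_mem_uIcc
  rw [Real.norm_eq_abs, Real.norm_eq_abs] at h1
  have h2 : a * |v| * |w - (w - v)| = a * v ^ 2 := by
    rw [sub_sub_cancel, mul_assoc, ← sq, sq_abs]
  rw [h2] at h1
  convert h1 using 2
  ring

/-- Every value of the distance to `n` is attained at most twice, once on each side. -/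
lemma sum_dist_le {g : ℕ → ℝ} (hg : ∀ m, 0 ≤ g m) {S : ℝ}
    (hS : ∀ n, ∑ m ∈ Finset.range n, g m ≤ S) (N n : ℕ) :
    ∑ i ∈ Finset.range N, g (Nat.dist n i) ≤ 2 * S := by
  calc ∑ i ∈ Finset.range N, g (Nat.dist n i)
      ≤ ∑ i ∈ Finset.range ((n + 1) + N), g (Nat.dist n i) :=
        Finset.sum_le_sum_of_subset_of_nonneg
          (Finset.range_subset_range.2 (by omega)) (fun _ _ _ => hg _)
    _ = ∑ i ∈ Finset.range (n + 1), g (Nat.dist n i)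
        + ∑ i ∈ Finset.range N, g (Nat.dist n (n + 1 + i)) := Finset.sum_range_add _ _ _
    _ = ∑ i ∈ Finset.range (n + 1), g i + ∑ i ∈ Finset.range N, g (i + 1) := by
        congr 1
        · rw [← Finset.sum_range_reflect]
          refine Finset.sum_congr rfl fun i hi => ?_
          have := Finset.mem_range.1 hi
          congr 1
          unfold Nat.dist; omega
        · refine Finset.sum_congr rfl fun i _ => ?_
          congr 1
          unfold Nat.dist; omega
    _ ≤ S + S := by
        refine add_le_add (hS _) ?_
        have := hS (N + 1)
        rw [Finset.sum_range_succ'] at this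
        linarith [hg 0]
    _ = 2 * S := by ring

/-- Summing over `l`, then `k`, then `j` costs `Q`, `S` and `Q`; only `i` ranges freely. This is the
count behind the variance of the local quadratic form, where `q` is the indicator of the window. -/
lemma sum_window_le {N : ℕ} {q e : ℕ → ℕ → ℝ} {Q S : ℝ}
    (hq0 : ∀ i j, 0 ≤ q i j) (he0 : ∀ i j, 0 ≤ e i j) (hQ : 0 ≤ Q) (hS : 0 ≤ S)
    (hq : ∀ i, ∑ j ∈ Finset.range N, q i j ≤ Q) (he : ∀ i, ∑ j ∈ Finset.range N, e i j ≤ S) :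
    ∑ i ∈ Finset.range N, ∑ j ∈ Finset.range N, ∑ k ∈ Finset.range N, ∑ l ∈ Finset.range N,
      q i j * q k l * e i k ≤ N * (Q ^ 2 * S) := by
  have h1 : ∀ i, ∑ j ∈ Finset.range N, ∑ k ∈ Finset.range N, ∑ l ∈ Finset.range N,
      q i j * q k l * e i k ≤ Q ^ 2 * S := by
    intro i
    calc ∑ j ∈ Finset.range N, ∑ k ∈ Finset.range N, ∑ l ∈ Finset.range N,
        q i j * q k l * e i k
        = ∑ j ∈ Finset.range N, q i j * ∑ k ∈ Finset.range N,
            e i k * ∑ l ∈ Finset.range N, q k l := by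
          refine Finset.sum_congr rfl fun j _ => ?_
          rw [Finset.mul_sum]
          refine Finset.sum_congr rfl fun k _ => ?_
          rw [Finset.mul_sum, Finset.mul_sum]
          exact Finset.sum_congr rfl fun l _ => by ring
      _ ≤ ∑ j ∈ Finset.range N, q i j * (S * Q) := by
          refine Finset.sum_le_sum fun j _ => mul_le_mul_of_nonneg_left ?_ (hq0 _ _)
          calc ∑ k ∈ Finset.range N, e i k * ∑ l ∈ Finset.range N, q k l
              ≤ ∑ k ∈ Finset.range N, e i k * Q :=
                Finset.sum_le_sum fun k _ => mul_le_mul_of_nonneg_left (hq k) (he0 _ _)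
            _ = (∑ k ∈ Finset.range N, e i k) * Q := by rw [Finset.sum_mul]
            _ ≤ S * Q := mul_le_mul_of_nonneg_right (he i) hQ
      _ = (∑ j ∈ Finset.range N, q i j) * (S * Q) := by rw [Finset.sum_mul]
      _ ≤ Q * (S * Q) := mul_le_mul_of_nonneg_right (hq i) (by positivity)
      _ = Q ^ 2 * S := by ring
  calc _ ≤ ∑ _i ∈ Finset.range N, Q ^ 2 * S := Finset.sum_le_sum fun i _ => h1 i
    _ = _ := by simp

/-- The normal approximation bound for sums of bounded variables with decaying correlations of
first and second order. -/
theorem abs_integral_stein_le {Ω : Type*} [MeasurableSpace Ω] {μ : Measure Ω}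
    [IsProbabilityMeasure μ] {X : ℕ → Ω → ℝ} {b : ℝ} (hXm : ∀ i, Measurable (X i))
    (hXb : ∀ i x, |X i x| ≤ b) {N K : ℕ} (hN : 1 ≤ N)
    {W : Ω → ℝ} (hW : ∀ x, W x = 1 / √(N : ℝ) * ∑ i ∈ Finset.range N, X i x)
    {ε : ℕ → ℝ} (hε : ∀ m, 0 ≤ ε m) {S τ c e : ℝ} (hc : 0 ≤ c)
    (hS : ∀ n, ∑ m ∈ Finset.range n, ε m ≤ S)
    (hτ : ∀ n, ∑ m ∈ Finset.range n, (if m ≤ K then 0 else ε m) ≤ τ)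
    (hcorr : ∀ i j, |∫ x, X i x * X j x ∂μ| ≤ c * ε (Nat.dist i j))
    (hcov : ∀ i j k l, |(∫ x, X i x * X j x * (X k x * X l x) ∂μ)
        - (∫ x, X i x * X j x ∂μ) * ∫ x, X k x * X l x ∂μ|
      ≤ c * (ε (Nat.dist i k) + ε (Nat.dist i l) + ε (Nat.dist j k) + ε (Nat.dist j l)))
    {A A' : ℝ → ℝ} {a₁ a₂ : ℝ} (hA : ∀ x, HasDerivAt A (A' x) x) {a₀ : ℝ}
    (hA0 : ∀ x, |A x| ≤ a₀) (hA1 : ∀ x, |A' x| ≤ a₁)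
    (hA2 : ∀ x y, |A' x - A' y| ≤ a₂ * |x - y|)
    (hdec : ∀ n < N, |∫ x, X n x * A (1 / √(N : ℝ) *
      ∑ j ∈ Finset.range N, if Nat.dist n j ≤ K then 0 else X j x) ∂μ| ≤ e) :
    |∫ x, ((∫ y, W y ^ 2 ∂μ) * A' (W x) - W x * A (W x)) ∂μ| ≤
      √(N : ℝ) * e + a₁ * (2 * c * τ + (2 * (K + 1)) * √(8 * c * S) / √(N : ℝ))
        + a₂ * (b * (c * (2 * (K + 1)) * (2 * S))) / √(N : ℝ) := by
  have hNpos : (0 : ℝ) < N := by exact_mod_cast hN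
  set r : ℝ := 1 / √(N : ℝ) with hr
  have hr0 : 0 < r := by positivity
  have hrr : r * r = 1 / N := by
    rw [hr, div_mul_div_comm, one_mul, Real.mul_self_sqrt hNpos.le]
  have hS0 : 0 ≤ S := by simpa using hS 0
  have hτ0 : 0 ≤ τ := by simpa using hτ 0
  have hb0 : 0 ≤ b := by
    obtain ⟨x⟩ := μ.nonempty_of_neZero
    exact (abs_nonneg _).trans (hXb 0 x)
  have ha1 : 0 ≤ a₁ := (abs_nonneg _).trans (hA1 0)
  have ha2 : 0 ≤ a₂ := by simpa using (abs_nonneg _).trans (hA2 1 0)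
  set q : ℕ → ℕ → ℝ := fun i j => if Nat.dist i j ≤ K then 1 else 0 with hq
  set Q : ℝ := 2 * (K + 1) with hQ
  have hQ0 : 0 ≤ Q := by positivity
  have hq0 : ∀ i j, 0 ≤ q i j := fun i j => by simp only [hq]; split_ifs <;> norm_num
  have hq1 : ∀ i j, q i j ≤ 1 := fun i j => by simp only [hq]; split_ifs <;> norm_num
  have hqs : ∀ i j, q i j = q j i := fun i j => by simp only [hq, Nat.dist_comm]
  have hqQ : ∀ i, ∑ j ∈ Finset.range N, q i j ≤ Q := by
    intro i
    refine sum_dist_le (g := fun m => if m ≤ K then (1 : ℝ) else 0)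
      (fun m => by split_ifs <;> norm_num) (fun n => ?_) N i
    rw [Finset.sum_ite, Finset.sum_const_zero, add_zero, Finset.sum_const, nsmul_eq_mul, mul_one]
    have : ((Finset.range n).filter (· ≤ K)).card ≤ K + 1 := by
      calc _ ≤ (Finset.range (K + 1)).card := Finset.card_le_card (fun m hm => by
            simp only [Finset.mem_filter, Finset.mem_range] at hm ⊢; omega)
        _ = K + 1 := by simp
    exact_mod_cast this
  have hεs : ∀ i, ∑ j ∈ Finset.range N, ε (Nat.dist i j) ≤ 2 * S := sum_dist_le hε hS N
  have hAc : Continuous A := continuous_iff_continuousAt.2 fun x => (hA x).continuousAt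
  have hA'c : Continuous A' := by
    have : LipschitzWith a₂.toNNReal A' := LipschitzWith.of_dist_le_mul fun x y => by
      simpa [Real.dist_eq, Real.coe_toNNReal _ ha2] using hA2 x y
    exact this.continuous
  have bint : ∀ {F : Ω → ℝ} (C : ℝ), Measurable F → (∀ x, |F x| ≤ C) → Integrable F μ := by
    intro F C hF hFC
    exact Integrable.of_bound hF.aestronglyMeasurable C (Eventually.of_forall hFC)
  have hX2 : ∀ i j x, |X i x * X j x| ≤ b * b := fun i j x => by
    rw [abs_mul]; exact mul_le_mul (hXb i x) (hXb j x) (abs_nonneg _) hb0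
  have hX2i : ∀ i j, Integrable (fun x => X i x * X j x) μ := fun i j =>
    bint (b * b) ((hXm i).mul (hXm j)) (hX2 i j)
  have hX4i : ∀ i j k l, Integrable (fun x => X i x * X j x * (X k x * X l x)) μ :=
    fun i j k l => bint (b * b * (b * b)) (((hXm i).mul (hXm j)).mul ((hXm k).mul (hXm l)))
      (fun x => by
        rw [abs_mul]; exact mul_le_mul (hX2 i j x) (hX2 k l x) (abs_nonneg _) (by positivity))
  -- the local sum around `n`, the partially decoupled sum, and the local quadratic form
  set V : ℕ → Ω → ℝ := fun n x => r * ∑ j ∈ Finset.range N, q n j * X j x with hV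
  set U : ℕ → Ω → ℝ := fun n x => r * ∑ j ∈ Finset.range N, (if Nat.dist n j ≤ K then 0 else X j x)
    with hU
  set D : Ω → ℝ := fun x => r * r * ∑ i ∈ Finset.range N, ∑ j ∈ Finset.range N,
    q i j * (X i x * X j x) with hD
  set s2 : ℝ := ∫ y, W y ^ 2 ∂μ with hs2
  have hWm : Measurable W := by
    have : W = fun x => r * ∑ i ∈ Finset.range N, X i x := funext hW
    rw [this]
    exact (Finset.measurable_fun_sum _ fun i _ => hXm i).const_mul r
  have hVm : ∀ n, Measurable (V n) := fun n =>
    (Finset.measurable_fun_sum _ fun i _ => (hXm i).const_mul _).const_mul r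
  have hUV : ∀ n x, U n x = W x - V n x := by
    intro n x
    simp only [hU, hV, hW]
    rw [← mul_sub, ← Finset.sum_sub_distrib]
    congr 1
    refine Finset.sum_congr rfl fun j _ => ?_
    simp only [hq]; split_ifs <;> ring
  have hUm : ∀ n, Measurable (U n) := fun n => by
    have : U n = fun x => W x - V n x := funext (hUV n)
    rw [this]; exact hWm.sub (hVm n)
  have hDm : Measurable D :=
    (Finset.measurable_fun_sum _ fun i _ => Finset.measurable_fun_sum _ fun j _ =>
      ((hXm i).mul (hXm j)).const_mul _).const_mul _
  have hDV : ∀ x, D x = ∑ n ∈ Finset.range N, r * X n x * V n x := by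
    intro x
    simp only [hD, hV, Finset.mul_sum]
    refine Finset.sum_congr rfl fun i _ => Finset.sum_congr rfl fun j _ => by ring
  have hqX : ∀ i j x, |q i j * (X i x * X j x)| ≤ b * b := fun i j x => by
    rw [abs_mul, abs_of_nonneg (hq0 i j)]
    calc _ ≤ 1 * (b * b) := mul_le_mul (hq1 i j) (hX2 i j x) (abs_nonneg _) zero_le_one
      _ = _ := one_mul _
  have hsumb : ∀ (F : ℕ → Ω → ℝ) (B : ℝ), (∀ i x, |F i x| ≤ B) →
      ∀ x, |∑ i ∈ Finset.range N, F i x| ≤ N * B := fun F B hF x => by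
    calc _ ≤ ∑ i ∈ Finset.range N, |F i x| := Finset.abs_sum_le_sum_abs _ _
      _ ≤ ∑ _i ∈ Finset.range N, B := Finset.sum_le_sum fun i _ => hF i x
      _ = _ := by simp
  have hDb : ∀ x, |D x| ≤ r * r * (N * (N * (b * b))) := fun x => by
    simp only [hD]
    rw [abs_mul, abs_of_pos (by positivity : 0 < r * r)]
    exact mul_le_mul_of_nonneg_left
      (hsumb (fun i x => ∑ j ∈ Finset.range N, q i j * (X i x * X j x)) _
        (fun i x => hsumb (fun j x => q i j * (X i x * X j x)) _ (fun j x => hqX i j x) x) x)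
      (by positivity)
  have hVb : ∀ n x, |V n x| ≤ r * (N * b) := fun n x => by
    simp only [hV]
    rw [abs_mul, abs_of_pos hr0]
    refine mul_le_mul_of_nonneg_left (hsumb (fun j x => q n j * X j x) _ (fun j x => ?_) x) hr0.le
    rw [abs_mul, abs_of_nonneg (hq0 _ _)]
    calc _ ≤ 1 * b := mul_le_mul (hq1 _ _) (hXb j x) (abs_nonneg _) zero_le_one
      _ = _ := one_mul _
  have hWb : ∀ x, |W x| ≤ r * (N * b) := fun x => by
    rw [hW, abs_mul, abs_of_pos hr0]
    exact mul_le_mul_of_nonneg_left (hsumb X _ hXb x) hr0.le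
  have hDi : Integrable D μ := bint _ hDm hDb
  -- second moment of the local sums
  have hV2 : ∀ n, ∫ x, V n x ^ 2 ∂μ ≤ r * r * (c * Q * (2 * S)) := by
    intro n
    have h1 : ∀ x, V n x ^ 2 = r * r * ∑ i ∈ Finset.range N, ∑ j ∈ Finset.range N,
        q n i * q n j * (X i x * X j x) := by
      intro x
      simp only [hV]
      rw [mul_pow, sq, sq, Finset.sum_mul_sum]
      congr 1
      exact Finset.sum_congr rfl fun i _ => Finset.sum_congr rfl fun j _ => by ring
    simp only [h1]
    rw [integral_const_mul]
    refine mul_le_mul_of_nonneg_left ?_ (by positivity)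
    rw [integral_finsetSum _ fun i _ => integrable_finsetSum _ fun j _ => (hX2i i j).const_mul _]
    calc _ = ∑ i ∈ Finset.range N, ∑ j ∈ Finset.range N,
          q n i * q n j * ∫ x, X i x * X j x ∂μ := by
          refine Finset.sum_congr rfl fun i _ => ?_
          rw [integral_finsetSum _ fun j _ => (hX2i i j).const_mul _]
          exact Finset.sum_congr rfl fun j _ => integral_const_mul _ _
      -- One of the two window indicators is dropped: the decay of `ε` already sums over `j`, which
      -- leaves one factor `Q` instead of `Q ^ 2`.
      _ ≤ ∑ i ∈ Finset.range N, ∑ j ∈ Finset.range N, q n i * (c * ε (Nat.dist i j)) := by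
          refine Finset.sum_le_sum fun i _ => Finset.sum_le_sum fun j _ => ?_
          rw [mul_assoc]
          refine mul_le_mul_of_nonneg_left ?_ (hq0 _ _)
          calc _ ≤ |q n j * ∫ x, X i x * X j x ∂μ| := le_abs_self _
            _ ≤ 1 * (c * ε (Nat.dist i j)) := by
              rw [abs_mul, abs_of_nonneg (hq0 _ _)]
              exact mul_le_mul (hq1 _ _) (hcorr i j) (abs_nonneg _) zero_le_one
            _ = _ := one_mul _
      _ = ∑ i ∈ Finset.range N, q n i * (c * ∑ j ∈ Finset.range N, ε (Nat.dist i j)) := by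
          refine Finset.sum_congr rfl fun i _ => ?_
          rw [Finset.mul_sum, Finset.mul_sum]
      _ ≤ ∑ i ∈ Finset.range N, q n i * (c * (2 * S)) :=
          Finset.sum_le_sum fun i _ => mul_le_mul_of_nonneg_left
            (mul_le_mul_of_nonneg_left (hεs i) hc) (hq0 _ _)
      _ = (∑ i ∈ Finset.range N, q n i) * (c * (2 * S)) := by rw [Finset.sum_mul]
      _ ≤ Q * (c * (2 * S)) := mul_le_mul_of_nonneg_right (hqQ n) (by positivity)
      _ = _ := by ring
  -- the mean of the local quadratic form
  have hDmean : |s2 - ∫ x, D x ∂μ| ≤ 2 * c * τ := by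
    have h1 : ∀ x, W x ^ 2 - D x = r * r * ∑ i ∈ Finset.range N, ∑ j ∈ Finset.range N,
        (1 - q i j) * (X i x * X j x) := by
      intro x
      simp only [hW, hD]
      rw [mul_pow, sq, sq, Finset.sum_mul_sum, ← mul_sub, ← Finset.sum_sub_distrib]
      congr 1
      refine Finset.sum_congr rfl fun i _ => ?_
      rw [← Finset.sum_sub_distrib]
      exact Finset.sum_congr rfl fun j _ => by ring
    have hW2i : Integrable (fun x => W x ^ 2) μ := by
      refine bint ((r * (N * b)) ^ 2) (hWm.pow_const 2) (fun x => ?_)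
      rw [abs_pow]; exact pow_le_pow_left₀ (abs_nonneg _) (hWb x) 2
    rw [hs2, ← integral_sub hW2i hDi]
    simp only [h1]
    rw [integral_const_mul, integral_finsetSum _ fun i _ =>
      integrable_finsetSum _ fun j _ => (hX2i i j).const_mul _, abs_mul,
      abs_of_pos (by positivity : 0 < r * r), hrr]
    have h2 : |∑ i ∈ Finset.range N, ∫ x, ∑ j ∈ Finset.range N,
        (1 - q i j) * (X i x * X j x) ∂μ| ≤ ∑ _i ∈ Finset.range N, (c * (2 * τ)) := by
      refine (Finset.abs_sum_le_sum_abs _ _).trans (Finset.sum_le_sum fun i _ => ?_)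
      rw [integral_finsetSum _ fun j _ => (hX2i i j).const_mul _]
      calc _ ≤ ∑ j ∈ Finset.range N, |∫ x, (1 - q i j) * (X i x * X j x) ∂μ| :=
            Finset.abs_sum_le_sum_abs _ _
        _ ≤ ∑ j ∈ Finset.range N,
              c * (fun m => if m ≤ K then 0 else ε m) (Nat.dist i j) := by
            refine Finset.sum_le_sum fun j _ => ?_
            rw [integral_const_mul, abs_mul]
            simp only [hq]
            split_ifs with h
            · simp
            · simpa using hcorr i j
        _ ≤ c * (2 * τ) := by
            rw [← Finset.mul_sum]
            refine mul_le_mul_of_nonneg_left (sum_dist_le (fun m => ?_) hτ N i) hc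
            split_ifs
            · exact le_rfl
            · exact hε m
    rw [Finset.sum_const, Finset.card_range, nsmul_eq_mul] at h2
    calc _ ≤ 1 / (N : ℝ) * (N * (c * (2 * τ))) := mul_le_mul_of_nonneg_left h2 (by positivity)
      _ = _ := by field_simp
  -- the variance of the local quadratic form
  have hDvar : ∫ x, (D x - ∫ y, D y ∂μ) ^ 2 ∂μ ≤ Q ^ 2 * (8 * c * S) / N := by
    have hE : ∫ y, D y ∂μ = r * r * ∑ i ∈ Finset.range N, ∑ j ∈ Finset.range N,
        q i j * ∫ x, X i x * X j x ∂μ := by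
      simp only [hD]
      rw [integral_const_mul, integral_finsetSum _ fun i _ =>
        integrable_finsetSum _ fun j _ => (hX2i i j).const_mul _]
      congr 1
      refine Finset.sum_congr rfl fun i _ => ?_
      rw [integral_finsetSum _ fun j _ => (hX2i i j).const_mul _]
      exact Finset.sum_congr rfl fun j _ => integral_const_mul _ _
    have h0 : ∫ x, (D x - ∫ y, D y ∂μ) ^ 2 ∂μ = (∫ x, D x ^ 2 ∂μ) - (∫ y, D y ∂μ) ^ 2 := by
      have := variance_eq_sub (X := D) (μ := μ)
        (MemLp.of_bound hDm.aestronglyMeasurable _ (Eventually.of_forall hDb))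
      rw [variance_eq_integral hDm.aemeasurable] at this
      simpa using this
    have h1 : ∫ x, D x ^ 2 ∂μ = (r * r) ^ 2 * ∑ i ∈ Finset.range N, ∑ j ∈ Finset.range N,
        ∑ k ∈ Finset.range N, ∑ l ∈ Finset.range N,
          q i j * q k l * ∫ x, X i x * X j x * (X k x * X l x) ∂μ := by
      have h2 : ∀ x, D x ^ 2 = (r * r) ^ 2 * ∑ i ∈ Finset.range N, ∑ j ∈ Finset.range N,
          ∑ k ∈ Finset.range N, ∑ l ∈ Finset.range N,
          q i j * q k l * (X i x * X j x * (X k x * X l x)) := by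
        intro x
        simp only [hD]
        rw [mul_pow, sq (∑ i ∈ _, _), Finset.sum_mul]
        congr 1
        refine Finset.sum_congr rfl fun i _ => ?_
        rw [Finset.sum_mul]
        refine Finset.sum_congr rfl fun j _ => ?_
        rw [Finset.mul_sum]
        refine Finset.sum_congr rfl fun k _ => ?_
        rw [Finset.mul_sum]
        exact Finset.sum_congr rfl fun l _ => by ring
      simp only [h2]
      rw [integral_const_mul]
      congr 1
      rw [integral_finsetSum _ fun i _ => integrable_finsetSum _ fun j _ =>
        integrable_finsetSum _ fun k _ => integrable_finsetSum _ fun l _ =>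
          (hX4i i j k l).const_mul _]
      refine Finset.sum_congr rfl fun i _ => ?_
      rw [integral_finsetSum _ fun j _ =>
        integrable_finsetSum _ fun k _ => integrable_finsetSum _ fun l _ =>
          (hX4i i j k l).const_mul _]
      refine Finset.sum_congr rfl fun j _ => ?_
      rw [integral_finsetSum _ fun k _ => integrable_finsetSum _ fun l _ =>
          (hX4i i j k l).const_mul _]
      refine Finset.sum_congr rfl fun k _ => ?_
      rw [integral_finsetSum _ fun l _ => (hX4i i j k l).const_mul _]
      exact Finset.sum_congr rfl fun l _ => integral_const_mul _ _
    have h3 : (∫ y, D y ∂μ) ^ 2 = (r * r) ^ 2 * ∑ i ∈ Finset.range N, ∑ j ∈ Finset.range N,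
        ∑ k ∈ Finset.range N, ∑ l ∈ Finset.range N,
          q i j * q k l * ((∫ x, X i x * X j x ∂μ) * ∫ x, X k x * X l x ∂μ) := by
      rw [hE, mul_pow, sq (∑ i ∈ _, _), Finset.sum_mul]
      congr 1
      refine Finset.sum_congr rfl fun i _ => ?_
      rw [Finset.sum_mul]
      refine Finset.sum_congr rfl fun j _ => ?_
      rw [Finset.mul_sum]
      refine Finset.sum_congr rfl fun k _ => ?_
      rw [Finset.mul_sum]
      exact Finset.sum_congr rfl fun l _ => by ring
    rw [h0, h1, h3, ← mul_sub]
    simp only [← Finset.sum_sub_distrib, ← mul_sub]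
    have hsw := fun (e : ℕ → ℕ → ℝ) (he0 : ∀ i j, 0 ≤ e i j)
      (he : ∀ i, ∑ j ∈ Finset.range N, e i j ≤ 2 * S) =>
      sum_window_le (N := N) hq0 he0 hQ0 (by positivity : (0 : ℝ) ≤ 2 * S) hqQ he
    have t1 := hsw (fun i k => ε (Nat.dist i k)) (fun _ _ => hε _) hεs
    -- The remaining three sums reduce to `t1` by exchanging indices inside a pair, since `q` is
    -- symmetric.
    have t2 : ∑ i ∈ Finset.range N, ∑ j ∈ Finset.range N, ∑ k ∈ Finset.range N,
        ∑ l ∈ Finset.range N, q i j * q k l * ε (Nat.dist i l) ≤ N * (Q ^ 2 * (2 * S)) := by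
      refine le_of_eq_of_le (Finset.sum_congr rfl fun i _ => Finset.sum_congr rfl fun j _ => ?_) t1
      rw [Finset.sum_comm]
      exact Finset.sum_congr rfl fun k _ => Finset.sum_congr rfl fun l _ => by rw [hqs k l]
    have t3 : ∑ i ∈ Finset.range N, ∑ j ∈ Finset.range N, ∑ k ∈ Finset.range N,
        ∑ l ∈ Finset.range N, q i j * q k l * ε (Nat.dist j k) ≤ N * (Q ^ 2 * (2 * S)) := by
      refine le_of_eq_of_le ?_ t1
      rw [Finset.sum_comm]
      refine Finset.sum_congr rfl fun i _ => Finset.sum_congr rfl fun j _ =>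
        Finset.sum_congr rfl fun k _ => Finset.sum_congr rfl fun l _ => by rw [hqs i j]
    have t4 : ∑ i ∈ Finset.range N, ∑ j ∈ Finset.range N, ∑ k ∈ Finset.range N,
        ∑ l ∈ Finset.range N, q i j * q k l * ε (Nat.dist j l) ≤ N * (Q ^ 2 * (2 * S)) := by
      refine le_of_eq_of_le ?_ t2
      rw [Finset.sum_comm]
      refine Finset.sum_congr rfl fun i _ => Finset.sum_congr rfl fun j _ =>
        Finset.sum_congr rfl fun k _ => Finset.sum_congr rfl fun l _ => by rw [hqs i j]
    have t5 : ∑ i ∈ Finset.range N, ∑ j ∈ Finset.range N, ∑ k ∈ Finset.range N,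
        ∑ l ∈ Finset.range N, q i j * q k l * ((∫ x, X i x * X j x * (X k x * X l x) ∂μ)
          - (∫ x, X i x * X j x ∂μ) * ∫ x, X k x * X l x ∂μ)
        ≤ c * (∑ i ∈ Finset.range N, ∑ j ∈ Finset.range N, ∑ k ∈ Finset.range N,
          ∑ l ∈ Finset.range N, (q i j * q k l * ε (Nat.dist i k)
            + q i j * q k l * ε (Nat.dist i l) + q i j * q k l * ε (Nat.dist j k)
            + q i j * q k l * ε (Nat.dist j l))) := by
      simp only [Finset.mul_sum]
      refine Finset.sum_le_sum fun i _ => Finset.sum_le_sum fun j _ =>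
        Finset.sum_le_sum fun k _ => Finset.sum_le_sum fun l _ => ?_
      calc _ ≤ q i j * q k l * (c * (ε (Nat.dist i k) + ε (Nat.dist i l) + ε (Nat.dist j k)
            + ε (Nat.dist j l))) :=
            mul_le_mul_of_nonneg_left ((le_abs_self _).trans (hcov i j k l))
              (mul_nonneg (hq0 _ _) (hq0 _ _))
        _ = _ := by ring
    simp only [Finset.sum_add_distrib] at t5
    calc _ ≤ (r * r) ^ 2 * (c * (N * (Q ^ 2 * (2 * S)) + N * (Q ^ 2 * (2 * S))
          + N * (Q ^ 2 * (2 * S)) + N * (Q ^ 2 * (2 * S)))) := by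
          refine mul_le_mul_of_nonneg_left (t5.trans (mul_le_mul_of_nonneg_left ?_ hc))
            (by positivity)
          exact add_le_add (add_le_add (add_le_add t1 t2) t3) t4
      _ = _ := by rw [hrr]; field_simp; ring
  have hDabs : ∫ x, |D x - ∫ y, D y ∂μ| ∂μ ≤ Q * √(8 * c * S) / √(N : ℝ) := by
    have hm : MemLp (fun x => D x - ∫ y, D y ∂μ) 2 μ :=
      (MemLp.of_bound hDm.aestronglyMeasurable _ (Eventually.of_forall hDb)).sub (memLp_const _)
    have h1 : (∫ x, |D x - ∫ y, D y ∂μ| ∂μ) ^ 2 ≤ ∫ x, (D x - ∫ y, D y ∂μ) ^ 2 ∂μ := by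
      have h2 := variance_nonneg (fun x => |D x - ∫ y, D y ∂μ|) μ
      rw [variance_eq_sub (X := fun x => |D x - ∫ y, D y ∂μ|) hm.abs] at h2
      simp only [Pi.pow_apply, sq_abs] at h2
      linarith
    have h3 : Q * √(8 * c * S) / √(N : ℝ) = √(Q ^ 2 * (8 * c * S) / N) := by
      rw [Real.sqrt_div (by positivity), Real.sqrt_mul (sq_nonneg Q),
        Real.sqrt_sq hQ0]
    rw [h3]
    exact Real.le_sqrt_of_sq_le (h1.trans hDvar)
  -- the remainder
  set R : ℕ → Ω → ℝ := fun n x => A (W x) - A (U n x) - A' (W x) * V n x with hR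
  have hRb : ∀ n x, |R n x| ≤ a₂ * V n x ^ 2 := fun n x => by
    simp only [hR, hUV]
    exact abs_sub_sub_mul_le_of_lipschitz_deriv hA hA2 _ _
  have hRm : ∀ n, Measurable (R n) := fun n =>
    ((hAc.measurable.comp hWm).sub (hAc.measurable.comp (hUm n))).sub
      ((hA'c.measurable.comp hWm).mul (hVm n))
  have hV2i : ∀ n, Integrable (fun x => V n x ^ 2) μ := fun n =>
    bint ((r * (N * b)) ^ 2) ((hVm n).pow_const 2) fun x => by
      rw [abs_pow]; exact pow_le_pow_left₀ (abs_nonneg _) (hVb n x) 2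
  have hXRb : ∀ n x, |X n x * R n x| ≤ b * a₂ * V n x ^ 2 := fun n x => by
    rw [abs_mul, mul_assoc]
    exact mul_le_mul (hXb n x) (hRb n x) (abs_nonneg _) hb0
  have hXRi : ∀ n, Integrable (fun x => X n x * R n x) μ := fun n =>
    Integrable.mono' ((hV2i n).const_mul (b * a₂)) ((hXm n).mul (hRm n)).aestronglyMeasurable
      (Eventually.of_forall (hXRb n))
  have hXUi : ∀ n, Integrable (fun x => X n x * A (U n x)) μ := fun n =>
    bint (b * a₀) ((hXm n).mul (hAc.measurable.comp (hUm n))) fun x => by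
      rw [abs_mul]; exact mul_le_mul (hXb n x) (hA0 _) (abs_nonneg _) hb0
  have hDA : Integrable (fun x => (s2 - D x) * A' (W x)) μ := by
    have h1 : Integrable (fun x => s2 - D x) μ := (integrable_const _).sub hDi
    refine h1.mul_bdd (c := a₁) (hA'c.measurable.comp hWm).aestronglyMeasurable
      (Eventually.of_forall fun x => hA1 _)
  -- Expanding at `W` rather than at `U n` gives the linear terms the common factor `A' (W x)`, so
  -- that they add up to `D x * A' (W x)`. Only the `L¹` norm of `s2 - D` is then needed.
  have hdecomp : ∀ x, s2 * A' (W x) - W x * A (W x) = (s2 - D x) * A' (W x)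
      - r * ∑ n ∈ Finset.range N, (X n x * A (U n x) + X n x * R n x) := by
    intro x
    have h1 : W x * A (W x) = D x * A' (W x)
        + r * ∑ n ∈ Finset.range N, (X n x * A (U n x) + X n x * R n x) := by
      rw [hDV, Finset.sum_mul, Finset.mul_sum, ← Finset.sum_add_distrib, hW x, mul_assoc,
        Finset.sum_mul, Finset.mul_sum]
      refine Finset.sum_congr rfl fun n _ => ?_
      simp only [hR, hW]
      ring
    rw [h1]; ring
  have hXi : ∀ n, Integrable (fun x => X n x * A (U n x) + X n x * R n x) μ := fun n =>
    (hXUi n).add (hXRi n)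
  have hsumi : Integrable
      (fun x => ∑ n ∈ Finset.range N, (X n x * A (U n x) + X n x * R n x)) μ :=
    integrable_finsetSum _ fun n _ => hXi n
  simp only [hdecomp]
  rw [integral_sub hDA (hsumi.const_mul r), integral_const_mul,
    integral_finsetSum _ fun n _ => hXi n]
  have hfirst : |∫ x, (s2 - D x) * A' (W x) ∂μ| ≤
      a₁ * (2 * c * τ + Q * √(8 * c * S) / √(N : ℝ)) := by
    have h1 : Integrable (fun x => |D x - ∫ y, D y ∂μ|) μ := (hDi.sub (integrable_const _)).abs
    calc _ ≤ ∫ x, |(s2 - D x) * A' (W x)| ∂μ := abs_integral_le_integral_abs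
      _ ≤ ∫ x, (|s2 - ∫ y, D y ∂μ| + |D x - ∫ y, D y ∂μ|) * a₁ ∂μ := by
          refine integral_mono hDA.abs (((integrable_const _).add h1).mul_const _) fun x => ?_
          simp only [abs_mul]
          refine mul_le_mul ?_ (hA1 _) (abs_nonneg _) (by positivity)
          rw [abs_sub_comm (D x)]
          calc _ = |(s2 - ∫ y, D y ∂μ) + ((∫ y, D y ∂μ) - D x)| := by ring_nf
            _ ≤ _ := abs_add_le _ _
      _ = (|s2 - ∫ y, D y ∂μ| + ∫ x, |D x - ∫ y, D y ∂μ| ∂μ) * a₁ := by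
          rw [integral_mul_const, integral_add (integrable_const _) h1]
          simp
      _ ≤ (2 * c * τ + Q * √(8 * c * S) / √(N : ℝ)) * a₁ :=
          mul_le_mul_of_nonneg_right (add_le_add hDmean hDabs) ha1
      _ = _ := mul_comm _ _
  have hsecond : |∑ n ∈ Finset.range N, ∫ x, (X n x * A (U n x) + X n x * R n x) ∂μ|
      ≤ N * (e + b * a₂ * (r * r * (c * Q * (2 * S)))) := by
    calc _ ≤ ∑ n ∈ Finset.range N, |∫ x, (X n x * A (U n x) + X n x * R n x) ∂μ| :=
          Finset.abs_sum_le_sum_abs _ _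
      _ ≤ ∑ _n ∈ Finset.range N, (e + b * a₂ * (r * r * (c * Q * (2 * S)))) := by
          refine Finset.sum_le_sum fun n hn => ?_
          rw [integral_add (hXUi n) (hXRi n)]
          refine (abs_add_le _ _).trans (add_le_add (hdec n (Finset.mem_range.1 hn)) ?_)
          calc _ ≤ ∫ x, |X n x * R n x| ∂μ := abs_integral_le_integral_abs
            _ ≤ ∫ x, b * a₂ * V n x ^ 2 ∂μ :=
              integral_mono (hXRi n).abs ((hV2i n).const_mul _) (hXRb n)
            _ ≤ _ := by
              rw [integral_const_mul]
              exact mul_le_mul_of_nonneg_left (hV2 n) (by positivity)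
      _ = _ := by simp [mul_add]
  calc _ ≤ |∫ x, (s2 - D x) * A' (W x) ∂μ|
        + |r * ∑ n ∈ Finset.range N, ∫ x, (X n x * A (U n x) + X n x * R n x) ∂μ| := abs_sub _ _
    _ ≤ a₁ * (2 * c * τ + Q * √(8 * c * S) / √(N : ℝ))
        + r * (N * (e + b * a₂ * (r * r * (c * Q * (2 * S))))) := by
        rw [abs_mul, abs_of_pos hr0]
        exact add_le_add hfirst (mul_le_mul_of_nonneg_left hsecond hr0.le)
    _ = _ := by
        have h1 : r * N = √(N : ℝ) := by
          rw [hr]; rw [one_div, inv_mul_eq_div, Real.div_sqrt]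
        have h2 : r * (N * (e + b * a₂ * (r * r * (c * Q * (2 * S)))))
            = √(N : ℝ) * e + a₂ * (b * (c * Q * (2 * S))) * (r * (r * N) * r) := by
          rw [← h1]; ring
        have h3 : r * (r * N) * r = r := by
          have : r * (r * N) * r = (r * r) * N * r := by ring
          rw [this, hrr]; field_simp
        rw [h2, h3, hr]; ring

/-! ### The branches of the map and the transfer operator. -/

namespace Intermittent

/-- The left branch of the intermittent map. -/
noncomputable def leftBranch (α y : ℝ) : ℝ := y * (1 + 2 ^ α * y ^ α)

/-- The derivative of the left branch. -/
noncomputable def leftDeriv (α y : ℝ) : ℝ := 1 + (1 + α) * (2 ^ α * y ^ α)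

/-- The inverse of the left branch on `[0,1]`. -/
noncomputable def leftInv (α x : ℝ) : ℝ := sSup {y | y ∈ Set.Icc (0 : ℝ) 1 ∧ leftBranch α y ≤ x}

/-- The transfer operator of the intermittent map with respect to Lebesgue measure. -/
noncomputable def transfer (α : ℝ) (g : ℝ → ℝ) (x : ℝ) : ℝ :=
  g (leftInv α x) / leftDeriv α (leftInv α x) + g ((x + 1) / 2) / 2

section Branch

variable {α β : ℝ}

lemma continuous_leftBranch (hα : 0 ≤ α) : Continuous (leftBranch α) := by
  unfold leftBranch
  have := Real.continuous_rpow_const hα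
  fun_prop

lemma strictMonoOn_leftBranch (hα : 0 ≤ α) : StrictMonoOn (leftBranch α) (Set.Ici 0) := by
  intro x hx y hy hxy
  have hx' : 0 ≤ x := hx
  have h1 : x ^ α ≤ y ^ α := Real.rpow_le_rpow hx hxy.le hα
  have h2 : (0 : ℝ) < 2 ^ α := by positivity
  have h3 : 0 ≤ x ^ α := Real.rpow_nonneg hx α
  unfold leftBranch
  have h4 : 2 ^ α * x ^ α ≤ 2 ^ α * y ^ α := mul_le_mul_of_nonneg_left h1 h2.le
  have h5 : 0 ≤ 2 ^ α * x ^ α := by positivity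
  nlinarith

lemma leftBranch_zero : leftBranch α 0 = 0 := by simp [leftBranch]

lemma leftBranch_half : leftBranch α (1 / 2) = 1 := by
  unfold leftBranch
  rw [← Real.mul_rpow (by norm_num) (by norm_num)]
  norm_num

lemma exists_leftBranch_eq (hα : 0 ≤ α) {x : ℝ} (hx : x ∈ Set.Ioc (0 : ℝ) 1) :
    ∃ y ∈ Set.Ioc (0 : ℝ) (1 / 2), leftBranch α y = x := by
  have h := intermediate_value_Icc (by norm_num : (0 : ℝ) ≤ 1 / 2)
    (continuous_leftBranch hα).continuousOn
  rw [leftBranch_zero, leftBranch_half] at h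
  obtain ⟨y, hy, hyx⟩ := h ⟨hx.1.le, hx.2⟩
  refine ⟨y, ⟨lt_of_le_of_ne hy.1 ?_, hy.2⟩, hyx⟩
  rintro rfl
  rw [leftBranch_zero] at hyx
  exact hx.1.ne hyx

lemma leftInv_leftBranch (hα : 0 ≤ α) {y : ℝ} (hy : y ∈ Set.Icc (0 : ℝ) 1) :
    leftInv α (leftBranch α y) = y := by
  have : {z | z ∈ Set.Icc (0 : ℝ) 1 ∧ leftBranch α z ≤ leftBranch α y} = Set.Icc 0 y := by
    ext z
    constructor
    · rintro ⟨hz, hzy⟩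
      exact ⟨hz.1, ((strictMonoOn_leftBranch hα).le_iff_le hz.1 hy.1).1 hzy⟩
    · rintro ⟨hz, hzy⟩
      exact ⟨⟨hz, hzy.trans hy.2⟩, ((strictMonoOn_leftBranch hα).le_iff_le hz hy.1).2 hzy⟩
  rw [leftInv, this, csSup_Icc hy.1]

lemma leftInv_mem (hα : 0 ≤ α) {x : ℝ} (hx : x ∈ Set.Ioc (0 : ℝ) 1) :
    leftInv α x ∈ Set.Ioc (0 : ℝ) (1 / 2) := by
  obtain ⟨y, hy, rfl⟩ := exists_leftBranch_eq hα hx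
  rwa [leftInv_leftBranch hα ⟨hy.1.le, hy.2.trans (by norm_num)⟩]

lemma leftBranch_leftInv (hα : 0 ≤ α) {x : ℝ} (hx : x ∈ Set.Ioc (0 : ℝ) 1) :
    leftBranch α (leftInv α x) = x := by
  obtain ⟨y, hy, rfl⟩ := exists_leftBranch_eq hα hx
  rw [leftInv_leftBranch hα ⟨hy.1.le, hy.2.trans (by norm_num)⟩]

/-- The definition by a supremum makes this hold on the whole line (the supremum of the empty set is
`0`). Measurability of the inverse branch follows without restricting its domain. -/
lemma monotone_leftInv (α : ℝ) : Monotone (leftInv α) := by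
  intro x x' hx
  unfold leftInv
  rcases Set.eq_empty_or_nonempty {y | y ∈ Set.Icc (0 : ℝ) 1 ∧ leftBranch α y ≤ x} with h | h
  · rw [h, Real.sSup_empty]
    exact Real.sSup_nonneg fun y hy => hy.1.1
  · exact csSup_le_csSup ⟨1, fun y hy => hy.1.2⟩ h fun y hy => ⟨hy.1, hy.2.trans hx⟩

lemma leftInv_mem_Ioc (hα : 0 ≤ α) {x : ℝ} (hx : x ∈ Set.Ioc (0 : ℝ) 1) :
    leftInv α x ∈ Set.Ioc (0 : ℝ) 1 :=
  ⟨(leftInv_mem hα hx).1, (leftInv_mem hα hx).2.trans (by norm_num)⟩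

lemma rightInv_mem_Ioc {x : ℝ} (hx : x ∈ Set.Ioc (0 : ℝ) 1) :
    (x + 1) / 2 ∈ Set.Ioc (0 : ℝ) 1 := ⟨by linarith [hx.1], by linarith [hx.2]⟩

lemma leftDeriv_pos (hα : 0 ≤ α) {y : ℝ} (hy : 0 ≤ y) : 0 < leftDeriv α y := by
  have : 0 ≤ y ^ α := Real.rpow_nonneg hy α
  unfold leftDeriv; positivity

lemma leftDeriv_mono (hα : 0 ≤ α) {y y' : ℝ} (hy : 0 ≤ y) (h : y ≤ y') :
    leftDeriv α y ≤ leftDeriv α y' := by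
  have := Real.rpow_le_rpow hy h hα
  unfold leftDeriv
  gcongr

lemma hasDerivAt_leftBranch {y : ℝ} (hy : 0 < y) :
    HasDerivAt (leftBranch α) (leftDeriv α y) y := by
  have h1 := (Real.hasDerivAt_rpow_const (p := α) (Or.inl hy.ne')).const_mul (2 ^ α)
  refine ((hasDerivAt_id y).fun_mul (h1.const_add 1)).congr_deriv ?_
  have h2 : y * y ^ (α - 1) = y ^ α := by
    rw [mul_comm, ← Real.rpow_add_one hy.ne']; simp
  simp only [id]
  unfold leftDeriv
  linear_combination (2 ^ α * α) * h2

lemma two_mul_rpow_le (hαβ : α ≤ β) {y : ℝ} (hy : y ∈ Set.Ioc (0 : ℝ) (1 / 2)) :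
    (2 * y) ^ β ≤ 2 ^ α * y ^ α := by
  rw [← Real.mul_rpow (by norm_num) hy.1.le]
  exact Real.rpow_le_rpow_of_exponent_ge (by linarith [hy.1]) (by linarith [hy.2]) hαβ

lemma two_rpow_mul_rpow_le_one (hα : 0 ≤ α) {y : ℝ} (hy : y ∈ Set.Ioc (0 : ℝ) (1 / 2)) :
    2 ^ α * y ^ α ≤ 1 := by
  rw [← Real.mul_rpow (by norm_num) hy.1.le]
  exact Real.rpow_le_one (by linarith [hy.1]) (by linarith [hy.2]) hα

lemma leftBranch_rpow_div {y : ℝ} (hy : 0 < y) (s : ℝ) :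
    leftBranch α y ^ s / leftDeriv α y
      = (1 + 2 ^ α * y ^ α) ^ s / leftDeriv α y * y ^ s := by
  unfold leftBranch
  rw [Real.mul_rpow hy.le (by positivity)]
  ring

/-- With `t = 2 ^ α * y ^ α` the weight is `(1 + t) ^ (β + 1) / (1 + (1 + α) t)`, which increases in
`t` by Bernoulli's inequality because `α ≤ β`. It is the factor by which the left branch changes `y
^ (β + 1) * g y`. -/
lemma leftWeight_mono (hα : 0 ≤ α) (hαβ : α ≤ β) {y y' : ℝ} (hy : 0 < y) (h : y ≤ y') :
    (1 + 2 ^ α * y ^ α) ^ (β + 1) / leftDeriv α y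
      ≤ (1 + 2 ^ α * y' ^ α) ^ (β + 1) / leftDeriv α y' := by
  set t : ℝ := 2 ^ α * y ^ α with ht
  set t' : ℝ := 2 ^ α * y' ^ α with ht'
  have hy' : 0 < y' := hy.trans_le h
  have htt : t ≤ t' := mul_le_mul_of_nonneg_left (Real.rpow_le_rpow hy.le h hα) (by positivity)
  have ht0 : 0 ≤ t := by positivity
  have hd : leftDeriv α y = 1 + (1 + α) * t := rfl
  have hd' : leftDeriv α y' = 1 + (1 + α) * t' := rfl
  rw [div_le_div_iff₀ (leftDeriv_pos hα hy.le) (leftDeriv_pos hα hy'.le), hd, hd']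
  -- Chosen so that `1 + t' = (1 + s) * (1 + t)`, which separates the two powers.
  set s : ℝ := (t' - t) / (1 + t) with hs
  have hs0 : 0 ≤ s := div_nonneg (by linarith) (by linarith)
  have hst : s * (1 + t) = t' - t := by rw [hs]; field_simp
  have h1 : 1 + t' = (1 + s) * (1 + t) := by linarith
  rw [h1, Real.mul_rpow (by linarith) (by linarith)]
  have h2 : 1 + (1 + α) * s ≤ (1 + s) ^ (β + 1) := by
    calc 1 + (1 + α) * s ≤ (1 + s) ^ (1 + α) :=
          one_add_mul_self_le_rpow_one_add (by linarith) (by linarith)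
      _ ≤ (1 + s) ^ (β + 1) := Real.rpow_le_rpow_of_exponent_le (by linarith) (by linarith)
  have h3 : 0 ≤ (1 + t) ^ (β + 1) := by positivity
  have h4 : 1 + (1 + α) * t' ≤ (1 + (1 + α) * s) * (1 + (1 + α) * t) := by
    have : t' = t + s * (1 + t) := by linarith
    rw [this]
    nlinarith [mul_nonneg (mul_nonneg hα hs0) ht0, mul_nonneg hs0 ht0, mul_nonneg hα hs0,
      mul_nonneg hα (mul_nonneg (mul_nonneg hα hs0) ht0)]
  calc (1 + t) ^ (β + 1) * (1 + (1 + α) * t')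
      ≤ (1 + t) ^ (β + 1) * ((1 + s) ^ (β + 1) * (1 + (1 + α) * t)) := by
        refine mul_le_mul_of_nonneg_left (h4.trans ?_) h3
        exact mul_le_mul_of_nonneg_right h2 (by positivity)
    _ = _ := by ring

lemma measurable_leftInv (α : ℝ) : Measurable (leftInv α) := (monotone_leftInv α).measurable

lemma measurable_leftDeriv (α : ℝ) : Measurable (leftDeriv α) := by
  unfold leftDeriv; fun_prop

lemma measurable_transfer (α : ℝ) {g : ℝ → ℝ} (hg : Measurable g) :
    Measurable (transfer α g) := by
  have h1 := measurable_leftInv α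
  have h2 := measurable_leftDeriv α
  unfold transfer
  exact ((hg.comp h1).div (h2.comp h1)).add ((hg.comp (by fun_prop)).div_const 2)

lemma measurable_map (α : ℝ) : Measurable (map α) := by
  unfold map
  exact Measurable.ite (measurableSet_lt measurable_id measurable_const) (by fun_prop)
    (by fun_prop)

lemma measurable_comp (α : ℕ → ℝ) (n : ℕ) : Measurable (comp α n) := by
  induction n with
  | zero => exact measurable_id
  | succ n ih => exact (measurable_map _).comp ih

lemma map_mem_Icc (hα : 0 ≤ α) {x : ℝ} (hx : x ∈ Set.Icc (0 : ℝ) 1) :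
    map α x ∈ Set.Icc (0 : ℝ) 1 := by
  unfold map
  split_ifs with h
  · constructor
    · have := hx.1
      have := Real.rpow_nonneg hx.1 α
      positivity
    · have h1 : leftBranch α x ≤ leftBranch α (1 / 2) :=
        (strictMonoOn_leftBranch hα).monotoneOn hx.1 (by norm_num : (0 : ℝ) ≤ 1 / 2) h.le
      rwa [leftBranch_half] at h1
  · push Not at h
    constructor <;> linarith [hx.2]

/-- Duality between the map and its transfer operator, in a form allowing the test function to
depend on the image point. -/
lemma integral_transfer (hα : 0 ≤ α) (F : ℝ → ℝ → ℝ)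
    (hF : IntegrableOn (fun y => F (map α y) y) (Set.Ioc 0 1)) :
    IntegrableOn (fun x => transfer α (F x) x) (Set.Ioc 0 1) ∧
      ∫ x in Set.Ioc (0 : ℝ) 1, transfer α (F x) x
        = ∫ y in Set.Ioc (0 : ℝ) 1, F (map α y) y := by
  set G : ℝ → ℝ := fun y => F (map α y) y with hG
  set g₁ : ℝ → ℝ := fun x => F x (leftInv α x) / leftDeriv α (leftInv α x) with hg₁
  set g₂ : ℝ → ℝ := fun x => F x ((x + 1) / 2) / 2 with hg₂
  have hinj : Set.InjOn (leftBranch α) (Set.Ioo 0 (1 / 2)) :=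
    (strictMonoOn_leftBranch hα).injOn.mono fun y hy => hy.1.le
  have him : leftBranch α '' Set.Ioo 0 (1 / 2) = Set.Ioo 0 1 := by
    ext x
    constructor
    · rintro ⟨y, hy, rfl⟩
      have h1 := strictMonoOn_leftBranch hα (Set.mem_Ici.2 le_rfl) (Set.mem_Ici.2 hy.1.le) hy.1
      have h2 := strictMonoOn_leftBranch hα (Set.mem_Ici.2 hy.1.le)
        (Set.mem_Ici.2 (by norm_num : (0 : ℝ) ≤ 1 / 2)) hy.2
      rw [leftBranch_zero] at h1
      rw [leftBranch_half] at h2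
      exact ⟨h1, h2⟩
    · intro hx
      obtain ⟨y, hy, rfl⟩ := exists_leftBranch_eq hα ⟨hx.1, hx.2.le⟩
      refine ⟨y, ⟨hy.1, lt_of_le_of_ne hy.2 ?_⟩, rfl⟩
      rintro rfl
      rw [leftBranch_half] at hx
      exact lt_irrefl _ hx.2
  have hd1 : ∀ y ∈ Set.Ioo (0 : ℝ) (1 / 2),
      HasDerivWithinAt (leftBranch α) (leftDeriv α y) (Set.Ioo 0 (1 / 2)) y :=
    fun y hy => (hasDerivAt_leftBranch hy.1).hasDerivWithinAt
  have e1 : Set.EqOn (fun y => |leftDeriv α y| • g₁ (leftBranch α y)) G (Set.Ioo 0 (1 / 2)) := by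
    intro y hy
    have h1 := leftDeriv_pos hα hy.1.le
    have h2 : map α y = leftBranch α y := by simp only [map, if_pos hy.2, leftBranch]
    simp only [hg₁, hG, h2]
    rw [leftInv_leftBranch hα ⟨hy.1.le, hy.2.le.trans (by norm_num)⟩, abs_of_pos h1, smul_eq_mul]
    field_simp
  have hinj2 : Set.InjOn (fun y : ℝ => 2 * y - 1) (Set.Ioc (1 / 2) 1) := by
    intro y _ y' _ h
    simp only at h; linarith
  have him2 : (fun y : ℝ => 2 * y - 1) '' Set.Ioc (1 / 2) 1 = Set.Ioc 0 1 := by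
    ext x
    constructor
    · rintro ⟨y, hy, rfl⟩
      constructor <;> linarith [hy.1, hy.2]
    · intro hx
      exact ⟨(x + 1) / 2, ⟨by linarith [hx.1], by linarith [hx.2]⟩, by ring⟩
  have hd2 : ∀ y ∈ Set.Ioc (1 / 2 : ℝ) 1,
      HasDerivWithinAt (fun y : ℝ => 2 * y - 1) 2 (Set.Ioc (1 / 2) 1) y :=
    fun y _ =>
      ((((hasDerivAt_id y).const_mul 2).sub_const 1).congr_deriv (by ring)).hasDerivWithinAt
  have e2 : Set.EqOn (fun y => |(2 : ℝ)| • g₂ (2 * y - 1)) G (Set.Ioc (1 / 2) 1) := by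
    intro y hy
    have h2 : map α y = 2 * y - 1 := by simp only [map, if_neg (not_lt.2 hy.1.le)]
    have h3 : (2 * y - 1 + 1) / 2 = y := by ring
    simp only [hg₂, hG, h2, h3, smul_eq_mul]
    rw [abs_of_pos (by norm_num : (0 : ℝ) < 2)]; ring
  -- The endpoint `1 / 2`, where the branches meet, is omitted from both pieces; it has measure
  -- zero.
  have hGl : IntegrableOn G (Set.Ioo 0 (1 / 2)) :=
    hF.mono_set fun y hy => ⟨hy.1, hy.2.le.trans (by norm_num)⟩
  have hGr : IntegrableOn G (Set.Ioc (1 / 2) 1) :=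
    hF.mono_set fun y hy => ⟨lt_trans (by norm_num) hy.1, hy.2⟩
  have i1 : IntegrableOn g₁ (Set.Ioc 0 1) := by
    rw [integrableOn_Ioc_iff_integrableOn_Ioo, ← him,
      integrableOn_image_iff_integrableOn_abs_deriv_smul measurableSet_Ioo hd1 hinj]
    exact hGl.congr_fun e1.symm measurableSet_Ioo
  have i2 : IntegrableOn g₂ (Set.Ioc 0 1) := by
    rw [← him2, integrableOn_image_iff_integrableOn_abs_deriv_smul measurableSet_Ioc hd2 hinj2]
    exact hGr.congr_fun e2.symm measurableSet_Ioc
  have t1 : ∫ x in Set.Ioc (0 : ℝ) 1, g₁ x = ∫ y in Set.Ioo (0 : ℝ) (1 / 2), G y := by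
    rw [integral_Ioc_eq_integral_Ioo, ← him,
      integral_image_eq_integral_abs_deriv_smul measurableSet_Ioo hd1 hinj]
    exact setIntegral_congr_fun measurableSet_Ioo e1
  have t2 : ∫ x in Set.Ioc (0 : ℝ) 1, g₂ x = ∫ y in Set.Ioc (1 / 2 : ℝ) 1, G y := by
    rw [← him2, integral_image_eq_integral_abs_deriv_smul measurableSet_Ioc hd2 hinj2]
    exact setIntegral_congr_fun measurableSet_Ioc e2
  refine ⟨i1.add i2, ?_⟩
  have h1 : ∫ x in Set.Ioc (0 : ℝ) 1, transfer α (F x) x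
      = (∫ x in Set.Ioc (0 : ℝ) 1, g₁ x) + ∫ x in Set.Ioc (0 : ℝ) 1, g₂ x :=
    integral_add i1 i2
  rw [h1, t1, t2, ← integral_Ioc_eq_integral_Ioo, ← setIntegral_union]
  · rw [Set.Ioc_union_Ioc_eq_Ioc (by norm_num) (by norm_num)]
  · rw [Set.disjoint_left]
    intro y hy hy'
    exact absurd hy.2 (not_le.2 hy'.1)
  · exact measurableSet_Ioc
  · rwa [integrableOn_Ioc_iff_integrableOn_Ioo]
  · exact hGr

end Branch

end Intermittent

/-! ### The invariant cone. -/

namespace Intermittent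

/-- The shape conditions defining the cone, without the growth condition at the origin. -/
structure Shape (β : ℝ) (g : ℝ → ℝ) : Prop where
  measurable : Measurable g
  nonneg : ∀ x ∈ Set.Ioc (0 : ℝ) 1, 0 ≤ g x
  antitoneOn : AntitoneOn g (Set.Ioc 0 1)
  monotoneOn : MonotoneOn (fun x => x ^ (β + 1) * g x) (Set.Ioc 0 1)

/-- Cone of functions of mass at most `M` which is invariant under the transfer operators. -/
structure Cone (β M : ℝ) (g : ℝ → ℝ) : Prop extends Shape β g where
  le_rpow : ∀ x ∈ Set.Ioc (0 : ℝ) 1, g x ≤ 6 * M * x ^ (-β)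
  integral_le : ∫ x in Set.Ioc (0 : ℝ) 1, g x ≤ M

variable {α β M : ℝ} {g : ℝ → ℝ}

lemma integrableOn_rpow_neg (hβ : β < 1) :
    IntegrableOn (fun x : ℝ => x ^ (-β)) (Set.Ioc 0 1) := by
  rw [← intervalIntegrable_iff_integrableOn_Ioc_of_le zero_le_one]
  exact intervalIntegral.intervalIntegrable_rpow' (by linarith)

lemma integral_rpow_neg_le (hβ : β ≤ 1 / 2) :
    ∫ x in Set.Ioc (0 : ℝ) 1, x ^ (-β) ≤ 2 := by
  rw [← intervalIntegral.integral_of_le zero_le_one, integral_rpow (Or.inl (by linarith))]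
  rw [Real.one_rpow, Real.zero_rpow (by linarith), sub_zero, div_le_iff₀ (by linarith)]
  linarith

lemma integrableOn_of_le_rpow (hβ : β < 1) {C : ℝ} (hg : Measurable g)
    (hC : ∀ x ∈ Set.Ioc (0 : ℝ) 1, |g x| ≤ C * x ^ (-β)) : IntegrableOn g (Set.Ioc 0 1) := by
  refine Integrable.mono' ((integrableOn_rpow_neg hβ).const_mul C) hg.aestronglyMeasurable ?_
  exact (ae_restrict_iff' measurableSet_Ioc).2 (Eventually.of_forall hC)

lemma Cone.integrableOn (hβ : β < 1) (hg : Cone β M g) : IntegrableOn g (Set.Ioc 0 1) :=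
  integrableOn_of_le_rpow hβ hg.measurable fun x hx => by
    rw [abs_of_nonneg (hg.nonneg x hx)]; exact hg.le_rpow x hx

lemma Cone.nonneg_mass (hg : Cone β M g) : 0 ≤ M :=
  (setIntegral_nonneg measurableSet_Ioc hg.nonneg).trans hg.integral_le

/-- A nonnegative antitone function is bounded by its mass over `x`. -/
lemma Shape.mul_le_integral (hg : Shape β g) (hi : IntegrableOn g (Set.Ioc 0 1)) {x : ℝ}
    (hx : x ∈ Set.Ioc (0 : ℝ) 1) : x * g x ≤ ∫ y in Set.Ioc (0 : ℝ) 1, g y := by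
  have hsub : Set.Ioc 0 x ⊆ Set.Ioc (0 : ℝ) 1 := Set.Ioc_subset_Ioc_right hx.2
  calc x * g x = ∫ _y in Set.Ioc (0 : ℝ) x, g x := by simp [hx.1.le]
    _ ≤ ∫ y in Set.Ioc (0 : ℝ) x, g y := by
        refine setIntegral_mono_on (by simp) (hi.mono_set hsub) measurableSet_Ioc fun y hy => ?_
        exact hg.antitoneOn (hsub hy) hx hy.2
    _ ≤ ∫ y in Set.Ioc (0 : ℝ) 1, g y :=
        setIntegral_mono_set hi ((ae_restrict_iff' measurableSet_Ioc).2
          (Eventually.of_forall hg.nonneg)) hsub.eventuallyLE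

section Transfer


lemma Shape.left_antitoneOn (hα : 0 ≤ α) (hg : Shape β g) :
    AntitoneOn (fun x => g (leftInv α x) / leftDeriv α (leftInv α x)) (Set.Ioc 0 1) := by
  intro x hx x' hx' h
  have hm := monotone_leftInv α h
  have hy := leftInv_mem_Ioc hα hx
  have hy' := leftInv_mem_Ioc hα hx'
  exact div_le_div₀ (hg.nonneg _ hy) (hg.antitoneOn hy hy' hm) (leftDeriv_pos hα hy.1.le)
    (leftDeriv_mono hα hy.1.le hm)

/-- Writing `x` as the image of `y` factors the expression into the increasing weight of
`leftWeight_mono` and the increasing function `y ^ (β + 1) * g y`. -/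
lemma Shape.left_monotoneOn (hα : 0 ≤ α) (hαβ : α ≤ β) (hg : Shape β g) :
    MonotoneOn (fun x => x ^ (β + 1) * (g (leftInv α x) / leftDeriv α (leftInv α x)))
      (Set.Ioc 0 1) := by
  intro x hx x' hx' h
  have hm := monotone_leftInv α h
  have hy := leftInv_mem_Ioc hα hx
  have hy' := leftInv_mem_Ioc hα hx'
  have key : ∀ z ∈ Set.Ioc (0 : ℝ) 1,
      z ^ (β + 1) * (g (leftInv α z) / leftDeriv α (leftInv α z))
      = (1 + 2 ^ α * (leftInv α z) ^ α) ^ (β + 1) / leftDeriv α (leftInv α z)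
        * ((leftInv α z) ^ (β + 1) * g (leftInv α z)) := by
    intro z hz
    have h1 := leftBranch_rpow_div (α := α) (leftInv_mem hα hz).1 (β + 1)
    rw [leftBranch_leftInv hα hz] at h1
    rw [← mul_assoc, ← h1]; ring
  simp only [key x hx, key x' hx']
  have hn : ∀ z ∈ Set.Ioc (0 : ℝ) 1, 0 ≤ z ^ (β + 1) * g z := fun z hz =>
    mul_nonneg (Real.rpow_nonneg hz.1.le _) (hg.nonneg z hz)
  refine mul_le_mul (leftWeight_mono hα hαβ hy.1 hm) (hg.monotoneOn hy hy' hm) (hn _ hy) ?_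
  have := leftDeriv_pos hα hy'.1.le
  have := hy'.1
  positivity

lemma Shape.right_antitoneOn (hg : Shape β g) :
    AntitoneOn (fun x => g ((x + 1) / 2) / 2) (Set.Ioc 0 1) := by
  intro x hx x' hx' h
  have := hg.antitoneOn (rightInv_mem_Ioc hx) (rightInv_mem_Ioc hx') (by linarith)
  simp only
  linarith

/-- On the right branch the shape condition survives the subtraction of a constant. -/
lemma Shape.right_monotoneOn (hβ : 0 ≤ β) (hg : Shape β g) {δ : ℝ} (hδ0 : 0 ≤ δ)
    (hδ : 4 * δ ≤ g 1) :
    MonotoneOn (fun x => x ^ (β + 1) * (g ((x + 1) / 2) / 2 - δ)) (Set.Ioc 0 1) := by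
  intro x hx x' hx' h
  set y := (x + 1) / 2 with hy
  set y' := (x' + 1) / 2 with hy'
  have hyI : y ∈ Set.Ioc (0 : ℝ) 1 := rightInv_mem_Ioc hx
  have hyI' : y' ∈ Set.Ioc (0 : ℝ) 1 := rightInv_mem_Ioc hx'
  have hyy : y ≤ y' := by simp only [hy, hy']; linarith
  have hmono := hg.monotoneOn hyI hyI' hyy
  simp only at hmono
  have hr' : 4 * δ ≤ g y' := hδ.trans (hg.antitoneOn hyI' (by simp) hyI'.2)
  set a := β + 1 with ha
  have ha1 : 1 ≤ a := by linarith
  -- The monotonicity of `y ^ a * g y` reads `x ^ a * g y ≤ z ^ a * g y'`. Here `z` is at most the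
  -- midpoint of `x` and `x'`, so convexity bounds `z ^ a` by the mean of `x ^ a` and `x' ^ a`. The
  -- remaining slack is `(x' ^ a - x ^ a) * g y' / 4`, whence the constant `4` in the condition on
  -- `δ`.
  set z := x * y' / y with hz
  have hz0 : 0 ≤ z := by have := hx.1; have := hyI.1; have := hyI'.1; positivity
  have hzy : z ^ a * y ^ a = x ^ a * y' ^ a := by
    rw [← Real.mul_rpow hz0 hyI.1.le, ← Real.mul_rpow hx.1.le hyI'.1.le, hz,
      div_mul_cancel₀ _ hyI.1.ne']
  have hza : x ^ a * g y ≤ z ^ a * g y' := by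
    have hya : 0 < y ^ a := Real.rpow_pos_of_pos hyI.1 a
    have hxa : 0 ≤ x ^ a := Real.rpow_nonneg hx.1.le a
    refine le_of_mul_le_mul_left ?_ hya
    calc y ^ a * (x ^ a * g y) = x ^ a * (y ^ a * g y) := by ring
      _ ≤ x ^ a * (y' ^ a * g y') := mul_le_mul_of_nonneg_left hmono hxa
      _ = y ^ a * (z ^ a * g y') := by linear_combination (-g y') * hzy
  have hzm : z ≤ (x + x') / 2 := by
    rw [hz, div_le_iff₀ hyI.1, hy, hy']
    nlinarith [mul_nonneg (sub_nonneg.2 h) (sub_nonneg.2 hx.2)]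
  have hconv : z ^ a ≤ (x ^ a + x' ^ a) / 2 := by
    have h1 := (convexOn_rpow ha1).2 hx.1.le hx'.1.le (by norm_num : (0 : ℝ) ≤ 1 / 2)
      (by norm_num : (0 : ℝ) ≤ 1 / 2) (by norm_num)
    simp only [smul_eq_mul] at h1
    calc z ^ a ≤ ((x + x') / 2) ^ a := Real.rpow_le_rpow hz0 hzm (by linarith)
      _ = (1 / 2 * x + 1 / 2 * x') ^ a := by ring_nf
      _ ≤ _ := by linarith
  have hxx : x ^ a ≤ x' ^ a := Real.rpow_le_rpow hx.1.le h (by linarith)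
  simp only
  nlinarith

/-- The constant is taken entirely from the right branch, which has slack; the left branch preserves
the shape by itself. This is what drives the coupling. -/
lemma Shape.transfer_sub (hα : 0 ≤ α) (hαβ : α ≤ β) (hg : Shape β g) {δ : ℝ} (hδ0 : 0 ≤ δ)
    (hδ : 4 * δ ≤ g 1) :
    Shape β (fun x => transfer α g x - δ) where
  measurable := (measurable_transfer α hg.measurable).sub_const δ
  nonneg x hx := by
    have h1 : 0 ≤ g (leftInv α x) / leftDeriv α (leftInv α x) :=
      div_nonneg (hg.nonneg _ (leftInv_mem_Ioc hα hx))
        (leftDeriv_pos hα (leftInv_mem_Ioc hα hx).1.le).le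
    have h2 := hg.antitoneOn (rightInv_mem_Ioc hx) (by simp) (rightInv_mem_Ioc hx).2
    unfold transfer
    linarith
  antitoneOn x hx x' hx' h := by
    have h1 := hg.left_antitoneOn hα hx hx' h
    have h2 := hg.right_antitoneOn hx hx' h
    simp only at h1 h2
    simp only [transfer]
    linarith
  monotoneOn x hx x' hx' h := by
    have h1 := hg.left_monotoneOn hα hαβ hx hx' h
    have h2 := hg.right_monotoneOn (hα.trans hαβ) hδ0 hδ hx hx' h
    simp only at h1 h2
    simp only [transfer]
    linarith

lemma Shape.transfer (hα : 0 ≤ α) (hαβ : α ≤ β) (hg : Shape β g) : Shape β (transfer α g) := by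
  simpa using hg.transfer_sub hα hαβ le_rfl (by simpa using hg.nonneg 1 (by simp))

lemma integral_transfer_eq (hα : 0 ≤ α) (hi : IntegrableOn g (Set.Ioc 0 1)) :
    IntegrableOn (Intermittent.transfer α g) (Set.Ioc 0 1) ∧
    ∫ x in Set.Ioc (0 : ℝ) 1, Intermittent.transfer α g x = ∫ x in Set.Ioc (0 : ℝ) 1, g x :=
  integral_transfer hα (fun _ => g) hi

/-- Near the origin the expansion of the left branch lowers the constant in front of `x ^ (-β)` by
an amount proportional to `t = 2 ^ α * y ^ α`. The right branch contributes at most `M`, hence at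
most `M * t` after multiplication by `x ^ β ≤ t`, and the gain pays for it. -/
lemma Cone.transfer (hα : 0 ≤ α) (hαβ : α ≤ β) (hβ : β ≤ 1 / 2) (hg : Cone β M g) :
    Cone β M (transfer α g) where
  toShape := hg.toShape.transfer hα hαβ
  integral_le := by
    rw [(integral_transfer_eq hα (hg.integrableOn (by linarith))).2]
    exact hg.integral_le
  le_rpow x hx := by
    have hM := hg.nonneg_mass
    have hβ0 := hα.trans hαβ
    set y := leftInv α x with hy
    have hyI : y ∈ Set.Ioc (0 : ℝ) (1 / 2) := leftInv_mem hα hx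
    have hyI1 : y ∈ Set.Ioc (0 : ℝ) 1 := leftInv_mem_Ioc hα hx
    set t : ℝ := 2 ^ α * y ^ α with ht
    have ht0 : 0 ≤ t := by have := hyI.1; positivity
    have ht1 : t ≤ 1 := two_rpow_mul_rpow_le_one hα hyI
    have hxy : x = y * (1 + t) := (leftBranch_leftInv hα hx).symm
    have hd : leftDeriv α y = 1 + (1 + α) * t := rfl
    have hxβ : x ^ β ≤ t := by
      refine (Real.rpow_le_rpow hx.1.le ?_ hβ0).trans (two_mul_rpow_le hαβ hyI)
      rw [hxy]; nlinarith [hyI.1]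
    have hright : g ((x + 1) / 2) / 2 ≤ M := by
      have h1 : (1 / 2 : ℝ) ∈ Set.Ioc (0 : ℝ) 1 := by norm_num
      have h2 := hg.antitoneOn h1 (rightInv_mem_Ioc hx) (by linarith [hx.1])
      have h3 := hg.toShape.mul_le_integral (hg.integrableOn (by linarith)) h1
      have := hg.integral_le
      linarith
    have hleft : g y ≤ 6 * M * y ^ (-β) := hg.le_rpow y hyI1
    have hxb : 0 < x ^ β := Real.rpow_pos_of_pos hx.1 β
    have hyb : 0 < y ^ β := Real.rpow_pos_of_pos hyI.1 β
    have hdpos : 0 < 1 + (1 + α) * t := by positivity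
    have hxyb : x ^ β = y ^ β * (1 + t) ^ β := by
      rw [hxy, Real.mul_rpow hyI.1.le (by linarith)]
    have hbern : (1 + t) ^ β ≤ 1 + β * t :=
      rpow_one_add_le_one_add_mul_self (by linarith) hβ0 (by linarith)
    rw [Real.rpow_neg hx.1.le, ← div_eq_mul_inv, le_div_iff₀ hxb]
    have hgy : g y * y ^ β ≤ 6 * M := by
      rw [Real.rpow_neg hyI.1.le, ← div_eq_mul_inv, le_div_iff₀ hyb] at hleft
      exact hleft
    unfold Intermittent.transfer
    rw [← hy, hd, add_mul]
    have h1 : g y / (1 + (1 + α) * t) * x ^ β ≤ 6 * M * (1 + β * t) / (1 + (1 + α) * t) := by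
      rw [hxyb, div_mul_eq_mul_div, ← mul_assoc]
      refine div_le_div_of_nonneg_right ?_ hdpos.le
      exact mul_le_mul hgy hbern (by positivity) (by positivity)
    have h2 : g ((x + 1) / 2) / 2 * x ^ β ≤ M * t := mul_le_mul hright hxβ hxb.le hM
    have h3 : 6 * M * (1 + β * t) / (1 + (1 + α) * t) ≤ 6 * M - M * t := by
      rw [div_le_iff₀ hdpos]
      have h4 : 0 ≤ M * t := by positivity
      -- The constant `6` in the cone is large enough here because `β ≤ 1 / 2` and `t ≤ 1`.
      have h5 : (0 : ℝ) ≤ 6 * (1 + α - β) - (1 + (1 + α) * t) := by nlinarith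
      nlinarith [mul_nonneg h4 h5]
    linarith

lemma Shape.add {g' : ℝ → ℝ} (hg : Shape β g) (hg' : Shape β g') :
    Shape β (fun x => g x + g' x) where
  measurable := hg.measurable.add hg'.measurable
  nonneg x hx := add_nonneg (hg.nonneg x hx) (hg'.nonneg x hx)
  antitoneOn := hg.antitoneOn.add hg'.antitoneOn
  monotoneOn := by simpa only [mul_add] using hg.monotoneOn.add hg'.monotoneOn

lemma Cone.add {M' : ℝ} {g' : ℝ → ℝ} (hβ : β < 1) (hg : Cone β M g) (hg' : Cone β M' g') :
    Cone β (M + M') (fun x => g x + g' x) where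
  toShape := hg.toShape.add hg'.toShape
  le_rpow x hx := by
    have := hg.le_rpow x hx
    have := hg'.le_rpow x hx
    linarith
  integral_le := by
    rw [integral_add (hg.integrableOn hβ) (hg'.integrableOn hβ)]
    exact add_le_add hg.integral_le hg'.integral_le

lemma Cone.const_mul {c : ℝ} (hc : 0 ≤ c) (hg : Cone β M g) :
    Cone β (c * M) (fun x => c * g x) where
  measurable := hg.measurable.const_mul c
  nonneg x hx := mul_nonneg hc (hg.nonneg x hx)
  antitoneOn x hx x' hx' h := mul_le_mul_of_nonneg_left (hg.antitoneOn hx hx' h) hc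
  monotoneOn x hx x' hx' h := by
    have := mul_le_mul_of_nonneg_left (hg.monotoneOn hx hx' h) hc
    simp only at this ⊢
    linarith
  le_rpow x hx := by
    have := mul_le_mul_of_nonneg_left (hg.le_rpow x hx) hc
    linarith
  integral_le := by
    rw [integral_const_mul]; exact mul_le_mul_of_nonneg_left hg.integral_le hc

lemma Cone.mono {M' : ℝ} (hg : Cone β M g) (h : M ≤ M') : Cone β M' g where
  toShape := hg.toShape
  le_rpow x hx := (hg.le_rpow x hx).trans (by
    have := Real.rpow_nonneg hx.1.le (-β)
    gcongr)
  integral_le := hg.integral_le.trans h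

lemma Cone.rpow (hβ0 : 0 ≤ β) (hβ : β ≤ 1 / 2) : Cone β 2 (fun x => x ^ (-β)) where
  measurable := by fun_prop
  nonneg x hx := Real.rpow_nonneg hx.1.le _
  antitoneOn x hx x' _ h := Real.rpow_le_rpow_of_nonpos hx.1 h (by linarith)
  monotoneOn x hx x' hx' h := by
    simp only
    rw [← Real.rpow_add hx.1, ← Real.rpow_add hx'.1]
    simpa using h
  le_rpow x hx := by
    have := Real.rpow_nonneg hx.1.le (-β)
    linarith
  integral_le := integral_rpow_neg_le hβ

end Transfer

end Intermittent

/-! ### Memory loss by coupling. -/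

namespace Intermittent

/-- The transfer operator of the composition `T_{α_n} ∘ ⋯ ∘ T_{α_1}`. -/
noncomputable def transferIter (α : ℕ → ℝ) : ℕ → (ℝ → ℝ) → ℝ → ℝ
  | 0, g => g
  | n + 1, g => transfer (α (n + 1)) (transferIter α n g)

/-- The pointwise envelope of the memory loss after `n` steps. -/
noncomputable def envelope (β : ℝ) (n : ℕ) (x : ℝ) : ℝ :=
  min (x ^ (-β)) (((n : ℝ) + 1) ^ (-(1 / β - 1)) / x)

/-- The rate of memory loss. -/
noncomputable def rate (β : ℝ) (n : ℕ) : ℝ :=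
  ((n : ℝ) + 1) ^ (-(1 / β - 1)) * (1 + Real.log (n + 1))

variable {β M : ℝ} {α : ℕ → ℝ} {g : ℝ → ℝ}

lemma Cone.transferIter (hβ : β ≤ 1 / 2) (hα : Admissible β α) (hg : Cone β M g) (n : ℕ) :
    Cone β M (transferIter α n g) := by
  induction n with
  | zero => exact hg
  | succ n ih => exact ih.transfer (hα _ (by omega)).1 (hα _ (by omega)).2 hβ

lemma integral_rpow_Ioc {z s : ℝ} (hz : 0 ≤ z) (hs : -1 < s) :
    ∫ x in Set.Ioc (0 : ℝ) z, x ^ s = z ^ (s + 1) / (s + 1) := by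
  rw [← intervalIntegral.integral_of_le hz, integral_rpow (Or.inl hs),
    Real.zero_rpow (by linarith), sub_zero]

/-- The mass of a function of the cone is controlled by its value at `1`. -/
lemma Shape.integral_le_of_value (hβ0 : 0 < β) (hβ : β ≤ 1 / 2) (hM : 0 < M) (hg : Shape β g)
    (hle : ∀ x ∈ Set.Ioc (0 : ℝ) 1, g x ≤ 6 * M * x ^ (-β)) :
    ∫ x in Set.Ioc (0 : ℝ) 1, g x ≤
      6 * M * ((1 / (1 - β) + 1 / β) * (g 1 / (6 * M)) ^ (1 - β)) := by
  have hi : IntegrableOn g (Set.Ioc 0 1) :=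
    integrableOn_of_le_rpow (β := β) (by linarith) hg.measurable
      fun x hx => by rw [abs_of_nonneg (hg.nonneg x hx)]; exact hle x hx
  have h1 : (1 : ℝ) ∈ Set.Ioc (0 : ℝ) 1 := by simp
  have hval : ∀ x ∈ Set.Ioc (0 : ℝ) 1, g x ≤ g 1 * x ^ (-β - 1) := by
    intro x hx
    have h2 := hg.monotoneOn hx h1 hx.2
    simp only [Real.one_rpow, one_mul] at h2
    have h3 : (-β - 1 : ℝ) = -(β + 1) := by ring
    rw [h3, Real.rpow_neg hx.1.le, ← div_eq_mul_inv, le_div_iff₀ (Real.rpow_pos_of_pos hx.1 _)]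
    linarith
  have hs0 : 0 ≤ g 1 := hg.nonneg 1 h1
  have hc0 : 0 ≤ 1 / (1 - β) + 1 / β := by
    have : 0 < 1 - β := by linarith
    positivity
  rcases hs0.eq_or_lt with hs | hs
  · have h0 : ∫ x in Set.Ioc (0 : ℝ) 1, g x ≤ 0 :=
      setIntegral_nonpos measurableSet_Ioc fun x hx => by
        have := hval x hx
        rwa [← hs, zero_mul] at this
    refine h0.trans ?_
    have : 0 ≤ (g 1 / (6 * M)) ^ (1 - β) := Real.rpow_nonneg (by positivity) _
    positivity
  -- At this point the two bounds `6 * M * x ^ (-β)` and `g 1 * x ^ (-β - 1)` cross.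
  set z := g 1 / (6 * M) with hz
  have hz0 : 0 < z := by positivity
  have hz1 : z ≤ 1 := by
    rw [hz, div_le_one (by positivity)]
    simpa using hle 1 h1
  have hz6 : g 1 = 6 * M * z := by rw [hz]; field_simp
  have hsplit : Set.Ioc (0 : ℝ) 1 = Set.Ioc 0 z ∪ Set.Ioc z 1 :=
    (Set.Ioc_union_Ioc_eq_Ioc hz0.le hz1).symm
  have hsub1 : Set.Ioc 0 z ⊆ Set.Ioc (0 : ℝ) 1 := Set.Ioc_subset_Ioc_right hz1
  have hsub2 : Set.Ioc z 1 ⊆ Set.Ioc (0 : ℝ) 1 := Set.Ioc_subset_Ioc_left hz0.le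
  have e1 : ∫ x in Set.Ioc (0 : ℝ) z, g x ≤ 6 * M * (z ^ (1 - β) / (1 - β)) := by
    calc _ ≤ ∫ x in Set.Ioc (0 : ℝ) z, 6 * M * x ^ (-β) :=
          setIntegral_mono_on (hi.mono_set hsub1)
            (((integrableOn_rpow_neg (by linarith)).mono_set hsub1).const_mul _) measurableSet_Ioc
            fun x hx => hle x (hsub1 hx)
      _ = _ := by
          rw [integral_const_mul, integral_rpow_Ioc hz0.le (by linarith)]
          ring_nf
  have e2 : ∫ x in Set.Ioc z 1, g x ≤ 6 * M * (z ^ (1 - β) / β) := by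
    have hInt : IntegrableOn (fun x : ℝ => g 1 * x ^ (-β - 1)) (Set.Ioc z 1) := by
      have : IntegrableOn (fun x : ℝ => x ^ (-β - 1)) (Set.Ioc z 1) := by
        rw [← intervalIntegrable_iff_integrableOn_Ioc_of_le hz1]
        refine intervalIntegral.intervalIntegrable_rpow (Or.inr ?_)
        rw [Set.uIcc_of_le hz1]
        exact fun h => absurd h.1 (not_le.2 hz0)
      exact this.const_mul _
    calc _ ≤ ∫ x in Set.Ioc z 1, g 1 * x ^ (-β - 1) :=
          setIntegral_mono_on (hi.mono_set hsub2) hInt measurableSet_Ioc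
            fun x hx => hval x (hsub2 hx)
      _ = g 1 * ((z ^ (-β) - 1) / β) := by
          rw [integral_const_mul, ← intervalIntegral.integral_of_le hz1,
            integral_rpow (Or.inr ⟨by linarith, by
              rw [Set.uIcc_of_le hz1]; exact fun h => absurd h.1 (not_le.2 hz0)⟩)]
          have : (-β - 1 + 1 : ℝ) = -β := by ring
          rw [this, Real.one_rpow, div_neg, ← neg_div]
          ring_nf
      _ ≤ g 1 * (z ^ (-β) / β) := by gcongr; linarith
      _ = 6 * M * (z ^ (1 - β) / β) := by
          have : z * z ^ (-β) = z ^ (1 - β) := by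
            rw [sub_eq_add_neg, Real.rpow_add hz0, Real.rpow_one]
          rw [hz6, ← this]; ring
  rw [hsplit, setIntegral_union (by
      rw [Set.disjoint_left]; exact fun y hy hy' => absurd hy.2 (not_le.2 hy'.1))
    measurableSet_Ioc (hi.mono_set hsub1) (hi.mono_set hsub2)]
  calc _ ≤ 6 * M * (z ^ (1 - β) / (1 - β)) + 6 * M * (z ^ (1 - β) / β) := add_le_add e1 e2
    _ = _ := by ring

/-- Discrete form of the differential inequality `p' ≤ -c p ^ (1 + κ)`: along it `p ^ (-κ)` grows at
least linearly. -/
lemma rpow_neg_add_le_of_le_sub {κ c p p' : ℝ} (hκ : 0 < κ) (hc : 0 < c) (hp : 0 < p)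
    (hp' : 0 < p') (h : p' ≤ p - c * p ^ (1 + κ)) : p ^ (-κ) + κ * c ≤ p' ^ (-κ) := by
  set u := c * p ^ κ with hu
  have hpk : 0 < p ^ κ := Real.rpow_pos_of_pos hp κ
  have hu0 : 0 < u := by positivity
  have h1 : p' ≤ p * (1 - u) := by
    rw [Real.rpow_add hp, Real.rpow_one] at h
    calc p' ≤ _ := h
      _ = _ := by rw [hu]; ring
  have hu1 : 0 < 1 - u := by
    by_contra hcon
    push Not at hcon
    have := mul_nonpos_of_nonneg_of_nonpos hp.le hcon
    linarith
  have h2 : (p * (1 - u)) ^ (-κ) ≤ p' ^ (-κ) :=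
    Real.rpow_le_rpow_of_nonpos hp' h1 (by linarith)
  have h3 : 1 + κ * u ≤ (1 - u) ^ (-κ) := by
    rw [Real.rpow_def_of_pos hu1]
    have h4 : Real.log (1 - u) ≤ -u := by
      have := Real.log_le_sub_one_of_pos hu1
      linarith
    have h5 := Real.add_one_le_exp (Real.log (1 - u) * -κ)
    nlinarith
  have h4 : p ^ (-κ) * p ^ κ = 1 := by rw [← Real.rpow_add hp]; simp
  have hpk' : 0 < p ^ (-κ) := Real.rpow_pos_of_pos hp _
  calc p ^ (-κ) + κ * c = p ^ (-κ) * (1 + κ * u) := by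
        rw [hu]; linear_combination (-κ * c) * h4
    _ ≤ p ^ (-κ) * (1 - u) ^ (-κ) := mul_le_mul_of_nonneg_left h3 hpk'.le
    _ = (p * (1 - u)) ^ (-κ) := (Real.mul_rpow hp.le hu1.le).symm
    _ ≤ _ := h2

/-- Coupling: the images of two functions of equal mass differ by functions of the same shape
whose mass decays polynomially. -/
lemma exists_residual (hβ0 : 0 < β) (hβ : β ≤ 1 / 2) (hα : Admissible β α) (hM : 0 < M)
    {g g' : ℝ → ℝ} (hg : Cone β M g) (hg' : Cone β M g')
    (heq : ∫ x in Set.Ioc (0 : ℝ) 1, g x = ∫ x in Set.Ioc (0 : ℝ) 1, g' x) (n : ℕ) :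
    ∃ r r' : ℝ → ℝ, Shape β r ∧ Shape β r' ∧
      (∀ x ∈ Set.Ioc (0 : ℝ) 1, transferIter α n g x - transferIter α n g' x = r x - r' x) ∧
      (∀ x ∈ Set.Ioc (0 : ℝ) 1, r x ≤ transferIter α n g x) ∧
      (∀ x ∈ Set.Ioc (0 : ℝ) 1, r' x ≤ transferIter α n g' x) ∧
      (∫ x in Set.Ioc (0 : ℝ) 1, r x = ∫ x in Set.Ioc (0 : ℝ) 1, r' x) ∧
      (0 < ∫ x in Set.Ioc (0 : ℝ) 1, r x →
        1 + β / (1 - β) * (1 / 4 * (1 / (1 - β) + 1 / β) ^ (-(1 / (1 - β)))) * n ≤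
          ((∫ x in Set.Ioc (0 : ℝ) 1, r x) / (6 * M)) ^ (-(β / (1 - β)))) := by
  have hb1 : 0 < 1 - β := by linarith
  set κ := β / (1 - β) with hκ
  have hκ0 : 0 < κ := by positivity
  have hκ1 : 1 / (1 - β) = 1 + κ := by rw [hκ]; field_simp; ring
  set c₀ := 1 / (1 - β) + 1 / β with hc₀
  have hc₀0 : 0 < c₀ := by positivity
  set c := 1 / 4 * c₀ ^ (-(1 / (1 - β))) with hc
  have hc0 : 0 < c := by positivity
  have hInt : ∀ (n : ℕ) (h r : ℝ → ℝ), Cone β M h → Shape β r →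
      (∀ x ∈ Set.Ioc (0 : ℝ) 1, r x ≤ transferIter α n h x) →
      (∀ x ∈ Set.Ioc (0 : ℝ) 1, r x ≤ 6 * M * x ^ (-β)) ∧ IntegrableOn r (Set.Ioc 0 1) := by
    intro n h r hh hr hle
    have h1 : ∀ x ∈ Set.Ioc (0 : ℝ) 1, r x ≤ 6 * M * x ^ (-β) := fun x hx =>
      (hle x hx).trans ((hh.transferIter hβ hα n).le_rpow x hx)
    exact ⟨h1, integrableOn_of_le_rpow (β := β) (by linarith) hr.measurable fun x hx => by
      rw [abs_of_nonneg (hr.nonneg x hx)]; exact h1 x hx⟩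
  induction n with
  | zero =>
    refine ⟨g, g', hg.toShape, hg'.toShape, fun _ _ => rfl, fun _ _ => le_rfl, fun _ _ => le_rfl,
      heq, fun hpos => ?_⟩
    simp only [Nat.cast_zero, mul_zero, add_zero]
    refine Real.one_le_rpow_of_pos_of_le_one_of_nonpos (by positivity) ?_ (by linarith)
    rw [div_le_one (by positivity)]
    linarith [hg.integral_le]
  | succ n ih =>
    obtain ⟨r, r', hr, hr', hdiff, hle, hle', hmass, hbound⟩ := ih
    have hα0 := (hα (n + 1) (by omega)).1
    have hαβ := (hα (n + 1) (by omega)).2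
    have h1 : (1 : ℝ) ∈ Set.Ioc (0 : ℝ) 1 := by simp
    -- The largest constant that `transfer_sub` allows to be removed from both residuals at once. It
    -- cancels in their difference.
    set δ := min (r 1) (r' 1) / 4 with hδ
    have hδ0 : 0 ≤ δ := div_nonneg (le_min (hr.nonneg 1 h1) (hr'.nonneg 1 h1)) (by norm_num)
    have hδr : 4 * δ ≤ r 1 := by rw [hδ]; linarith [min_le_left (r 1) (r' 1)]
    have hδr' : 4 * δ ≤ r' 1 := by rw [hδ]; linarith [min_le_right (r 1) (r' 1)]
    obtain ⟨hb, hi⟩ := hInt n g r hg hr hle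
    obtain ⟨hb', hi'⟩ := hInt n g' r' hg' hr' hle'
    have htr := integral_transfer_eq hα0 hi
    have htr' := integral_transfer_eq hα0 hi'
    have hmassδ : ∀ (s : ℝ → ℝ), IntegrableOn s (Set.Ioc 0 1) →
        ∫ x in Set.Ioc (0 : ℝ) 1, (s x - δ) = (∫ x in Set.Ioc (0 : ℝ) 1, s x) - δ := by
      intro s hs
      rw [integral_sub hs (by simp)]; simp
    have htmono : ∀ (s t : ℝ → ℝ), (∀ x ∈ Set.Ioc (0 : ℝ) 1, s x ≤ t x) →
        ∀ x ∈ Set.Ioc (0 : ℝ) 1, transfer (α (n + 1)) s x ≤ transfer (α (n + 1)) t x := by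
      intro s t hst x hx
      have hy := leftInv_mem_Ioc hα0 hx
      have := div_le_div_of_nonneg_right (hst _ hy) (leftDeriv_pos hα0 hy.1.le).le
      have := hst _ (rightInv_mem_Ioc hx)
      unfold transfer
      linarith
    refine ⟨fun x => transfer (α (n + 1)) r x - δ, fun x => transfer (α (n + 1)) r' x - δ,
      hr.transfer_sub hα0 hαβ hδ0 hδr, hr'.transfer_sub hα0 hαβ hδ0 hδr', fun x hx => ?_,
      fun x hx => ?_, fun x hx => ?_, ?_, ?_⟩
    · have e1 := hdiff _ (leftInv_mem_Ioc hα0 hx)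
      have e2 := hdiff _ (rightInv_mem_Ioc hx)
      simp only [transferIter, transfer]
      have e3 := congrArg (fun v => v / leftDeriv (α (n + 1)) (leftInv (α (n + 1)) x)) e1
      simp only [sub_div] at e3
      linarith
    · exact (sub_le_self _ hδ0).trans (htmono _ _ hle x hx)
    · exact (sub_le_self _ hδ0).trans (htmono _ _ hle' x hx)
    · rw [hmassδ _ htr.1, hmassδ _ htr'.1, htr.2, htr'.2, hmass]
    · rw [hmassδ _ htr.1, htr.2]
      set m := ∫ x in Set.Ioc (0 : ℝ) 1, r x with hm
      -- The mass has to be positive because `0 ^ (-κ)` is `0` by convention, so the linear lower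
      -- bound would fail for an exhausted residual.
      intro hpos
      have hm0 : 0 < m := by linarith
      -- Inverting the bound of the mass by the value at `1` bounds that value from below by a
      -- multiple of `m ^ (1 + κ)`. The factor `4` cancels against the one in `δ`.
      have hval : ∀ s : ℝ, 0 ≤ s → m ≤ 6 * M * (c₀ * (s / (6 * M)) ^ (1 - β)) →
          6 * M * (4 * (c * (m / (6 * M)) ^ (1 + κ))) ≤ s := by
        intro s hs hms
        have h2 : m / (6 * M) / c₀ ≤ (s / (6 * M)) ^ (1 - β) := by
          rw [div_le_iff₀ hc₀0, div_le_iff₀ (by positivity)]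
          linarith
        have h3 : (m / (6 * M) / c₀) ^ (1 / (1 - β)) ≤ s / (6 * M) := by
          calc _ ≤ ((s / (6 * M)) ^ (1 - β)) ^ (1 / (1 - β)) :=
                Real.rpow_le_rpow (by positivity) h2 (by positivity)
            _ = s / (6 * M) := by
                rw [← Real.rpow_mul (by positivity), mul_one_div_cancel hb1.ne', Real.rpow_one]
        rw [Real.div_rpow (by positivity) hc₀0.le, le_div_iff₀ (by positivity)] at h3
        calc _ = (m / (6 * M)) ^ (1 / (1 - β)) / c₀ ^ (1 / (1 - β)) * (6 * M) := by
              rw [hc, ← hκ1, Real.rpow_neg hc₀0.le]; ring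
          _ ≤ s := h3
      have hδm : 6 * M * (c * (m / (6 * M)) ^ (1 + κ)) ≤ δ := by
        have v1 := hval (r 1) (hr.nonneg 1 h1) (hr.integral_le_of_value hβ0 hβ hM hb)
        have v2 := hval (r' 1) (hr'.nonneg 1 h1)
          (hmass ▸ hr'.integral_le_of_value hβ0 hβ hM hb')
        have := le_min v1 v2
        rw [hδ]
        linarith
      have hstep := rpow_neg_add_le_of_le_sub (p := m / (6 * M)) (p' := (m - δ) / (6 * M))
        hκ0 hc0 (by positivity) (by positivity) (by
          rw [sub_div]
          have : c * (m / (6 * M)) ^ (1 + κ) ≤ δ / (6 * M) := by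
            rw [le_div_iff₀ (by positivity)]; linarith
          linarith)
      have := hbound hm0
      push_cast
      linarith

/-- Pointwise memory loss with polynomial rate. -/
theorem exists_memory_loss (hβ0 : 0 < β) (hβ : β ≤ 1 / 2) :
    ∃ C : ℝ, 0 < C ∧ ∀ (α : ℕ → ℝ) (M : ℝ) (g g' : ℝ → ℝ), Admissible β α → Cone β M g →
      Cone β M g' → ∫ x in Set.Ioc (0 : ℝ) 1, g x = ∫ x in Set.Ioc (0 : ℝ) 1, g' x →
      ∀ n, ∀ x ∈ Set.Ioc (0 : ℝ) 1,
        |transferIter α n g x - transferIter α n g' x| ≤ C * M * envelope β n x := by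
  have hb1 : 0 < 1 - β := by linarith
  set κ := β / (1 - β) with hκ
  have hκ0 : 0 < κ := by positivity
  set c := κ * (1 / 4 * (1 / (1 - β) + 1 / β) ^ (-(1 / (1 - β)))) with hc
  have hc0 : 0 < c := by positivity
  have hγ : 1 / β - 1 = 1 / κ := by rw [hκ]; field_simp
  have hγ0 : 0 < 1 / κ := by positivity
  -- Then `d * (n + 1) ≤ 1 + c * n`, which covers `n = 0` as well.
  set d := min 1 c with hd
  have hd0 : 0 < d := lt_min one_pos hc0
  have hd1 : 1 ≤ d ^ (-(1 / κ)) :=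
    Real.one_le_rpow_of_pos_of_le_one_of_nonpos hd0 (min_le_left _ _) (by linarith)
  refine ⟨6 * d ^ (-(1 / κ)), by positivity, fun α M g g' hα hg hg' heq n x hx => ?_⟩
  have hgn := hg.transferIter hβ hα n
  have hgn' := hg'.transferIter hβ hα n
  have hM0 := hg.nonneg_mass
  have hx0 := hx.1
  have hxb : 0 ≤ x ^ (-β) := Real.rpow_nonneg hx.1.le _
  have hfirst : |transferIter α n g x - transferIter α n g' x| ≤ 6 * M * x ^ (-β) := by
    have h1 := hgn.le_rpow x hx
    have h2 := hgn'.le_rpow x hx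
    have h3 := hgn.nonneg x hx
    have h4 := hgn'.nonneg x hx
    rw [abs_le]; constructor <;> linarith
  have h6 : 6 * M ≤ 6 * d ^ (-(1 / κ)) * M := by nlinarith
  have hn0 : (0 : ℝ) < (n : ℝ) + 1 := by positivity
  rcases hM0.eq_or_lt with hM | hM
  · rw [← hM] at hfirst ⊢
    simpa using hfirst
  obtain ⟨r, r', hr, hr', hdiff, hle, hle', hmass, hbound⟩ :=
    exists_residual hβ0 hβ hα hM hg hg' heq n
  have hi : ∀ (h s : ℝ → ℝ), Cone β M h → Shape β s →
      (∀ x ∈ Set.Ioc (0 : ℝ) 1, s x ≤ transferIter α n h x) → IntegrableOn s (Set.Ioc 0 1) := by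
    intro h s hh hs hsle
    exact integrableOn_of_le_rpow (β := β) (by linarith) hs.measurable fun x hx => by
      rw [abs_of_nonneg (hs.nonneg x hx)]
      exact (hsle x hx).trans ((hh.transferIter hβ hα n).le_rpow x hx)
  set m := ∫ x in Set.Ioc (0 : ℝ) 1, r x with hm
  have hm6 : m ≤ 6 * d ^ (-(1 / κ)) * M * ((n : ℝ) + 1) ^ (-(1 / κ)) := by
    rcases le_or_gt m 0 with h | h
    · exact h.trans (by positivity)
    have h1 : d * ((n : ℝ) + 1) ≤ (m / (6 * M)) ^ (-κ) := by
      refine le_trans ?_ (hbound h)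
      rw [← hκ, ← hc]
      have : d ≤ 1 := min_le_left _ _
      have h2 : d ≤ c := min_le_right _ _
      have h3 : d * n ≤ c * n := mul_le_mul_of_nonneg_right h2 (by positivity)
      linarith
    have h2 : ((m / (6 * M)) ^ (-κ)) ^ (-(1 / κ)) = m / (6 * M) := by
      rw [← Real.rpow_mul (by positivity), neg_mul_neg, mul_one_div_cancel hκ0.ne', Real.rpow_one]
    have h3 : m / (6 * M) ≤ (d * ((n : ℝ) + 1)) ^ (-(1 / κ)) := by
      rw [← h2]
      exact Real.rpow_le_rpow_of_nonpos (by positivity) h1 (by linarith)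
    rw [Real.mul_rpow hd0.le hn0.le, div_le_iff₀ (by positivity)] at h3
    linarith
  -- The residuals are decreasing, so their mass controls them pointwise away from the origin.
  have hrx : r x ≤ m / x := by
    rw [le_div_iff₀ hx.1, mul_comm]
    exact hr.mul_le_integral (hi g r hg hr hle) hx
  have hrx' : r' x ≤ m / x := by
    rw [le_div_iff₀ hx.1, mul_comm, hmass]
    exact hr'.mul_le_integral (hi g' r' hg' hr' hle') hx
  have hsecond : |transferIter α n g x - transferIter α n g' x| ≤ m / x := by
    rw [hdiff x hx, abs_le]
    have := hr.nonneg x hx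
    have := hr'.nonneg x hx
    constructor <;> linarith
  unfold envelope
  rw [mul_min_of_nonneg _ _ (by positivity)]
  refine le_min (hfirst.trans (mul_le_mul_of_nonneg_right h6 hxb)) (hsecond.trans ?_)
  rw [hγ, ← mul_div_assoc]
  exact div_le_div_of_nonneg_right hm6 hx.1.le

lemma envelope_nonneg {n : ℕ} {x : ℝ} (hx : x ∈ Set.Ioc (0 : ℝ) 1) : 0 ≤ envelope β n x := by
  have := hx.1
  unfold envelope
  positivity

lemma measurable_envelope (n : ℕ) : Measurable (envelope β n) := by
  unfold envelope
  fun_prop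

lemma integrableOn_envelope (hβ : β < 1) (n : ℕ) : IntegrableOn (envelope β n) (Set.Ioc 0 1) :=
  integrableOn_of_le_rpow (C := 1) hβ (measurable_envelope n) fun x hx => by
    rw [abs_of_nonneg (envelope_nonneg hx), one_mul]
    exact min_le_left _ _

lemma rate_nonneg (n : ℕ) : 0 ≤ rate β n := by
  have : 0 ≤ Real.log ((n : ℝ) + 1) := Real.log_nonneg (by linarith [n.cast_nonneg (α := ℝ)])
  unfold rate
  positivity

lemma integral_envelope_le (hβ0 : 0 < β) (hβ : β ≤ 1 / 2) (n : ℕ) :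
    ∫ x in Set.Ioc (0 : ℝ) 1, envelope β n x ≤ (2 + 1 / β) * rate β n := by
  have hn0 : (0 : ℝ) < (n : ℝ) + 1 := by positivity
  have hn1 : (1 : ℝ) ≤ (n : ℝ) + 1 := by linarith [n.cast_nonneg (α := ℝ)]
  -- The two expressions in the envelope agree at `z`. The part beyond `z` is the integral of `ρ /
  -- x`, the source of the logarithm in `rate`.
  set z : ℝ := ((n : ℝ) + 1) ^ (-(1 / β)) with hz
  have hz0 : 0 < z := Real.rpow_pos_of_pos hn0 _
  have hz1 : z ≤ 1 := Real.rpow_le_one_of_one_le_of_nonpos hn1 (by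
    have : 0 < 1 / β := by positivity
    linarith)
  set ρ : ℝ := ((n : ℝ) + 1) ^ (-(1 / β - 1)) with hρ
  have hρ0 : 0 < ρ := Real.rpow_pos_of_pos hn0 _
  have hi := integrableOn_envelope (β := β) (by linarith) n
  have hsub1 : Set.Ioc 0 z ⊆ Set.Ioc (0 : ℝ) 1 := Set.Ioc_subset_Ioc_right hz1
  have hsub2 : Set.Ioc z 1 ⊆ Set.Ioc (0 : ℝ) 1 := Set.Ioc_subset_Ioc_left hz0.le
  have hzρ : z ^ (1 - β) = ρ := by
    rw [hz, hρ, ← Real.rpow_mul hn0.le]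
    congr 1
    field_simp
  have e1 : ∫ x in Set.Ioc (0 : ℝ) z, envelope β n x ≤ 2 * ρ := by
    calc _ ≤ ∫ x in Set.Ioc (0 : ℝ) z, x ^ (-β) :=
          setIntegral_mono_on (hi.mono_set hsub1)
            ((integrableOn_rpow_neg (by linarith)).mono_set hsub1) measurableSet_Ioc
            fun x hx => min_le_left _ _
      _ = ρ / (1 - β) := by
          rw [integral_rpow_Ioc hz0.le (by linarith), ← hzρ]
          ring_nf
      _ ≤ 2 * ρ := by
          rw [div_le_iff₀ (by linarith)]; nlinarith
  have e2 : ∫ x in Set.Ioc z 1, envelope β n x ≤ ρ * (1 / β * Real.log ((n : ℝ) + 1)) := by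
    have hnot : (0 : ℝ) ∉ Set.uIcc z 1 := by
      rw [Set.uIcc_of_le hz1]; exact fun h => absurd h.1 (not_le.2 hz0)
    have hInt : IntegrableOn (fun x : ℝ => ρ * x⁻¹) (Set.Ioc z 1) := by
      have : IntegrableOn (fun x : ℝ => x⁻¹) (Set.Ioc z 1) := by
        rw [← intervalIntegrable_iff_integrableOn_Ioc_of_le hz1]
        exact intervalIntegral.intervalIntegrable_inv (fun x hx h => hnot (h ▸ hx)) continuousOn_id
      exact this.const_mul _
    calc _ ≤ ∫ x in Set.Ioc z 1, ρ * x⁻¹ :=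
          setIntegral_mono_on (hi.mono_set hsub2) hInt measurableSet_Ioc
            fun x hx => (min_le_right _ _).trans (le_of_eq (div_eq_mul_inv _ _))
      _ = _ := by
          rw [integral_const_mul, ← intervalIntegral.integral_of_le hz1, integral_inv hnot,
            one_div z, Real.log_inv, hz, Real.log_rpow hn0]
          ring
  have hlog : 0 ≤ Real.log ((n : ℝ) + 1) := Real.log_nonneg hn1
  rw [← Set.Ioc_union_Ioc_eq_Ioc hz0.le hz1, setIntegral_union (by
      rw [Set.disjoint_left]; exact fun y hy hy' => absurd hy.2 (not_le.2 hy'.1))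
    measurableSet_Ioc (hi.mono_set hsub1) (hi.mono_set hsub2)]
  have hrate : rate β n = ρ * (1 + Real.log (n + 1)) := rfl
  rw [hrate]
  have hb : 0 < 1 / β := by positivity
  calc _ ≤ 2 * ρ + ρ * (1 / β * Real.log ((n : ℝ) + 1)) := add_le_add e1 e2
    _ ≤ _ := by nlinarith [mul_nonneg hρ0.le hlog, mul_nonneg hρ0.le hb.le]

end Intermittent

/-! ### Differences of cone functions and multiplication by Lipschitz functions. -/

namespace Intermittent

variable {β M : ℝ} {α : ℕ → ℝ} {g : ℝ → ℝ}

lemma transferIter_linear (α : ℕ → ℝ) (n : ℕ) (a b : ℝ) (u v : ℝ → ℝ) (x : ℝ) :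
    transferIter α n (fun y => a * u y + b * v y) x
      = a * transferIter α n u x + b * transferIter α n v x := by
  induction n generalizing x with
  | zero => rfl
  | succ n ih => simp only [transferIter, transfer, ih]; ring

lemma transferIter_congr (hα : Admissible β α) {u v : ℝ → ℝ}
    (h : ∀ x ∈ Set.Ioc (0 : ℝ) 1, u x = v x) (n : ℕ) :
    ∀ x ∈ Set.Ioc (0 : ℝ) 1, transferIter α n u x = transferIter α n v x := by
  induction n with
  | zero => exact h
  | succ n ih =>
    intro x hx
    have hα0 := (hα (n + 1) (by omega)).1
    simp only [transferIter, transfer, ih _ (leftInv_mem_Ioc hα0 hx), ih _ (rightInv_mem_Ioc hx)]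

/-- Iterated duality, with a test function that may depend on the image point. -/
lemma integral_transferIter (hα : Admissible β α) (n : ℕ) (F : ℝ → ℝ → ℝ)
    (hF : IntegrableOn (fun y => F (comp α n y) y) (Set.Ioc 0 1)) :
    IntegrableOn (fun x => transferIter α n (F x) x) (Set.Ioc 0 1) ∧
      ∫ x in Set.Ioc (0 : ℝ) 1, transferIter α n (F x) x
        = ∫ y in Set.Ioc (0 : ℝ) 1, F (comp α n y) y := by
  induction n generalizing F with
  | zero => exact ⟨hF, rfl⟩
  | succ n ih =>
    obtain ⟨h1, h2⟩ := ih (fun x => F (map (α (n + 1)) x)) hF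
    obtain ⟨h3, h4⟩ := integral_transfer (hα (n + 1) (by omega)).1
      (fun x => transferIter α n (F x)) h1
    exact ⟨h3, h4.trans h2⟩

/-- Differences of functions of the cone. -/
def IsConeDiff (β B : ℝ) (u : ℝ → ℝ) : Prop :=
  ∃ g g' : ℝ → ℝ, Cone β B g ∧ Cone β B g' ∧ ∀ x ∈ Set.Ioc (0 : ℝ) 1, u x = g x - g' x

namespace IsConeDiff

variable {B B' : ℝ} {u v : ℝ → ℝ}

lemma nonneg (hu : IsConeDiff β B u) : 0 ≤ B := by
  obtain ⟨g, g', hg, -, -⟩ := hu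
  exact hg.nonneg_mass

lemma integrableOn (hβ : β < 1) (hu : IsConeDiff β B u) : IntegrableOn u (Set.Ioc 0 1) := by
  obtain ⟨g, g', hg, hg', h⟩ := hu
  exact ((hg.integrableOn hβ).sub (hg'.integrableOn hβ)).congr_fun
    (fun x hx => (h x hx).symm) measurableSet_Ioc

lemma mono (hu : IsConeDiff β B u) (h : B ≤ B') : IsConeDiff β B' u := by
  obtain ⟨g, g', hg, hg', hu⟩ := hu
  exact ⟨g, g', hg.mono h, hg'.mono h, hu⟩

lemma sub (hβ : β < 1) (hu : IsConeDiff β B u) (hv : IsConeDiff β B' v) :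
    IsConeDiff β (B + B') (fun x => u x - v x) := by
  obtain ⟨g, g', hg, hg', hu⟩ := hu
  obtain ⟨k, k', hk, hk', hv⟩ := hv
  exact ⟨_, _, hg.add hβ hk', hg'.add hβ hk, fun x hx => by
    simp only [hu x hx, hv x hx]; ring⟩

lemma const_mul (c : ℝ) (hu : IsConeDiff β B u) : IsConeDiff β (|c| * B) (fun x => c * u x) := by
  obtain ⟨g, g', hg, hg', hu⟩ := hu
  rcases le_total 0 c with hc | hc
  · rw [abs_of_nonneg hc]
    exact ⟨_, _, hg.const_mul hc, hg'.const_mul hc, fun x hx => by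
      simp only [hu x hx]; ring⟩
  · rw [abs_of_nonpos hc]
    exact ⟨_, _, hg'.const_mul (neg_nonneg.2 hc), hg.const_mul (neg_nonneg.2 hc),
      fun x hx => by simp only [hu x hx]; ring⟩

lemma transferIter (hβ : β ≤ 1 / 2) (hα : Admissible β α) (hu : IsConeDiff β B u) (n : ℕ) :
    IsConeDiff β B (transferIter α n u) := by
  obtain ⟨g, g', hg, hg', hu⟩ := hu
  refine ⟨_, _, hg.transferIter hβ hα n, hg'.transferIter hβ hα n, fun x hx => ?_⟩
  rw [transferIter_congr hα (v := fun y => 1 * g y + (-1) * g' y)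
    (fun y hy => by rw [hu y hy]; ring) n x hx, transferIter_linear]
  ring

lemma abs_integral_le (hβ : β < 1) (hu : IsConeDiff β B u) :
    |∫ x in Set.Ioc (0 : ℝ) 1, u x| ≤ B := by
  obtain ⟨g, g', hg, hg', hu⟩ := hu
  rw [setIntegral_congr_fun measurableSet_Ioc hu,
    integral_sub (hg.integrableOn hβ) (hg'.integrableOn hβ)]
  have h1 := setIntegral_nonneg (μ := volume) measurableSet_Ioc hg.nonneg
  have h2 := setIntegral_nonneg (μ := volume) measurableSet_Ioc hg'.nonneg
  have h3 := hg.integral_le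
  have h4 := hg'.integral_le
  rw [abs_le]; constructor <;> linarith

end IsConeDiff

lemma Cone.isConeDiff (hg : Cone β M g) : IsConeDiff β M g := by
  refine ⟨g, fun x => 0 * g x, hg, (hg.const_mul le_rfl).mono ?_, fun x _ => by ring⟩
  rw [zero_mul]; exact hg.nonneg_mass

theorem exists_memory_loss_coneDiff (hβ0 : 0 < β) (hβ : β ≤ 1 / 2) :
    ∃ C : ℝ, 0 < C ∧ ∀ (α : ℕ → ℝ) (B : ℝ) (u : ℝ → ℝ), Admissible β α → IsConeDiff β B u →
      ∫ x in Set.Ioc (0 : ℝ) 1, u x = 0 → ∀ n, ∀ x ∈ Set.Ioc (0 : ℝ) 1,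
        |transferIter α n u x| ≤ C * B * envelope β n x := by
  obtain ⟨C, hC, h⟩ := exists_memory_loss hβ0 hβ
  refine ⟨C, hC, fun α B u hα hu h0 n x hx => ?_⟩
  obtain ⟨g, g', hg, hg', hu⟩ := hu
  rw [setIntegral_congr_fun measurableSet_Ioc hu,
    integral_sub (hg.integrableOn (by linarith)) (hg'.integrableOn (by linarith)),
    sub_eq_zero] at h0
  rw [transferIter_congr hα (v := fun y => 1 * g y + (-1) * g' y)
    (fun y hy => by rw [hu y hy]; ring) n x hx, transferIter_linear]
  have := h α B g g' hα hg hg' h0 n x hx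
  convert this using 2
  ring

section Power

variable {x x' : ℝ}

lemma rpow_one_sub_sub_le (hβ0 : 0 ≤ β) (hx : x ∈ Set.Ioc (0 : ℝ) 1) (hx' : x' ∈ Set.Ioc (0 : ℝ) 1)
    (h : x ≤ x') : x' ^ (1 - β) - x ^ (1 - β) ≤ x' ^ (-β) * (x' - x) := by
  have h1 : x ^ (1 - β) = x * x ^ (-β) := by
    rw [sub_eq_add_neg, Real.rpow_add hx.1, Real.rpow_one]
  have h1' : x' ^ (1 - β) = x' * x' ^ (-β) := by
    rw [sub_eq_add_neg, Real.rpow_add hx'.1, Real.rpow_one]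
  have h2 : x' ^ (-β) ≤ x ^ (-β) := Real.rpow_le_rpow_of_nonpos hx.1 h (by linarith)
  rw [h1, h1']
  nlinarith [hx.1]

lemma sub_le_rpow_one_sub_sub (hβ0 : 0 ≤ β) (hβ : β ≤ 1 / 2) (hx : x ∈ Set.Ioc (0 : ℝ) 1)
    (hx' : x' ∈ Set.Ioc (0 : ℝ) 1) (h : x ≤ x') :
    x' - x ≤ 2 * (x' ^ (1 - β) - x ^ (1 - β)) := by
  set s := x / x' with hs
  have hs1 : s ≤ 1 := (div_le_one hx'.1).2 h
  have hs0 : 0 ≤ s := div_nonneg hx.1.le hx'.1.le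
  have hxs : x = s * x' := by rw [hs, div_mul_cancel₀ _ hx'.1.ne']
  have h1 : s ^ (1 - β) ≤ 1 + (1 - β) * (s - 1) := by
    have := rpow_one_add_le_one_add_mul_self (s := s - 1) (p := 1 - β) (by linarith)
      (by linarith) (by linarith)
    simpa using this
  have h2 : x ^ (1 - β) = s ^ (1 - β) * x' ^ (1 - β) := by
    conv_lhs => rw [hxs]
    exact Real.mul_rpow hs0 hx'.1.le
  have h3 : x' ≤ x' ^ (1 - β) := by
    conv_lhs => rw [← Real.rpow_one x']
    exact Real.rpow_le_rpow_of_exponent_ge hx'.1 hx'.2 (by linarith)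
  have h4 : (1 - s) / 2 ≤ 1 - s ^ (1 - β) := by nlinarith
  have h5 : x' * ((1 - s) / 2) ≤ x' ^ (1 - β) * (1 - s ^ (1 - β)) :=
    mul_le_mul h3 h4 (by linarith) (Real.rpow_nonneg hx'.1.le _)
  rw [h2]
  nlinarith

/-- Both sides are compared with a multiple of `(1 - x / x') * x' ^ (-β)`. The bound lets a multiple
of the decreasing function `x ^ (-β)` repair a failure of monotonicity. -/
lemma le_rpow_neg_sub (hβ0 : 0 < β) (hβ : β ≤ 1 / 2) (hx : x ∈ Set.Ioc (0 : ℝ) 1)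
    (hx' : x' ∈ Set.Ioc (0 : ℝ) 1) (h : x ≤ x') :
    (x' ^ (1 - β) - x ^ (1 - β)) * x' ^ (-β) ≤ 1 / β * (x ^ (-β) - x' ^ (-β)) := by
  set s := x / x' with hs
  have hs1 : s ≤ 1 := (div_le_one hx'.1).2 h
  have hs0 : 0 < s := div_pos hx.1 hx'.1
  have hxs : x = s * x' := by rw [hs, div_mul_cancel₀ _ hx'.1.ne']
  have hp : 0 < x' ^ (-β) := Real.rpow_pos_of_pos hx'.1 _
  have h1 : s ^ β ≤ 1 + β * (s - 1) := by
    have := rpow_one_add_le_one_add_mul_self (s := s - 1) (p := β) (by linarith)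
      (by linarith) (by linarith)
    simpa using this
  have h2 : 1 + β * (1 - s) ≤ s ^ (-β) := by
    rw [Real.rpow_neg hs0.le]
    have hsb : 0 < s ^ β := Real.rpow_pos_of_pos hs0 _
    rw [le_inv_comm₀ (by nlinarith) hsb]
    refine h1.trans ?_
    rw [le_inv_comm₀ (by nlinarith) (by nlinarith), ← one_div,
      le_div_iff₀ (by nlinarith)]
    nlinarith [sq_nonneg (β * (1 - s))]
  have h3 : x ^ (-β) = s ^ (-β) * x' ^ (-β) := by
    conv_lhs => rw [hxs]
    exact Real.mul_rpow hs0.le hx'.1.le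
  have h4 : x' ^ (-β) * x' ≤ 1 := by
    have : x' ^ (-β) * x' = x' ^ (1 - β) := by
      rw [sub_eq_add_neg, Real.rpow_add hx'.1, Real.rpow_one]; ring
    rw [this]
    exact Real.rpow_le_one hx'.1.le hx'.2 (by linarith)
  have h5 := rpow_one_sub_sub_le hβ0.le hx hx' h
  have h6 : x' - x = x' * (1 - s) := by rw [hxs]; ring
  calc _ ≤ x' ^ (-β) * (x' - x) * x' ^ (-β) := mul_le_mul_of_nonneg_right h5 hp.le
    _ = (x' ^ (-β) * x') * ((1 - s) * x' ^ (-β)) := by rw [h6]; ring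
    _ ≤ 1 * ((1 - s) * x' ^ (-β)) :=
        mul_le_mul_of_nonneg_right h4 (mul_nonneg (by linarith) hp.le)
    _ = 1 / β * (β * (1 - s) * x' ^ (-β)) := by field_simp
    _ ≤ 1 / β * (x ^ (-β) - x' ^ (-β)) := by
        refine mul_le_mul_of_nonneg_left ?_ (by positivity)
        rw [h3]
        nlinarith

end Power

/-- Functions whose failure to have the shape of the cone is controlled by increments of
`x ^ (1 - β)` are differences of functions of the cone. -/
lemma isConeDiff_of_almost_shape (hβ0 : 0 < β) (hβ : β ≤ 1 / 2) {u : ℝ → ℝ} {b c : ℝ}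
    (hb : 0 ≤ b) (hc : 0 ≤ c)
    (hum : Measurable u) (hu0 : ∀ x ∈ Set.Ioc (0 : ℝ) 1, 0 ≤ u x)
    (hub : ∀ x ∈ Set.Ioc (0 : ℝ) 1, u x ≤ 6 * b * x ^ (-β))
    (h₁ : ∀ x ∈ Set.Ioc (0 : ℝ) 1, ∀ x' ∈ Set.Ioc (0 : ℝ) 1, x ≤ x' →
      u x' - u x ≤ c * ((x' ^ (1 - β) - x ^ (1 - β)) * x' ^ (-β)))
    (h₂ : ∀ x ∈ Set.Ioc (0 : ℝ) 1, ∀ x' ∈ Set.Ioc (0 : ℝ) 1, x ≤ x' →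
      x ^ (β + 1) * u x - x' ^ (β + 1) * u x' ≤ c * ((x' ^ (1 - β) - x ^ (1 - β)) * x)) :
    IsConeDiff β (12 * b + 2 * (c / β)) u := by
  set l := c / β with hl
  have hl0 : 0 ≤ l := by positivity
  have hcl : c ≤ l := by
    rw [hl, le_div_iff₀ hβ0]; nlinarith
  have hpow : ∀ x ∈ Set.Ioc (0 : ℝ) 1, x ^ (β + 1) * x ^ (-β) = x := fun x hx => by
    rw [← Real.rpow_add hx.1]; simp
  -- Adding `l * x ^ (-β)` restores both shape conditions: its decrease pays for `h₁`, and since `x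
  -- ^ (β + 1) * x ^ (-β) = x`, the increase of `l * x` pays for `h₂`.
  have hcone := (Cone.rpow hβ0.le hβ).const_mul hl0
  refine ⟨fun x => u x + l * x ^ (-β), fun x => l * x ^ (-β), ?_, hcone.mono (by linarith),
    fun x _ => by ring⟩
  have hle : ∀ x ∈ Set.Ioc (0 : ℝ) 1, u x + l * x ^ (-β) ≤ (6 * b + l) * x ^ (-β) := fun x hx => by
    have := hub x hx
    linarith
  have hmeas : Measurable fun x => u x + l * x ^ (-β) := hum.add (by fun_prop)
  exact
  { measurable := hmeas
    nonneg := fun x hx => add_nonneg (hu0 x hx) (hcone.nonneg x hx)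
    antitoneOn := fun x hx x' hx' h => by
      have e1 := h₁ x hx x' hx' h
      have e2 := mul_le_mul_of_nonneg_left (le_rpow_neg_sub hβ0 hβ hx hx' h) hc
      have e3 : c * (1 / β * (x ^ (-β) - x' ^ (-β))) = l * (x ^ (-β) - x' ^ (-β)) := by
        rw [hl]; ring
      simp only
      linarith
    monotoneOn := fun x hx x' hx' h => by
      have e1 := h₂ x hx x' hx' h
      have e2 := rpow_one_sub_sub_le hβ0.le hx hx' h
      have e3 : x' ^ (-β) * x ≤ 1 := by
        calc x' ^ (-β) * x ≤ x' ^ (-β) * x' :=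
              mul_le_mul_of_nonneg_left h (Real.rpow_nonneg hx'.1.le _)
          _ = x' ^ (1 - β) := by
              rw [sub_eq_add_neg, Real.rpow_add hx'.1, Real.rpow_one]; ring
          _ ≤ 1 := Real.rpow_le_one hx'.1.le hx'.2 (by linarith)
      have e4 : c * ((x' ^ (1 - β) - x ^ (1 - β)) * x) ≤ l * (x' - x) := by
        calc _ ≤ c * (x' ^ (-β) * (x' - x) * x) :=
              mul_le_mul_of_nonneg_left (mul_le_mul_of_nonneg_right e2 hx.1.le) hc
          _ = c * ((x' ^ (-β) * x) * (x' - x)) := by ring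
          _ ≤ c * (1 * (x' - x)) :=
              mul_le_mul_of_nonneg_left (mul_le_mul_of_nonneg_right e3 (by linarith)) hc
          _ ≤ l * (x' - x) := by
              rw [one_mul]; exact mul_le_mul_of_nonneg_right hcl (by linarith)
      have p1 := hpow x hx
      have p2 := hpow x' hx'
      simp only [mul_add]
      have p3 : x ^ (β + 1) * (l * x ^ (-β)) = l * x := by linear_combination l * p1
      have p4 : x' ^ (β + 1) * (l * x' ^ (-β)) = l * x' := by linear_combination l * p2
      rw [p3, p4]
      linarith
    le_rpow := fun x hx => (hle x hx).trans
      (mul_le_mul_of_nonneg_right (by linarith) (Real.rpow_nonneg hx.1.le _))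
    integral_le := by
      have hInt : IntegrableOn (fun x => u x + l * x ^ (-β)) (Set.Ioc 0 1) :=
        integrableOn_of_le_rpow (β := β) (by linarith) hmeas fun x hx => by
          rw [abs_of_nonneg (add_nonneg (hu0 x hx) (hcone.nonneg x hx))]; exact hle x hx
      calc _ ≤ ∫ x in Set.Ioc (0 : ℝ) 1, (6 * b + l) * x ^ (-β) :=
            setIntegral_mono_on hInt ((integrableOn_rpow_neg (by linarith)).const_mul _)
              measurableSet_Ioc hle
        _ ≤ (6 * b + l) * 2 := by
            rw [integral_const_mul]
            exact mul_le_mul_of_nonneg_left (integral_rpow_neg_le hβ) (by linarith)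
        _ = _ := by ring }

/-- The factor `w + b` is nonnegative, so `(w + b) * g` violates the shape conditions only through
the increments of `w`, which `isConeDiff_of_almost_shape` tolerates. Then `b * g` is subtracted. -/
lemma Cone.mul_lipschitz (hβ0 : 0 < β) (hβ : β ≤ 1 / 2) (hg : Cone β M g) {w : ℝ → ℝ} {b l : ℝ}
    (hl : 0 ≤ l) (hw : Measurable w) (hwb : ∀ x, |w x| ≤ b)
    (hwl : ∀ x y, |w x - w y| ≤ l * |x - y|) :
    IsConeDiff β (25 * (b + l / β) * M) (fun x => w x * g x) := by
  have hb : 0 ≤ b := (abs_nonneg _).trans (hwb 0)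
  have hM := hg.nonneg_mass
  have hw0 : ∀ x, 0 ≤ w x + b := fun x => by linarith [(abs_le.1 (hwb x)).1]
  have hw2 : ∀ x, w x + b ≤ 2 * b := fun x => by linarith [(abs_le.1 (hwb x)).2]
  have hpow : ∀ x ∈ Set.Ioc (0 : ℝ) 1, x ^ (β + 1) * x ^ (-β) = x := fun x hx => by
    rw [← Real.rpow_add hx.1]; simp
  have h1 : IsConeDiff β (12 * (2 * b * M) + 2 * (12 * l * M / β))
      (fun x => (w x + b) * g x) := by
    refine isConeDiff_of_almost_shape hβ0 hβ (by positivity) (by positivity)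
      ((hw.add_const b).mul hg.measurable) (fun x hx => mul_nonneg (hw0 x) (hg.nonneg x hx))
      (fun x hx => ?_) (fun x hx x' hx' h => ?_) (fun x hx x' hx' h => ?_)
    · calc _ ≤ 2 * b * (6 * M * x ^ (-β)) :=
            mul_le_mul (hw2 x) (hg.le_rpow x hx) (hg.nonneg x hx) (by positivity)
        _ = _ := by ring
    · have e1 := hg.antitoneOn hx hx' h
      have e2 := mul_nonneg (hw0 x) (sub_nonneg.2 e1)
      have e3 : w x' - w x ≤ l * (x' - x) := by
        have := (le_abs_self _).trans (hwl x' x)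
        rwa [abs_of_nonneg (sub_nonneg.2 h)] at this
      have e4 := sub_le_rpow_one_sub_sub hβ0.le hβ hx hx' h
      calc (w x' + b) * g x' - (w x + b) * g x ≤ (w x' - w x) * g x' := by nlinarith
        _ ≤ (l * (2 * (x' ^ (1 - β) - x ^ (1 - β)))) * (6 * M * x' ^ (-β)) := by
            refine mul_le_mul (e3.trans (mul_le_mul_of_nonneg_left e4 hl)) (hg.le_rpow x' hx')
              (hg.nonneg x' hx') (mul_nonneg hl (by linarith))
        _ = _ := by ring
    · have e1 := hg.monotoneOn hx hx' h
      simp only at e1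
      have e2 := mul_nonneg (hw0 x') (sub_nonneg.2 e1)
      have e3 : w x - w x' ≤ l * (x' - x) := by
        have := (le_abs_self _).trans (hwl x x')
        rwa [abs_sub_comm x, abs_of_nonneg (sub_nonneg.2 h)] at this
      have e4 := sub_le_rpow_one_sub_sub hβ0.le hβ hx hx' h
      have e5 : x ^ (β + 1) * g x ≤ 6 * M * x := by
        calc _ ≤ x ^ (β + 1) * (6 * M * x ^ (-β)) :=
              mul_le_mul_of_nonneg_left (hg.le_rpow x hx) (Real.rpow_nonneg hx.1.le _)
          _ = _ := by linear_combination (6 * M) * hpow x hx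
      calc _ ≤ (w x - w x') * (x ^ (β + 1) * g x) := by nlinarith
        _ ≤ (l * (2 * (x' ^ (1 - β) - x ^ (1 - β)))) * (6 * M * x) := by
            refine mul_le_mul (e3.trans (mul_le_mul_of_nonneg_left e4 hl)) e5
              (mul_nonneg (Real.rpow_nonneg hx.1.le _) (hg.nonneg x hx))
              (mul_nonneg hl (by linarith))
        _ = _ := by ring
  have h2 := h1.sub (by linarith) (hg.isConeDiff.const_mul b)
  rw [abs_of_nonneg hb] at h2
  have h3 : IsConeDiff β (25 * (b + l / β) * M) (fun x => (w x + b) * g x - b * g x) := by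
    refine h2.mono ?_
    have : 0 ≤ l / β * M := by positivity
    have e : 12 * l * M / β = 12 * (l / β * M) := by ring
    rw [e]
    nlinarith
  obtain ⟨k, k', hk, hk', h⟩ := h3
  exact ⟨k, k', hk, hk', fun x hx => by rw [← h x hx]; ring⟩

lemma IsConeDiff.mul_lipschitz (hβ0 : 0 < β) (hβ : β ≤ 1 / 2) {u : ℝ → ℝ} {B : ℝ}
    (hu : IsConeDiff β B u) {w : ℝ → ℝ} {b l : ℝ} (hl : 0 ≤ l) (hw : Measurable w)
    (hwb : ∀ x, |w x| ≤ b) (hwl : ∀ x y, |w x - w y| ≤ l * |x - y|) :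
    IsConeDiff β (50 * (b + l / β) * B) (fun x => w x * u x) := by
  obtain ⟨g, g', hg, hg', hu⟩ := hu
  obtain ⟨k, k', hk, hk', h⟩ := (hg.mul_lipschitz hβ0 hβ hl hw hwb hwl).sub (by linarith)
    (hg'.mul_lipschitz hβ0 hβ hl hw hwb hwl)
  exact IsConeDiff.mono ⟨k, k', hk, hk', fun x hx => by
    rw [← h x hx]; simp only [hu x hx]; ring⟩
    (le_of_eq (by ring))

end Intermittent

/-! ### Densities weighted by a functional of the past. -/

namespace Intermittent

section Expansion

variable {a β l : ℝ}

/-- The branch is only weakly expanding near the neutral fixed point, but measured in `y ^ (1 - β)`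
the gain of one step is at least `1 / 8` of the ordinary distance. An error of size `l * (y' - y)`
added at every step can therefore be carried with the fixed constant `8 * l`. -/
lemma left_expansion (ha : 0 ≤ a) (haβ : a ≤ β) (hβ : β ≤ 1 / 2) (hl : 0 ≤ l) {y y' : ℝ}
    (hy : y ∈ Set.Ioc (0 : ℝ) (1 / 2)) (hy' : y' ∈ Set.Ioc (0 : ℝ) (1 / 2)) (h : y ≤ y') :
    l * (y' - y) + 8 * l * (y' ^ (1 - β) - y ^ (1 - β))
      ≤ 8 * l * (leftBranch a y' ^ (1 - β) - leftBranch a y ^ (1 - β)) := by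
  have hβ0 := ha.trans haβ
  have hpos : ∀ z, 0 < z → 0 < leftBranch a z := fun z hz => by
    unfold leftBranch; positivity
  have hd : ∀ z, 0 < z → HasDerivAt
      (fun z => leftBranch a z ^ (1 - β) - z ^ (1 - β) - 1 / 8 * z)
      (leftDeriv a z * (1 - β) * leftBranch a z ^ (1 - β - 1) - (1 - β) * z ^ (1 - β - 1) - 1 / 8)
      z := fun z hz =>
    (((hasDerivAt_leftBranch hz).rpow_const (Or.inl (hpos z hz).ne')).fun_sub
      (Real.hasDerivAt_rpow_const (Or.inl hz.ne'))).fun_sub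
      (((hasDerivAt_id z).const_mul (1 / 8)).congr_deriv (by ring))
  have hmono : MonotoneOn (fun z => leftBranch a z ^ (1 - β) - z ^ (1 - β) - 1 / 8 * z)
      (Set.Ioc 0 (1 / 2)) := by
    apply monotoneOn_of_deriv_nonneg (convex_Ioc _ _)
    · exact fun z hz => (hd z hz.1).continuousAt.continuousWithinAt
    · intro z hz
      rw [interior_Ioc] at hz
      exact (hd z hz.1).differentiableAt.differentiableWithinAt
    · intro z hz
      rw [interior_Ioc] at hz
      have hzI : z ∈ Set.Ioc (0 : ℝ) (1 / 2) := ⟨hz.1, hz.2.le⟩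
      have hz0 := hz.1
      rw [(hd z hz.1).deriv]
      set t : ℝ := 2 ^ a * z ^ a with ht
      have ht0 : 0 < t := by positivity
      have ht1 : t ≤ 1 := two_rpow_mul_rpow_le_one ha hzI
      have hlb : leftBranch a z = z * (1 + t) := rfl
      have hld : leftDeriv a z = 1 + (1 + a) * t := rfl
      have e1 : (1 - β - 1 : ℝ) = -β := by ring
      have hzb : 0 < z ^ (-β) := Real.rpow_pos_of_pos hz0 _
      rw [e1, hlb, Real.mul_rpow hz0.le (by linarith), hld]
      have h1 : (1 + t) ^ β ≤ 1 + β * t :=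
        rpow_one_add_le_one_add_mul_self (by linarith) hβ0 (by linarith)
      have h2 : 1 / (1 + β * t) ≤ (1 + t) ^ (-β) := by
        rw [Real.rpow_neg (by linarith), ← one_div]
        exact one_div_le_one_div_of_le (Real.rpow_pos_of_pos (by linarith) _) h1
      have h3 : 1 + t / 4 ≤ (1 + (1 + a) * t) * (1 + t) ^ (-β) := by
        calc 1 + t / 4 ≤ (1 + (1 + a) * t) * (1 / (1 + β * t)) := by
              rw [mul_one_div, le_div_iff₀ (by positivity)]
              nlinarith [mul_nonneg hβ0 ht0.le, mul_nonneg ha ht0.le,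
                mul_nonneg (mul_nonneg hβ0 ht0.le) ht0.le]
          _ ≤ _ := mul_le_mul_of_nonneg_left h2 (by positivity)
      -- The singular derivative of `z ^ (1 - β)` compensates for the vanishing expansion `t`.
      -- Together with `t / 4` from `h3` and `1 - β ≥ 1 / 2` this yields the constant `1 / 8`.
      have h4 : 1 ≤ z ^ (-β) * t := by
        have h5 := two_mul_rpow_le haβ hzI
        rw [Real.mul_rpow (by norm_num) hz0.le] at h5
        have h6 : (1 : ℝ) ≤ 2 ^ β := Real.one_le_rpow (by norm_num) hβ0
        have h7 : z ^ (-β) * z ^ β = 1 := by rw [← Real.rpow_add hz0]; simp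
        have h8 : 0 < z ^ β := Real.rpow_pos_of_pos hz0 _
        calc 1 = z ^ (-β) * (1 * z ^ β) := by rw [one_mul, h7]
          _ ≤ z ^ (-β) * t := mul_le_mul_of_nonneg_left
              ((mul_le_mul_of_nonneg_right h6 h8.le).trans h5) hzb.le
      have h9 := mul_le_mul_of_nonneg_left h3 hzb.le
      have h10 : (1 - β) * (z ^ (-β) * (1 + t / 4))
          ≤ (1 - β) * (z ^ (-β) * ((1 + (1 + a) * t) * (1 + t) ^ (-β))) :=
        mul_le_mul_of_nonneg_left h9 (by linarith)
      nlinarith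
  have := hmono hy hy' h
  simp only at this
  nlinarith

lemma right_expansion (hβ0 : 0 ≤ β) (hβ : β ≤ 1 / 2) (hl : 0 ≤ l) {x x' : ℝ}
    (hx : x ∈ Set.Ioc (0 : ℝ) 1) (hx' : x' ∈ Set.Ioc (0 : ℝ) 1) (h : x ≤ x') :
    l * ((x' + 1) / 2 - (x + 1) / 2)
        + 8 * l * (((x' + 1) / 2) ^ (1 - β) - ((x + 1) / 2) ^ (1 - β))
      ≤ 8 * l * (x' ^ (1 - β) - x ^ (1 - β)) := by
  have hd : ∀ z, 0 < z → HasDerivAt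
      (fun z : ℝ => z ^ (1 - β) - ((z + 1) / 2) ^ (1 - β) - 1 / 8 * ((z + 1) / 2))
      ((1 - β) * z ^ (1 - β - 1) - 1 / 2 * (1 - β) * ((z + 1) / 2) ^ (1 - β - 1) - 1 / 8 * (1 / 2))
      z := fun z hz => by
    have h1 : HasDerivAt (fun z : ℝ => (z + 1) / 2) (1 / 2) z :=
      ((hasDerivAt_id z).add_const 1).div_const 2
    exact ((Real.hasDerivAt_rpow_const (Or.inl hz.ne')).fun_sub
      (h1.rpow_const (Or.inl (by positivity)))).fun_sub (h1.const_mul (1 / 8))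
  have hmono : MonotoneOn
      (fun z : ℝ => z ^ (1 - β) - ((z + 1) / 2) ^ (1 - β) - 1 / 8 * ((z + 1) / 2))
      (Set.Ioc 0 1) := by
    apply monotoneOn_of_deriv_nonneg (convex_Ioc _ _)
    · exact fun z hz => (hd z hz.1).continuousAt.continuousWithinAt
    · intro z hz
      rw [interior_Ioc] at hz
      exact (hd z hz.1).differentiableAt.differentiableWithinAt
    · intro z hz
      rw [interior_Ioc] at hz
      rw [(hd z hz.1).deriv]
      have e1 : (1 - β - 1 : ℝ) = -β := by ring
      rw [e1]
      have h1 : ((z + 1) / 2) ^ (-β) ≤ z ^ (-β) :=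
        Real.rpow_le_rpow_of_nonpos hz.1 (by linarith [hz.2]) (by linarith)
      have h2 : 1 ≤ z ^ (-β) :=
        Real.one_le_rpow_of_pos_of_le_one_of_nonpos hz.1 hz.2.le (by linarith)
      nlinarith
  have := hmono hx hx' h
  simp only at this
  nlinarith

end Expansion

section PastDensity

variable {β : ℝ}

/-- `u` has the shape of the cone up to errors measured by `G` and increments of `x ^ (1 - β)`. -/
structure AlmostShape (β c : ℝ) (G u : ℝ → ℝ) : Prop where
  almost_antitone : ∀ x ∈ Set.Ioc (0 : ℝ) 1, ∀ x' ∈ Set.Ioc (0 : ℝ) 1, x ≤ x' →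
    u x' - u x ≤ c * (x' ^ (1 - β) - x ^ (1 - β)) * G x'
  almost_monotone : ∀ x ∈ Set.Ioc (0 : ℝ) 1, ∀ x' ∈ Set.Ioc (0 : ℝ) 1, x ≤ x' →
    x ^ (β + 1) * u x - x' ^ (β + 1) * u x' ≤ c * (x' ^ (1 - β) - x ^ (1 - β)) * (x ^ (β + 1) * G x)

/-- One step of the transfer operator absorbs an additional Lipschitz error. -/
lemma AlmostShape.transfer {a l : ℝ} (ha : 0 ≤ a) (haβ : a ≤ β) (hβ : β ≤ 1 / 2) (hl : 0 ≤ l)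
    {G u : ℝ → ℝ} (hG : ∀ x ∈ Set.Ioc (0 : ℝ) 1, 0 ≤ G x) (hu : ∀ x ∈ Set.Ioc (0 : ℝ) 1, 0 ≤ u x)
    (h₁ : ∀ y ∈ Set.Ioc (0 : ℝ) 1, ∀ y' ∈ Set.Ioc (0 : ℝ) 1, y ≤ y' →
      u y' - u y ≤ (l * (y' - y) + 8 * l * (y' ^ (1 - β) - y ^ (1 - β))) * G y')
    (h₂ : ∀ y ∈ Set.Ioc (0 : ℝ) 1, ∀ y' ∈ Set.Ioc (0 : ℝ) 1, y ≤ y' →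
      y ^ (β + 1) * u y - y' ^ (β + 1) * u y'
        ≤ (l * (y' - y) + 8 * l * (y' ^ (1 - β) - y ^ (1 - β))) * (y ^ (β + 1) * G y)) :
    AlmostShape β (8 * l) (transfer a G) (transfer a u) := by
  have hβ0 := ha.trans haβ
  constructor
  · intro x hx x' hx' h
    have hm := monotone_leftInv a h
    have hy := leftInv_mem_Ioc ha hx
    have hy' := leftInv_mem_Ioc ha hx'
    have hE := left_expansion ha haβ hβ hl (leftInv_mem ha hx) (leftInv_mem ha hx') hm
    rw [leftBranch_leftInv ha hx, leftBranch_leftInv ha hx'] at hE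
    have hR := right_expansion hβ0 hβ hl hx hx' h
    set y := leftInv a x
    set y' := leftInv a x'
    have hd := leftDeriv_pos ha hy.1.le
    have hd' := leftDeriv_pos ha hy'.1.le
    have hdd := leftDeriv_mono ha hy.1.le hm
    have e1 : u y' / leftDeriv a y' - u y / leftDeriv a y
        ≤ 8 * l * (x' ^ (1 - β) - x ^ (1 - β)) * (G y' / leftDeriv a y') := by
      calc _ ≤ u y' / leftDeriv a y' - u y / leftDeriv a y' :=
            sub_le_sub_left (div_le_div_of_nonneg_left (hu y hy) hd hdd) _
        _ = (u y' - u y) / leftDeriv a y' := (sub_div _ _ _).symm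
        _ ≤ 8 * l * (x' ^ (1 - β) - x ^ (1 - β)) * G y' / leftDeriv a y' :=
            div_le_div_of_nonneg_right ((h₁ y hy y' hy' hm).trans
              (mul_le_mul_of_nonneg_right hE (hG y' hy'))) hd'.le
        _ = _ := by ring
    have e2 := (h₁ _ (rightInv_mem_Ioc hx) _ (rightInv_mem_Ioc hx') (by linarith)).trans
      (mul_le_mul_of_nonneg_right hR (hG _ (rightInv_mem_Ioc hx')))
    unfold Intermittent.transfer
    linarith
  · intro x hx x' hx' h
    have hm := monotone_leftInv a h
    have hy := leftInv_mem_Ioc ha hx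
    have hy' := leftInv_mem_Ioc ha hx'
    have hE := left_expansion ha haβ hβ hl (leftInv_mem ha hx) (leftInv_mem ha hx') hm
    have hw := leftBranch_rpow_div (α := a) hy.1 (β + 1)
    have hw' := leftBranch_rpow_div (α := a) hy'.1 (β + 1)
    rw [leftBranch_leftInv ha hx, leftBranch_leftInv ha hx'] at hE
    rw [leftBranch_leftInv ha hx] at hw
    rw [leftBranch_leftInv ha hx'] at hw'
    have hR := right_expansion hβ0 hβ hl hx hx' h
    have hww := leftWeight_mono ha haβ hy.1 hm
    set y := leftInv a x
    set y' := leftInv a x'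
    set k := (1 + 2 ^ a * y ^ a) ^ (β + 1) / leftDeriv a y
    set k' := (1 + 2 ^ a * y' ^ a) ^ (β + 1) / leftDeriv a y'
    have hk : 0 ≤ k := by
      have := leftDeriv_pos ha hy.1.le
      have := hy.1
      positivity
    -- Common to both branches: passing from `y` to `x` multiplies `y ^ (β + 1)` by an increasing
    -- weight, which is `k` on the left and `(x / z) ^ (β + 1)` on the right.
    have step : ∀ {k k' y y' E : ℝ}, 0 ≤ k → k ≤ k' → y ∈ Set.Ioc (0 : ℝ) 1 →
        y' ∈ Set.Ioc (0 : ℝ) 1 → y ≤ y' →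
        l * (y' - y) + 8 * l * (y' ^ (1 - β) - y ^ (1 - β)) ≤ E →
        k * (y ^ (β + 1) * u y) - k' * (y' ^ (β + 1) * u y')
          ≤ E * (k * (y ^ (β + 1) * G y)) := by
      intro k k' y y' E hk hkk hy hy' hm hE
      have hn : 0 ≤ y' ^ (β + 1) * u y' := mul_nonneg (Real.rpow_nonneg hy'.1.le _) (hu y' hy')
      have hnG : 0 ≤ y ^ (β + 1) * G y := mul_nonneg (Real.rpow_nonneg hy.1.le _) (hG y hy)
      calc _ ≤ k * (y ^ (β + 1) * u y) - k * (y' ^ (β + 1) * u y') :=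
            sub_le_sub_left (mul_le_mul_of_nonneg_right hkk hn) _
        _ = k * (y ^ (β + 1) * u y - y' ^ (β + 1) * u y') := by ring
        _ ≤ k * (E * (y ^ (β + 1) * G y)) :=
            mul_le_mul_of_nonneg_left ((h₂ y hy y' hy' hm).trans
              (mul_le_mul_of_nonneg_right hE hnG)) hk
        _ = _ := by ring
    have e1 := step hk hww hy hy' hm hE
    have f1 : ∀ v : ℝ → ℝ, k * (y ^ (β + 1) * v y) = x ^ (β + 1) * (v y / leftDeriv a y) := by
      intro v; rw [← mul_assoc, ← hw]; ring
    have f1' : ∀ v : ℝ → ℝ,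
        k' * (y' ^ (β + 1) * v y') = x' ^ (β + 1) * (v y' / leftDeriv a y') := by
      intro v; rw [← mul_assoc, ← hw']; ring
    rw [f1, f1', f1] at e1
    have hz := rightInv_mem_Ioc hx
    have hz' := rightInv_mem_Ioc hx'
    set z := (x + 1) / 2 with hzd
    set z' := (x' + 1) / 2 with hzd'
    have e2 := step (k := (x / z) ^ (β + 1)) (k' := (x' / z') ^ (β + 1)) (y := z) (y' := z')
      (Real.rpow_nonneg (div_nonneg hx.1.le hz.1.le) _)
      (Real.rpow_le_rpow (div_nonneg hx.1.le hz.1.le) (by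
        rw [div_le_div_iff₀ hz.1 hz'.1, hzd, hzd']; nlinarith) (by linarith))
      hz hz' (by rw [hzd, hzd']; linarith) hR
    have f2 : ∀ v : ℝ → ℝ, (x / z) ^ (β + 1) * (z ^ (β + 1) * v z) = x ^ (β + 1) * v z := by
      intro v
      rw [← mul_assoc, ← Real.mul_rpow (div_nonneg hx.1.le hz.1.le) hz.1.le,
        div_mul_cancel₀ _ hz.1.ne']
    have f2' : ∀ v : ℝ → ℝ,
        (x' / z') ^ (β + 1) * (z' ^ (β + 1) * v z') = x' ^ (β + 1) * v z' := by
      intro v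
      rw [← mul_assoc, ← Real.mul_rpow (div_nonneg hx'.1.le hz'.1.le) hz'.1.le,
        div_mul_cancel₀ _ hz'.1.ne']
    rw [f2, f2', f2] at e2
    unfold Intermittent.transfer
    linarith

/-- The density at time `k` of the measure `a (q + ∑ i < k, w i (x i)) φ dm`, where `x i` is the
orbit. -/
noncomputable def pastDensity (α : ℕ → ℝ) (a φ : ℝ → ℝ) (w : ℕ → ℝ → ℝ) : ℕ → ℝ → ℝ → ℝ
  | 0, q, x => a q * φ x
  | k + 1, q, x => transfer (α (k + 1)) (fun y => pastDensity α a φ w k (q + w k y) y) x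

variable {α : ℕ → ℝ} {a φ : ℝ → ℝ} {w : ℕ → ℝ → ℝ}

lemma measurable_pastDensity (ha : Measurable a) (hφ : Measurable φ)
    (hw : ∀ i, Measurable (w i)) (k : ℕ) :
    Measurable (fun p : ℝ × ℝ => pastDensity α a φ w k p.1 p.2) := by
  induction k with
  | zero => exact (ha.comp measurable_fst).mul (hφ.comp measurable_snd)
  | succ k ih =>
    have h1 : Measurable fun p : ℝ × ℝ => leftInv (α (k + 1)) p.2 :=
      (measurable_leftInv _).comp measurable_snd
    have h2 : Measurable fun p : ℝ × ℝ => (p.2 + 1) / 2 := by fun_prop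
    have h3 : ∀ {y : ℝ × ℝ → ℝ}, Measurable y →
        Measurable fun p : ℝ × ℝ => pastDensity α a φ w k (p.1 + w k (y p)) (y p) := fun hy =>
      ih.comp ((measurable_fst.add ((hw k).comp hy)).prodMk hy)
    simp only [pastDensity, transfer]
    exact ((h3 h1).div ((measurable_leftDeriv _).comp h1)).add ((h3 h2).div_const 2)

lemma transfer_le_transfer {t : ℝ} (ht : 0 ≤ t) {u v : ℝ → ℝ} {x : ℝ}
    (h : ∀ y ∈ Set.Ioc (0 : ℝ) 1, u y ≤ v y) (hx : x ∈ Set.Ioc (0 : ℝ) 1) :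
    transfer t u x ≤ transfer t v x := by
  have hy := leftInv_mem_Ioc ht hx
  have := div_le_div_of_nonneg_right (h _ hy) (leftDeriv_pos ht hy.1.le).le
  have := h _ (rightInv_mem_Ioc hx)
  unfold transfer
  linarith

/-- The four bounds are proved by a joint induction. Each step replaces the parameter `q` by `q + w
k y`, so the shape estimate needs the Lipschitz estimate in `q`. The constant `8 * (la * lw)` does
not grow with `k`, thanks to `AlmostShape.transfer`. -/
lemma pastDensity_bounds {b la lw : ℝ} (hβ : β ≤ 1 / 2) (hα : Admissible β α)
    (hφ : Cone β 1 φ) (ha0 : ∀ q, 0 ≤ a q) (hab : ∀ q, a q ≤ b) (hla : 0 ≤ la)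
    (hal : ∀ q q', |a q - a q'| ≤ la * |q - q'|) (hlw : 0 ≤ lw)
    (hwl : ∀ i x y, |w i x - w i y| ≤ lw * |x - y|) (k : ℕ) :
    (∀ q, ∀ x ∈ Set.Ioc (0 : ℝ) 1, 0 ≤ pastDensity α a φ w k q x) ∧
    (∀ q, ∀ x ∈ Set.Ioc (0 : ℝ) 1, pastDensity α a φ w k q x ≤ b * transferIter α k φ x) ∧
    (∀ q q', ∀ x ∈ Set.Ioc (0 : ℝ) 1,
      pastDensity α a φ w k q x - pastDensity α a φ w k q' x
        ≤ la * |q - q'| * transferIter α k φ x) ∧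
    (∀ q, AlmostShape β (8 * (la * lw)) (transferIter α k φ) (pastDensity α a φ w k q)) := by
  have hL : 0 ≤ la * lw := mul_nonneg hla hlw
  induction k with
  | zero =>
    refine ⟨fun q x hx => mul_nonneg (ha0 q) (hφ.nonneg x hx),
      fun q x hx => mul_le_mul_of_nonneg_right (hab q) (hφ.nonneg x hx),
      fun q q' x hx => ?_, fun q => ⟨fun x hx x' hx' h => ?_, fun x hx x' hx' h => ?_⟩⟩
    · simp only [pastDensity, transferIter, ← sub_mul]
      exact mul_le_mul_of_nonneg_right ((le_abs_self _).trans (hal q q')) (hφ.nonneg x hx)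
    · simp only [pastDensity, transferIter, ← mul_sub]
      have h1 := hφ.antitoneOn hx hx' h
      have h2 : x ^ (1 - β) ≤ x' ^ (1 - β) := Real.rpow_le_rpow hx.1.le h (by linarith)
      have h3 : a q * (φ x' - φ x) ≤ 0 :=
        mul_nonpos_of_nonneg_of_nonpos (ha0 q) (by linarith)
      exact h3.trans (mul_nonneg (mul_nonneg (by positivity) (by linarith)) (hφ.nonneg x' hx'))
    · simp only [pastDensity, transferIter]
      have h1 := hφ.monotoneOn hx hx' h
      simp only at h1
      have h2 : x ^ (1 - β) ≤ x' ^ (1 - β) := Real.rpow_le_rpow hx.1.le h (by linarith)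
      have h3 : a q * (x ^ (β + 1) * φ x - x' ^ (β + 1) * φ x') ≤ 0 :=
        mul_nonpos_of_nonneg_of_nonpos (ha0 q) (by linarith)
      have h4 := mul_nonneg (mul_nonneg (by positivity : 0 ≤ 8 * (la * lw)) (sub_nonneg.2 h2))
        (mul_nonneg (Real.rpow_nonneg hx.1.le (β + 1)) (hφ.nonneg x hx))
      linarith
  | succ k ih =>
    obtain ⟨i1, i2, i3, i4⟩ := ih
    have hα0 := (hα (k + 1) (by omega)).1
    have hαβ := (hα (k + 1) (by omega)).2
    have hφk := hφ.transferIter hβ hα k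
    refine ⟨fun q x hx => ?_, fun q x hx => ?_, fun q q' x hx => ?_, fun q => ?_⟩
    · have := transfer_le_transfer (u := fun _ => 0) hα0 (fun y hy => i1 (q + w k y) y hy) hx
      simpa [pastDensity, transfer] using this
    · have := transfer_le_transfer hα0 (fun y hy => i2 (q + w k y) y hy) hx
      refine this.trans (le_of_eq ?_)
      simp only [transferIter, transfer]; ring
    · have := transfer_le_transfer
        (u := fun y => pastDensity α a φ w k (q + w k y) y - pastDensity α a φ w k (q' + w k y) y)
        (v := fun y => la * |q - q'| * transferIter α k φ y) hα0 (fun y hy => by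
          have := i3 (q + w k y) (q' + w k y) y hy
          rwa [add_sub_add_right_eq_sub] at this) hx
      calc _ = _ := by simp only [pastDensity, transfer]; ring
        _ ≤ _ := this
        _ = _ := by simp only [transferIter, transfer]; ring
    · have e : pastDensity α a φ w (k + 1) q
          = transfer (α (k + 1)) (fun y => pastDensity α a φ w k (q + w k y) y) := by
        funext x; simp only [pastDensity]
      rw [e]
      refine AlmostShape.transfer hα0 hαβ hβ hL hφk.nonneg (fun y hy => i1 _ y hy)
        (fun y hy y' hy' h => ?_) (fun y hy y' hy' h => ?_)
      -- The increment is split into a change of parameter at a fixed point and a change of point at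
      -- a fixed parameter; the second estimate below is split in the same way.
      · have e1 := i3 (q + w k y') (q + w k y) y' hy'
        have e2 := (i4 (q + w k y)).almost_antitone y hy y' hy' h
        have e3 := hwl k y' y
        rw [add_sub_add_left_eq_sub] at e1
        rw [abs_of_nonneg (sub_nonneg.2 h)] at e3
        have e4 : la * |w k y' - w k y| * transferIter α k φ y'
            ≤ la * (lw * (y' - y)) * transferIter α k φ y' :=
          mul_le_mul_of_nonneg_right (mul_le_mul_of_nonneg_left e3 hla) (hφk.nonneg y' hy')
        nlinarith
      · have e1 := i3 (q + w k y) (q + w k y') y hy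
        have e2 := (i4 (q + w k y')).almost_monotone y hy y' hy' h
        have e3 := hwl k y y'
        rw [add_sub_add_left_eq_sub] at e1
        rw [abs_sub_comm y, abs_of_nonneg (sub_nonneg.2 h)] at e3
        have e4 : la * |w k y - w k y'| * transferIter α k φ y
            ≤ la * (lw * (y' - y)) * transferIter α k φ y :=
          mul_le_mul_of_nonneg_right (mul_le_mul_of_nonneg_left e3 hla) (hφk.nonneg y hy)
        have e5 := mul_le_mul_of_nonneg_left (e1.trans e4) (Real.rpow_nonneg hy.1.le (β + 1))
        linarith

lemma isConeDiff_pastDensity {b la lw : ℝ} (hβ0 : 0 < β) (hβ : β ≤ 1 / 2) (hα : Admissible β α)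
    (hφ : Cone β 1 φ) (ha : Measurable a) (ha0 : ∀ q, 0 ≤ a q) (hab : ∀ q, a q ≤ b) (hla : 0 ≤ la)
    (hal : ∀ q q', |a q - a q'| ≤ la * |q - q'|) (hw : ∀ i, Measurable (w i)) (hlw : 0 ≤ lw)
    (hwl : ∀ i x y, |w i x - w i y| ≤ lw * |x - y|) (k : ℕ) (q : ℝ) :
    IsConeDiff β (12 * b + 2 * (48 * (la * lw) / β)) (pastDensity α a φ w k q) := by
  obtain ⟨h1, h2, -, h4⟩ := pastDensity_bounds hβ hα hφ ha0 hab hla hal hlw hwl k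
  have hb : 0 ≤ b := (ha0 0).trans (hab 0)
  have hφk := hφ.transferIter hβ hα k
  have hpow : ∀ x ∈ Set.Ioc (0 : ℝ) 1, x ^ (β + 1) * x ^ (-β) = x := fun x hx => by
    rw [← Real.rpow_add hx.1]; simp
  have hmon : ∀ x ∈ Set.Ioc (0 : ℝ) 1, ∀ x' ∈ Set.Ioc (0 : ℝ) 1, x ≤ x' →
      0 ≤ 8 * (la * lw) * (x' ^ (1 - β) - x ^ (1 - β)) := fun x hx x' _ h =>
    mul_nonneg (by positivity) (sub_nonneg.2 (Real.rpow_le_rpow hx.1.le h (by linarith)))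
  refine isConeDiff_of_almost_shape hβ0 hβ hb (by positivity)
    ((measurable_pastDensity ha hφ.measurable hw k).comp measurable_prodMk_left)
    (h1 q) (fun x hx => ?_) (fun x hx x' hx' h => ?_) (fun x hx x' hx' h => ?_)
  · calc _ ≤ b * (6 * 1 * x ^ (-β)) :=
          (h2 q x hx).trans (mul_le_mul_of_nonneg_left (hφk.le_rpow x hx) hb)
      _ = _ := by ring
  · calc _ ≤ 8 * (la * lw) * (x' ^ (1 - β) - x ^ (1 - β)) * (6 * 1 * x' ^ (-β)) :=
          ((h4 q).almost_antitone x hx x' hx' h).trans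
            (mul_le_mul_of_nonneg_left (hφk.le_rpow x' hx') (hmon x hx x' hx' h))
      _ = _ := by ring
  · calc _ ≤ 8 * (la * lw) * (x' ^ (1 - β) - x ^ (1 - β)) * (x ^ (β + 1) * (6 * 1 * x ^ (-β))) :=
          ((h4 q).almost_monotone x hx x' hx' h).trans
            (mul_le_mul_of_nonneg_left (mul_le_mul_of_nonneg_left (hφk.le_rpow x hx)
              (Real.rpow_nonneg hx.1.le _)) (hmon x hx x' hx' h))
      _ = _ := by
          linear_combination (48 * (la * lw) * (x' ^ (1 - β) - x ^ (1 - β))) * hpow x hx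

/-- The past density represents functionals of the past and a function of the present. -/
lemma integral_pastDensity {b la lw : ℝ} (hβ : β ≤ 1 / 2) (hα : Admissible β α)
    (hφ : Cone β 1 φ) (ha : Measurable a) (ha0 : ∀ q, 0 ≤ a q) (hab : ∀ q, a q ≤ b) (hla : 0 ≤ la)
    (hal : ∀ q q', |a q - a q'| ≤ la * |q - q'|) (hw : ∀ i, Measurable (w i)) (hlw : 0 ≤ lw)
    (hwl : ∀ i x y, |w i x - w i y| ≤ lw * |x - y|) (k : ℕ) {Q H : ℝ → ℝ} (hQ : Measurable Q)
    (hH : Measurable H) {B : ℝ} (hHB : ∀ x, |H x| ≤ B) :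
    IntegrableOn (fun y => pastDensity α a φ w k (Q y) y * H y) (Set.Ioc 0 1) ∧
    ∫ x in Set.Ioc (0 : ℝ) 1, φ x * (a ((∑ i ∈ Finset.range k, w i (comp α i x))
        + Q (comp α k x)) * H (comp α k x))
      = ∫ y in Set.Ioc (0 : ℝ) 1, pastDensity α a φ w k (Q y) y * H y := by
  have hb : 0 ≤ b := (ha0 0).trans (hab 0)
  have hInt : ∀ (k : ℕ) {Q H : ℝ → ℝ}, Measurable Q → Measurable H → (∀ x, |H x| ≤ B) →
      IntegrableOn (fun y => pastDensity α a φ w k (Q y) y * H y) (Set.Ioc 0 1) := by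
    intro k Q H hQ hH hHB
    obtain ⟨h1, h2, -, -⟩ := pastDensity_bounds hβ hα hφ ha0 hab hla hal hlw hwl k
    refine integrableOn_of_le_rpow (β := β) (C := b * 6 * B) (by linarith)
      (((measurable_pastDensity ha hφ.measurable hw k).comp (hQ.prodMk measurable_id)).mul hH)
      fun x hx => ?_
    rw [abs_mul, abs_of_nonneg (h1 _ x hx)]
    have hr := Real.rpow_nonneg hx.1.le (-β)
    calc _ ≤ (b * (6 * 1 * x ^ (-β))) * B :=
          mul_le_mul ((h2 _ x hx).trans
            (mul_le_mul_of_nonneg_left ((hφ.transferIter hβ hα k).le_rpow x hx) hb))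
            (hHB x) (abs_nonneg _) (by positivity)
      _ = _ := by ring
  refine ⟨hInt k hQ hH hHB, ?_⟩
  induction k generalizing Q H with
  | zero =>
    refine integral_congr_ae (Eventually.of_forall fun x => ?_)
    simp only [pastDensity, comp, Finset.range_zero, Finset.sum_empty, zero_add, id]
    ring
  | succ k ih =>
    have hα0 := (hα (k + 1) (by omega)).1
    have hmap := measurable_map (α (k + 1))
    -- The last summand of the past becomes part of the function of the present, one step earlier.
    have hQ' : Measurable fun y => Q (map (α (k + 1)) y) + w k y := (hQ.comp hmap).add (hw k)
    have h1 := ih hQ' (hH.comp hmap) (fun x => hHB _)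
    have h2 := integral_transfer hα0
      (fun x y => pastDensity α a φ w k (Q x + w k y) y * H x)
      (hInt k hQ' (hH.comp hmap) (fun x => hHB _))
    have e1 : ∀ x, pastDensity α a φ w (k + 1) (Q x) x * H x
        = transfer (α (k + 1)) (fun y => pastDensity α a φ w k (Q x + w k y) y * H x) x := by
      intro x
      simp only [pastDensity, transfer]; ring
    simp only [e1]
    rw [h2.2]
    refine Eq.trans (integral_congr_ae (Eventually.of_forall fun x => ?_)) h1
    simp only [Finset.sum_range_succ, comp, Function.comp]
    congr 3
    ring

end PastDensity

end Intermittent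

/-! ### Decay of correlations of first and second order. -/

namespace Intermittent

section Decay

variable {β : ℝ} {α : ℕ → ℝ}

lemma cone_one (hβ0 : 0 ≤ β) : Cone β 1 (fun _ => 1) where
  measurable := measurable_const
  nonneg _ _ := zero_le_one
  antitoneOn _ _ _ _ _ := le_rfl
  monotoneOn x hx y _ h := by
    simpa using Real.rpow_le_rpow hx.1.le h (by linarith)
  le_rpow x hx := by
    have := Real.one_le_rpow_of_pos_of_le_one_of_nonpos hx.1 hx.2 (neg_nonpos.2 hβ0)
    linarith
  integral_le := by simp

/-- `C` is a constant in the decay of correlations for sequential intermittent maps. The function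
integrated against the initial point may depend on the image point. -/
def DecayBound (β C : ℝ) : Prop :=
  0 < C ∧ ∀ (α : ℕ → ℝ) (n : ℕ) (B κ : ℝ) (F : ℝ → ℝ → ℝ), Admissible β α →
    (∀ x, IsConeDiff β B (F x)) → (∀ x, |∫ y in Set.Ioc (0 : ℝ) 1, F x y| ≤ κ) →
    IntegrableOn (fun y => F (comp α n y) y) (Set.Ioc 0 1) →
    |∫ y in Set.Ioc (0 : ℝ) 1, F (comp α n y) y| ≤ C * B * rate β n + κ

/-- For fixed `x` the mean of `F x` is removed and memory loss is applied at that same `x`. This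
needs a pointwise bound, not one in `L¹`. What is left is the mean times the image of the density
`1`, which contributes at most `κ`. -/
theorem exists_decayBound (hβ0 : 0 < β) (hβ : β ≤ 1 / 2) : ∃ C, DecayBound β C := by
  obtain ⟨C, hC, h⟩ := exists_memory_loss_coneDiff hβ0 hβ
  have hβ1 : β < 1 := by linarith
  refine ⟨C * 2 * (2 + 1 / β), by positivity, fun α n B κ F hα hF hκ hInt => ?_⟩
  obtain ⟨h1, h2⟩ := integral_transferIter hα n F hInt
  have hB := (hF 0).nonneg
  have hone := (cone_one hβ0.le).transferIter hβ hα n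
  have hκ0 : 0 ≤ κ := (abs_nonneg _).trans (hκ 0)
  have hpt : ∀ x ∈ Set.Ioc (0 : ℝ) 1, |transferIter α n (F x) x|
      ≤ C * (2 * B) * envelope β n x + κ * transferIter α n (fun _ => 1) x := by
    intro x hx
    set c := ∫ y in Set.Ioc (0 : ℝ) 1, F x y with hc
    have hcB : |c| ≤ B := (hF x).abs_integral_le hβ1
    have hu : IsConeDiff β (2 * B) (fun y => F x y - c * 1) :=
      ((hF x).sub hβ1 ((cone_one hβ0.le).isConeDiff.const_mul c)).mono (by linarith)
    have h0 : ∫ y in Set.Ioc (0 : ℝ) 1, (F x y - c * 1) = 0 := by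
      rw [integral_sub ((hF x).integrableOn hβ1) (by simp)]
      simp [← hc]
    have h3 := h α (2 * B) _ hα hu h0 n x hx
    have h4 : transferIter α n (F x) x = transferIter α n (fun y => F x y - c * 1) x
        + c * transferIter α n (fun _ => 1) x := by
      have := transferIter_linear α n 1 c (fun y => F x y - c * 1) (fun _ => 1) x
      rw [one_mul] at this
      rw [← this]
      congr 1; funext y; ring
    rw [h4]
    refine (abs_add_le _ _).trans (add_le_add h3 ?_)
    rw [abs_mul, abs_of_nonneg (hone.nonneg x hx)]
    exact mul_le_mul_of_nonneg_right (hκ x) (hone.nonneg x hx)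
  rw [← h2]
  calc |∫ x in Set.Ioc (0 : ℝ) 1, transferIter α n (F x) x|
      ≤ ∫ x in Set.Ioc (0 : ℝ) 1, |transferIter α n (F x) x| := abs_integral_le_integral_abs
    _ ≤ ∫ x in Set.Ioc (0 : ℝ) 1,
          (C * (2 * B) * envelope β n x + κ * transferIter α n (fun _ => 1) x) :=
        setIntegral_mono_on h1.abs (((integrableOn_envelope hβ1 n).const_mul _).add
          ((hone.integrableOn hβ1).const_mul _)) measurableSet_Ioc hpt
    _ = C * (2 * B) * (∫ x in Set.Ioc (0 : ℝ) 1, envelope β n x)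
          + κ * ∫ x in Set.Ioc (0 : ℝ) 1, transferIter α n (fun _ => 1) x := by
        rw [integral_add ((integrableOn_envelope hβ1 n).const_mul _)
          ((hone.integrableOn hβ1).const_mul _), integral_const_mul, integral_const_mul]
    _ ≤ C * (2 * B) * ((2 + 1 / β) * rate β n) + κ * 1 :=
        add_le_add (mul_le_mul_of_nonneg_left (integral_envelope_le hβ0 hβ n) (by positivity))
          (mul_le_mul_of_nonneg_left hone.integral_le hκ0)
    _ = _ := by ring

lemma integrableOn_mul_bounded {u H : ℝ → ℝ} {g : ℝ} (hu : IntegrableOn u (Set.Ioc 0 1))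
    (hH : Measurable H) (hg : ∀ x, |H x| ≤ g) :
    IntegrableOn (fun y => u y * H y) (Set.Ioc 0 1) :=
  Integrable.mul_bdd (c := g) hu hH.aestronglyMeasurable (Eventually.of_forall hg)

/-- A function of the image point acts as a constant multiplier of `u`, so `G` needs no regularity
beyond measurability and boundedness. -/
lemma DecayBound.mul {C B g : ℝ} (hβ : β ≤ 1 / 2) (hC : DecayBound β C) (hα : Admissible β α)
    {u G : ℝ → ℝ} (hu : IsConeDiff β B u) (h0 : ∫ y in Set.Ioc (0 : ℝ) 1, u y = 0)
    (hG : Measurable G) (hg : ∀ x, |G x| ≤ g) (n : ℕ) :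
    |∫ y in Set.Ioc (0 : ℝ) 1, u y * G (comp α n y)| ≤ C * (g * B) * rate β n := by
  have h := hC.2 α n (g * B) 0 (fun x y => G x * u y) hα
    (fun x => (hu.const_mul (G x)).mono (mul_le_mul_of_nonneg_right (hg x) hu.nonneg))
    (fun x => by rw [integral_const_mul, h0]; simp)
    ((integrableOn_mul_bounded (hu.integrableOn (by linarith))
      (hG.comp (measurable_comp α n)) (fun x => hg _)).congr_fun
        (fun x _ => mul_comm _ _) measurableSet_Ioc)
  rw [add_zero] at h
  simpa only [mul_comm (u _)] using h

lemma integral_mul_comp (hα : Admissible β α) {u H : ℝ → ℝ} {g : ℝ}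
    (hu : IntegrableOn u (Set.Ioc 0 1)) (hH : Measurable H) (hg : ∀ x, |H x| ≤ g) (n : ℕ) :
    ∫ y in Set.Ioc (0 : ℝ) 1, u y * H (comp α n y)
      = ∫ y in Set.Ioc (0 : ℝ) 1, transferIter α n u y * H y := by
  have h := (integral_transferIter hα n (fun x y => H x * u y)
    ((integrableOn_mul_bounded hu (hH.comp (measurable_comp α n)) (fun x => hg _)).congr_fun
        (fun x _ => mul_comm _ _) measurableSet_Ioc)).2
  have e : ∀ x, transferIter α n (fun y => H x * u y) x = transferIter α n u x * H x := by
    intro x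
    have := transferIter_linear α n (H x) 0 u u x
    simp only [zero_mul, add_zero] at this
    rw [this, mul_comm]
  simp only [e] at h
  rw [h]
  exact integral_congr_ae (Eventually.of_forall fun x => mul_comm _ _)

/-- The sequence of parameters seen from time `k` on. -/
def shift (α : ℕ → ℝ) (k : ℕ) : ℕ → ℝ := fun i => α (k + i)

lemma Admissible.shift (hα : Admissible β α) (k : ℕ) : Admissible β (shift α k) :=
  fun n hn => hα (k + n) (by omega)

lemma comp_add (α : ℕ → ℝ) (k n : ℕ) (x : ℝ) :
    comp α (k + n) x = comp (shift α k) n (comp α k x) := by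
  induction n with
  | zero => rfl
  | succ n ih =>
    change map (α (k + n + 1)) (comp α (k + n) x) = _
    rw [ih]; rfl

lemma comp_of_le (α : ℕ → ℝ) {k n : ℕ} (h : k ≤ n) (x : ℝ) :
    comp α n x = comp (shift α k) (n - k) (comp α k x) := by
  rw [← comp_add, Nat.add_sub_cancel' h]

end Decay

section Correlations

/-- Bounded Lipschitz observables along a sequential orbit, centred with respect to the
initial density `φ`. -/
structure Observables (β b l : ℝ) (α : ℕ → ℝ) (φ : ℝ → ℝ) (f : ℕ → ℝ → ℝ) : Prop where
  admissible : Admissible β α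
  cone : Cone β 1 φ
  integral_eq : ∫ x in Set.Ioc (0 : ℝ) 1, φ x = 1
  measurable : ∀ i, Measurable (f i)
  bound : ∀ i x, |f i x| ≤ b
  lip_nonneg : 0 ≤ l
  lipschitz : ∀ i x y, |f i x - f i y| ≤ l * |x - y|
  centred : ∀ i, ∫ x in Set.Ioc (0 : ℝ) 1, φ x * f i (comp α i x) = 0

variable {β b l C : ℝ} {α : ℕ → ℝ} {φ : ℝ → ℝ} {f : ℕ → ℝ → ℝ}

namespace Observables

lemma bound_nonneg (h : Observables β b l α φ f) : 0 ≤ b := (abs_nonneg _).trans (h.bound 0 0)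

lemma integral_law (h : Observables β b l α φ f) (hβ : β ≤ 1 / 2) {H : ℝ → ℝ} {g : ℝ}
    (hH : Measurable H) (hg : ∀ x, |H x| ≤ g) (k : ℕ) :
    ∫ x in Set.Ioc (0 : ℝ) 1, φ x * H (comp α k x)
      = ∫ x in Set.Ioc (0 : ℝ) 1, transferIter α k φ x * H x :=
  integral_mul_comp h.admissible (h.cone.integrableOn (by linarith)) hH hg k

lemma integral_density (h : Observables β b l α φ f) (hβ : β ≤ 1 / 2) (k : ℕ) :
    ∫ x in Set.Ioc (0 : ℝ) 1, transferIter α k φ x = 1 := by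
  have := h.integral_law hβ (H := fun _ => 1) (g := 1) measurable_const (by simp) k
  simpa [h.integral_eq] using this.symm

lemma isConeDiff_mul (h : Observables β b l α φ f) (hβ0 : 0 < β) (hβ : β ≤ 1 / 2) {B : ℝ}
    {u : ℝ → ℝ} (hu : IsConeDiff β B u) (i : ℕ) :
    IsConeDiff β (50 * (b + l / β) * B) (fun x => f i x * u x) :=
  hu.mul_lipschitz hβ0 hβ h.lip_nonneg (h.measurable i) (h.bound i) (h.lipschitz i)

lemma integral_observable (h : Observables β b l α φ f) (hβ : β ≤ 1 / 2) (i : ℕ) :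
    ∫ x in Set.Ioc (0 : ℝ) 1, f i x * transferIter α i φ x = 0 := by
  have h1 := h.integral_law hβ (h.measurable i) (h.bound i) i
  rw [h.centred i] at h1
  simpa only [mul_comm] using h1.symm

/-- Decay of correlations of a single observable with the future. -/
lemma abs_integral_future_le (h : Observables β b l α φ f) (hβ0 : 0 < β) (hβ : β ≤ 1 / 2)
    (hC : DecayBound β C) {G : ℝ → ℝ} {g : ℝ} (hG : Measurable G) (hg : ∀ x, |G x| ≤ g)
    {i k : ℕ} (hik : i ≤ k) :
    |∫ x in Set.Ioc (0 : ℝ) 1, φ x * (f i (comp α i x) * G (comp α k x))|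
      ≤ C * (g * (50 * (b + l / β))) * rate β (k - i) := by
  have hGm := hG.comp (measurable_comp (shift α i) (k - i))
  have hb : ∀ x, |f i x * G (comp (shift α i) (k - i) x)| ≤ b * g := fun x => by
    rw [abs_mul]
    exact mul_le_mul (h.bound i x) (hg _) (abs_nonneg _) h.bound_nonneg
  have h1 := h.integral_law hβ (H := fun y => f i y * G (comp (shift α i) (k - i) y))
    ((h.measurable i).mul hGm) hb i
  simp only [← comp_of_le α hik] at h1
  rw [h1]
  have h2 := hC.mul hβ (h.admissible.shift i) (h.isConeDiff_mul hβ0 hβ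
    (h.cone.transferIter hβ h.admissible i).isConeDiff i) (h.integral_observable hβ i) hG hg (k - i)
  rw [mul_one] at h2
  refine le_of_eq_of_le (congrArg _ (integral_congr_ae (Eventually.of_forall fun x => ?_))) h2
  simp only; ring

/-- Decay of correlations of a pair of observables with the future. -/
lemma abs_cov_pair_future_le (h : Observables β b l α φ f) (hβ0 : 0 < β) (hβ : β ≤ 1 / 2)
    (hC : DecayBound β C) {G : ℝ → ℝ} {g : ℝ} (hG : Measurable G) (hg : ∀ x, |G x| ≤ g)
    {i j k : ℕ} (hij : i ≤ j) (hjk : j ≤ k) :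
    |(∫ x in Set.Ioc (0 : ℝ) 1,
        φ x * (f i (comp α i x) * f j (comp α j x) * G (comp α k x)))
      - (∫ x in Set.Ioc (0 : ℝ) 1, φ x * (f i (comp α i x) * f j (comp α j x)))
        * ∫ x in Set.Ioc (0 : ℝ) 1, φ x * G (comp α k x)|
      ≤ C * (g * (2 * (50 * (b + l / β)) ^ 2)) * rate β (k - j) := by
  have hβ1 : β < 1 := by linarith
  have hb0 := h.bound_nonneg
  set G' : ℝ → ℝ := fun y => G (comp (shift α j) (k - j) y) with hG'
  have hGm : Measurable G' := hG.comp (measurable_comp (shift α j) (k - j))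
  have hgG : ∀ x, |G' x| ≤ g := fun x => hg _
  have hφi := (h.cone.transferIter hβ h.admissible i).isConeDiff
  have hφj := (h.cone.transferIter hβ h.admissible j).isConeDiff
  have hv0 := h.isConeDiff_mul hβ0 hβ hφi i
  -- Weighting the density by `f i` at time `i` and by `f j` at time `j` keeps it a difference of
  -- cone functions. The covariance with the future is then the decay of `f j * v` minus its mean
  -- times the law at time `j`.
  set v : ℝ → ℝ := transferIter (shift α i) (j - i) (fun y => f i y * transferIter α i φ y) with hv
  have hv1 : IsConeDiff β _ v := hv0.transferIter hβ (h.admissible.shift i) (j - i)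
  have hv2 := h.isConeDiff_mul hβ0 hβ hv1 j
  have key : ∀ {H : ℝ → ℝ} {g : ℝ}, Measurable H → (∀ x, |H x| ≤ g) →
      ∫ x in Set.Ioc (0 : ℝ) 1, φ x * (f i (comp α i x) * f j (comp α j x) * H (comp α j x))
        = ∫ y in Set.Ioc (0 : ℝ) 1, f j y * v y * H y := by
    intro H g hH hg
    have hm : Measurable fun y => f j y * H y := (h.measurable j).mul hH
    have hbd : ∀ x, |f j x * H x| ≤ b * g := fun x => by
      rw [abs_mul]
      exact mul_le_mul (h.bound j x) (hg _) (abs_nonneg _) hb0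
    have h1 := h.integral_law hβ (H := fun y => f i y *
      (f j (comp (shift α i) (j - i) y) * H (comp (shift α i) (j - i) y)))
      ((h.measurable i).mul (hm.comp (measurable_comp _ _))) (g := b * (b * g)) (fun x => by
        rw [abs_mul]
        exact mul_le_mul (h.bound i x) (hbd _) (abs_nonneg _) hb0) i
    simp only [← comp_of_le α hij] at h1
    have h2 := integral_mul_comp (h.admissible.shift i) (hv0.integrableOn hβ1) hm hbd (j - i)
    calc _ = _ := by simp only [← mul_assoc] at h1 ⊢; exact h1
      _ = _ := integral_congr_ae (Eventually.of_forall fun x => by ring)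
      _ = _ := h2
      _ = _ := integral_congr_ae (Eventually.of_forall fun x => by simp only [hv]; ring)
  have e1 := key hGm hgG
  have e2 := key (H := fun _ => 1) (g := 1) measurable_const (by simp)
  have e3 := h.integral_law hβ hGm hgG j
  simp only [mul_one] at e2
  simp only [hG', ← comp_of_le α hjk] at e1 e3
  rw [e1, e2, e3]
  set κ := ∫ y in Set.Ioc (0 : ℝ) 1, f j y * v y with hκ
  have hB := hv2.nonneg
  have hu : IsConeDiff β (2 * (50 * (b + l / β)) ^ 2)
      (fun y => f j y * v y - κ * transferIter α j φ y) :=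
    (hv2.sub hβ1 (hφj.const_mul κ)).mono (by
      have := hv2.abs_integral_le hβ1
      rw [← hκ] at this
      calc _ ≤ _ := add_le_add_right (mul_le_mul_of_nonneg_right this zero_le_one) _
        _ = _ := by ring)
  have h0 : ∫ y in Set.Ioc (0 : ℝ) 1, (f j y * v y - κ * transferIter α j φ y) = 0 := by
    rw [integral_sub (hv2.integrableOn hβ1) ((hφj.integrableOn hβ1).const_mul κ),
      integral_const_mul, h.integral_density hβ j, ← hκ]
    ring
  have h3 := hC.mul hβ (h.admissible.shift j) hu h0 hG hg (k - j)
  refine le_of_eq_of_le (congrArg _ ?_) h3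
  rw [← integral_const_mul, ← integral_sub
    (integrableOn_mul_bounded (hv2.integrableOn hβ1) hGm hgG)
    ((integrableOn_mul_bounded (hφj.integrableOn hβ1) hGm hgG).const_mul κ)]
  refine integral_congr_ae (Eventually.of_forall fun x => ?_)
  simp only [hG']; ring

lemma abs_correlation_le (h : Observables β b l α φ f) (hβ0 : 0 < β) (hβ : β ≤ 1 / 2)
    (hC : DecayBound β C) (i j : ℕ) :
    |∫ x in Set.Ioc (0 : ℝ) 1, φ x * (f i (comp α i x) * f j (comp α j x))|
      ≤ C * (b * (50 * (b + l / β))) * rate β (Nat.dist i j) := by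
  wlog hij : i ≤ j generalizing i j
  · have := this j i (by omega)
    rw [Nat.dist_comm] at this
    simpa only [mul_comm (f j _)] using this
  rw [Nat.dist_eq_sub_of_le hij]
  exact h.abs_integral_future_le hβ0 hβ hC (h.measurable j) (h.bound j) hij

lemma abs_integral_le_of_abs_le (h : Observables β b l α φ f) (hβ : β ≤ 1 / 2) {H : ℝ → ℝ} {g : ℝ}
    (hg : ∀ x, |H x| ≤ g) : |∫ x in Set.Ioc (0 : ℝ) 1, φ x * H x| ≤ g := by
  have hi := h.cone.integrableOn (by linarith)
  calc _ ≤ ∫ x in Set.Ioc (0 : ℝ) 1, φ x * g := by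
        refine norm_integral_le_of_norm_le (f := fun x => φ x * H x) (hi.mul_const g) ?_
        filter_upwards [ae_restrict_mem measurableSet_Ioc] with x hx
        rw [Real.norm_eq_abs, abs_mul, abs_of_nonneg (h.cone.nonneg x hx)]
        exact mul_le_mul_of_nonneg_left (hg x) (h.cone.nonneg x hx)
    _ = g := by rw [integral_mul_const, h.integral_eq, one_mul]

/-- By symmetry `i` may be taken as the smallest index, with `i ≤ j` and `k ≤ m`. If the pairs do
not interlace, the gap from `j` to `k` decorrelates them. If `k < j`, the gap from `i` to `k` makes
both the joint moment and the product of the moments small, since `f i` is centred. -/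
lemma abs_cov_pairs_le (h : Observables β b l α φ f) (hβ0 : 0 < β) (hβ : β ≤ 1 / 2)
    (hC : DecayBound β C) (i j k m : ℕ) :
    |(∫ x in Set.Ioc (0 : ℝ) 1, φ x * (f i (comp α i x) * f j (comp α j x)
          * (f k (comp α k x) * f m (comp α m x))))
      - (∫ x in Set.Ioc (0 : ℝ) 1, φ x * (f i (comp α i x) * f j (comp α j x)))
        * ∫ x in Set.Ioc (0 : ℝ) 1, φ x * (f k (comp α k x) * f m (comp α m x))|
      ≤ C * (2 * (b ^ 2 + b ^ 3) * (50 * (b + l / β) + (50 * (b + l / β)) ^ 2))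
        * (rate β (Nat.dist i k) + rate β (Nat.dist i m)
          + rate β (Nat.dist j k) + rate β (Nat.dist j m)) := by
  wlog hij : i ≤ j generalizing i j
  · have := this j i (by omega)
    simp only [mul_comm (f j _) (f i _)] at this
    refine this.trans (le_of_eq ?_)
    ring
  wlog hkm : k ≤ m generalizing k m
  · have := this m k (by omega)
    simp only [mul_comm (f m _) (f k _)] at this
    refine this.trans (le_of_eq ?_)
    ring
  wlog hik : i ≤ k generalizing i j k m
  · have := this k m hkm i j hij (by omega)
    simp only [mul_comm (f k _ * f m _) (f i _ * f j _), Nat.dist_comm k, Nat.dist_comm m] at this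
    rw [mul_comm (∫ x in Set.Ioc (0 : ℝ) 1, φ x * (f k (comp α k x) * f m (comp α m x)))] at this
    refine this.trans (le_of_eq ?_)
    ring
  have hb := h.bound_nonneg
  have hl := h.lip_nonneg
  have hC0 := hC.1
  set D := 50 * (b + l / β) with hD
  have hD0 : 0 ≤ D := by positivity
  have hr : ∀ n, 0 ≤ rate β n := rate_nonneg
  have hprod : ∀ {x y c d : ℝ}, |x| ≤ c → |y| ≤ d → |x * y| ≤ c * d := fun {x y c d} hx hy => by
    rw [abs_mul]; exact mul_le_mul hx hy (abs_nonneg _) ((abs_nonneg _).trans hx)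
  rcases le_or_gt j k with hjk | hkj
  · have h1 := h.abs_cov_pair_future_le hβ0 hβ hC
      (G := fun y => f k y * f m (comp (shift α k) (m - k) y)) (g := b * b)
      ((h.measurable k).mul ((h.measurable m).comp (measurable_comp _ _)))
      (fun x => hprod (h.bound k x) (h.bound m _)) hij hjk
    simp only [← comp_of_le α hkm] at h1
    rw [Nat.dist_eq_sub_of_le hjk]
    refine h1.trans (mul_le_mul (mul_le_mul_of_nonneg_left ?_ hC0.le)
      (by linarith [hr (Nat.dist i k), hr (Nat.dist i m), hr (Nat.dist j m)]) (hr _)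
      (by positivity))
    have : 0 ≤ b ^ 2 * D := by positivity
    have : 0 ≤ b ^ 3 * (D + D ^ 2) := by positivity
    nlinarith
  · have h1 := h.abs_integral_future_le hβ0 hβ hC
      (G := fun y => f j (comp (shift α k) (j - k) y) * (f k y * f m (comp (shift α k) (m - k) y)))
      (g := b * (b * b))
      (((h.measurable j).comp (measurable_comp _ _)).mul
        ((h.measurable k).mul ((h.measurable m).comp (measurable_comp _ _))))
      (fun x => hprod (h.bound j _) (hprod (h.bound k x) (h.bound m _))) hik
    have h2 := h.abs_integral_future_le hβ0 hβ hC
      (G := fun y => f j (comp (shift α k) (j - k) y)) (g := b)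
      ((h.measurable j).comp (measurable_comp _ _)) (fun x => h.bound j _) hik
    have h3 := h.abs_integral_le_of_abs_le hβ (H := fun x => f k (comp α k x) * f m (comp α m x))
      (fun x => hprod (h.bound k _) (h.bound m _))
    simp only [← comp_of_le α hkm, ← comp_of_le α hkj.le] at h1 h2
    simp only [← mul_assoc (f i _) (f j _)] at h1
    rw [Nat.dist_eq_sub_of_le hik]
    refine (abs_sub _ _).trans ((add_le_add h1 (hprod h2 h3)).trans ?_)
    calc _ = C * (2 * b ^ 3 * D) * rate β (k - i) := by ring
      _ ≤ _ := mul_le_mul (mul_le_mul_of_nonneg_left ?_ hC0.le)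
        (by linarith [hr (Nat.dist j k), hr (Nat.dist i m), hr (Nat.dist j m)]) (hr _)
        (by positivity)
    have : 0 ≤ b ^ 2 * (D + D ^ 2) := by positivity
    have : 0 ≤ b ^ 3 * D ^ 2 := by positivity
    nlinarith

end Observables

end Correlations

end Intermittent

/-! ### Decoupling an observable from the past and the future beyond a window. -/

namespace Intermittent

lemma sum_gap_eq {N n : ℕ} (hn : n < N) (K : ℕ) (g : ℕ → ℝ) :
    ∑ j ∈ Finset.range N, (if Nat.dist n j ≤ K then 0 else g j)
      = ∑ j ∈ Finset.range (n - K), g j + ∑ j ∈ Finset.range N, if n + K < j then g j else 0 := by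
  have h1 : ∑ j ∈ Finset.range (n - K), g j
      = ∑ j ∈ Finset.range N, if j < n - K then g j else 0 := by
    rw [← Finset.sum_filter]
    refine Finset.sum_congr ?_ fun _ _ => rfl
    ext j
    simp only [Finset.mem_range, Finset.mem_filter]
    omega
  rw [h1, ← Finset.sum_add_distrib]
  refine Finset.sum_congr rfl fun j _ => ?_
  unfold Nat.dist
  split_ifs <;> first | omega | simp

namespace Observables

variable {β b l C : ℝ} {α : ℕ → ℝ} {φ : ℝ → ℝ} {f : ℕ → ℝ → ℝ}

lemma integral_density_mul (h : Observables β b l α φ f) (hβ : β ≤ 1 / 2) {s n : ℕ} (hs : s ≤ n) :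
    ∫ y in Set.Ioc (0 : ℝ) 1, transferIter α s φ y * f n (comp (shift α s) (n - s) y) = 0 := by
  have h1 := h.integral_law hβ (H := fun y => f n (comp (shift α s) (n - s) y))
    ((h.measurable n).comp (measurable_comp _ _)) (fun x => h.bound n _) s
  simp only [← comp_of_le α hs] at h1
  rw [← h1, h.centred n]

/-- The past weighted density is almost uncorrelated with an observable after a gap. -/
lemma abs_integral_pastDensity_mul_le (h : Observables β b l α φ f) (hβ0 : 0 < β) (hβ : β ≤ 1 / 2)
    (hC : DecayBound β C) {a : ℝ → ℝ} {w : ℕ → ℝ → ℝ} {K n : ℕ} {q B : ℝ}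
    (hψ : IsConeDiff β B (pastDensity α a φ w (n - K) q)) :
    |∫ y in Set.Ioc (0 : ℝ) 1, pastDensity α a φ w (n - K) q y
        * f n (comp (shift α (n - K)) (n - (n - K)) y)|
      ≤ C * (b * (2 * B)) * rate β K := by
  have hβ1 : β < 1 := by linarith
  have hz := h.integral_density_mul hβ (Nat.sub_le n K)
  have hb := h.bound_nonneg
  have hB := hψ.nonneg
  -- For `n < K` the truncated difference `n - K` is `0` and the gap is shorter than `K`. The past
  -- is then empty and centring makes the integral vanish.
  rcases lt_or_ge n K with hn | hn
  · have hs : n - K = 0 := by omega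
    rw [hs] at hz ⊢
    have e : ∀ y, pastDensity α a φ w 0 q y * f n (comp (shift α 0) (n - 0) y)
        = a q * (transferIter α 0 φ y * f n (comp (shift α 0) (n - 0) y)) := fun y => by
      simp only [pastDensity, transferIter]; ring
    simp only [e]
    rw [integral_const_mul, hz, mul_zero, abs_zero]
    have := rate_nonneg (β := β) K
    have := hC.1
    positivity
  · have hp : n - (n - K) = K := by omega
    rw [hp] at hz ⊢
    set s := n - K
    set ψ := pastDensity α a φ w s q
    set c := ∫ y in Set.Ioc (0 : ℝ) 1, ψ y with hc
    have hφs := (h.cone.transferIter hβ h.admissible s).isConeDiff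
    have hu : IsConeDiff β (2 * B) (fun y => ψ y - c * transferIter α s φ y) :=
      (hψ.sub hβ1 (hφs.const_mul c)).mono (by
        have := hψ.abs_integral_le hβ1
        rw [← hc] at this
        linarith)
    have h0 : ∫ y in Set.Ioc (0 : ℝ) 1, (ψ y - c * transferIter α s φ y) = 0 := by
      rw [integral_sub (hψ.integrableOn hβ1) ((hφs.integrableOn hβ1).const_mul c),
        integral_const_mul, h.integral_density hβ s, ← hc]
      ring
    have h3 := hC.mul hβ (h.admissible.shift s) hu h0 (h.measurable n) (h.bound n) K
    refine le_of_eq_of_le (congrArg _ ?_) h3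
    have hm : Measurable fun x => f n (comp (shift α s) K x) :=
      (h.measurable n).comp (measurable_comp (shift α s) K)
    have hbd : ∀ x, |f n (comp (shift α s) K x)| ≤ b := fun x => h.bound n _
    have e : ∀ y, (ψ y - c * transferIter α s φ y) * f n (comp (shift α s) K y)
        = ψ y * f n (comp (shift α s) K y)
          - c * (transferIter α s φ y * f n (comp (shift α s) K y)) := fun y => by ring
    simp only [e]
    rw [integral_sub (integrableOn_mul_bounded (hψ.integrableOn hβ1) hm hbd)
      ((integrableOn_mul_bounded (hφs.integrableOn hβ1) hm hbd).const_mul c),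
      integral_const_mul, hz, mul_zero, sub_zero]

/-- An observable is almost uncorrelated with functionals of the observables at times at a distance
larger than `K`. -/
lemma abs_integral_gap_le (h : Observables β b l α φ f) (hβ0 : 0 < β) (hβ : β ≤ 1 / 2)
    (hC : DecayBound β C) {A : ℝ → ℝ} {a₀ la ρ : ℝ} (hA : Measurable A) (hA0 : ∀ q, |A q| ≤ a₀)
    (hla : 0 ≤ la) (hAl : ∀ q q', |A q - A q'| ≤ la * |q - q'|) (hρ0 : 0 ≤ ρ) (hρ1 : ρ ≤ 1)
    {N n : ℕ} (hn : n < N) (K : ℕ) :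
    |∫ x in Set.Ioc (0 : ℝ) 1, φ x * (f n (comp α n x) * A (ρ *
        ∑ j ∈ Finset.range N, if Nat.dist n j ≤ K then 0 else f j (comp α j x)))|
      ≤ C * ((50 * (b + l / β) + 2 * b) * (12 * (2 * a₀) + 2 * (48 * (la * l) / β)))
        * rate β K := by
  have hβ1 : β < 1 := by linarith
  have hb := h.bound_nonneg
  set B := 12 * (2 * a₀) + 2 * (48 * (la * l) / β) with hB
  set s := n - K with hs
  have hsn : s ≤ n := Nat.sub_le n K
  -- The shift makes the weight nonnegative, as `pastDensity` requires; it does not change the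
  -- integral because `f n` is centred.
  set a : ℝ → ℝ := fun q => A q + a₀ with ha
  set w : ℕ → ℝ → ℝ := fun i x => ρ * f i x with hw
  -- The future part of the sum, written as a function of the point `z` at time `n + K`. It enters
  -- the past density as the parameter `q`.
  set Q : ℝ → ℝ := fun z => ∑ j ∈ Finset.range N,
    if n + K < j then ρ * f j (comp (shift α (n + K)) (j - (n + K)) z) else 0 with hQ
  have hQm : Measurable Q := by
    refine Finset.measurable_sum _ fun j _ => ?_
    by_cases hj : n + K < j
    · simp only [hj, if_true]
      exact ((h.measurable j).comp (measurable_comp _ _)).const_mul ρ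
    · simp only [hj, if_false]
      exact measurable_const
  have ham : Measurable a := hA.add_const a₀
  have ha0 : ∀ q, 0 ≤ a q := fun q => by linarith [(abs_le.1 (hA0 q)).1]
  have ha1 : ∀ q, a q ≤ 2 * a₀ := fun q => by
    have := (abs_le.1 (hA0 q)).2
    simp only [ha]; linarith
  have hal : ∀ q q', |a q - a q'| ≤ la * |q - q'| := fun q q' => by
    simpa only [ha, add_sub_add_right_eq_sub] using hAl q q'
  have hwm : ∀ i, Measurable (w i) := fun i => (h.measurable i).const_mul ρ
  have hwl : ∀ i x y, |w i x - w i y| ≤ l * |x - y| := fun i x y => by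
    simp only [hw]
    rw [← mul_sub, abs_mul, abs_of_nonneg hρ0]
    exact (mul_le_of_le_one_left (abs_nonneg _) hρ1).trans (h.lipschitz i x y)
  have hψ : ∀ q, IsConeDiff β B (pastDensity α a φ w s q) :=
    isConeDiff_pastDensity hβ0 hβ h.admissible h.cone ham ha0 ha1 hla hal hwm h.lip_nonneg hwl s
  have hfn : Measurable fun y => f n (comp (shift α s) (n - s) y) :=
    (h.measurable n).comp (measurable_comp _ _)
  have hQ' : Measurable fun y => Q (comp (shift α n) K (comp (shift α s) (n - s) y)) :=
    hQm.comp ((measurable_comp _ _).comp (measurable_comp _ _))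
  obtain ⟨hi, he⟩ := integral_pastDensity hβ h.admissible h.cone ham ha0 ha1 hla hal hwm
    h.lip_nonneg hwl s hQ' hfn (fun x => h.bound n _)
  have hsum : ∀ x, ∑ i ∈ Finset.range s, w i (comp α i x)
      + Q (comp (shift α n) K (comp (shift α s) (n - s) (comp α s x)))
      = ρ * ∑ j ∈ Finset.range N, if Nat.dist n j ≤ K then 0 else f j (comp α j x) := by
    intro x
    rw [sum_gap_eq hn, mul_add, Finset.mul_sum, Finset.mul_sum, ← comp_of_le α hsn, ← comp_add]
    congr 1
    refine Finset.sum_congr rfl fun j _ => ?_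
    split_ifs with hj
    · rw [← comp_of_le α hj.le]
    · simp
  simp only [hsum] at he
  simp only [← comp_of_le α hsn] at he
  set W' : ℝ → ℝ := fun x =>
    ρ * ∑ j ∈ Finset.range N, if Nat.dist n j ≤ K then 0 else f j (comp α j x) with hW'
  have hW'm : Measurable W' := by
    refine (Finset.measurable_sum _ fun j _ => ?_).const_mul ρ
    by_cases hj : Nat.dist n j ≤ K
    · simp only [hj, if_true]; exact measurable_const
    · simp only [hj, if_false]; exact (h.measurable j).comp (measurable_comp _ _)
  have hshift : ∫ x in Set.Ioc (0 : ℝ) 1, φ x * (f n (comp α n x) * A (W' x))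
      = ∫ x in Set.Ioc (0 : ℝ) 1, φ x * (a (W' x) * f n (comp α n x)) := by
    have hφi := h.cone.integrableOn hβ1
    have hXm : Measurable fun x => f n (comp α n x) := (h.measurable n).comp (measurable_comp _ _)
    have i1 := integrableOn_mul_bounded (g := b * a₀) hφi (hXm.mul (hA.comp hW'm)) (fun x => by
      rw [Pi.mul_apply, abs_mul]
      exact mul_le_mul (h.bound n _) (hA0 _) (abs_nonneg _) hb)
    have i2 := (integrableOn_mul_bounded hφi hXm (fun x => h.bound n _)).const_mul a₀
    have := integral_add i1 i2
    rw [integral_const_mul, h.centred n, mul_zero, add_zero] at this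
    refine this.symm.trans (integral_congr_ae (Eventually.of_forall fun x => ?_))
    simp only [ha, Pi.mul_apply, Function.comp]; ring
  have hσ := h.admissible.shift s
  -- Transport from time `n - K` to time `n`: both `f n` and the future depend on the image point
  -- only.
  obtain ⟨j1, j2⟩ := integral_transferIter hσ (n - s)
    (fun x y => pastDensity α a φ w s (Q (comp (shift α n) K x)) y * f n x) hi
  have e : ∀ z x, transferIter (shift α s) (n - s)
      (fun y => pastDensity α a φ w s (Q z) y * f n x) x
      = f n x * transferIter (shift α s) (n - s) (pastDensity α a φ w s (Q z)) x := fun z x => by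
    have := transferIter_linear (shift α s) (n - s) (f n x) 0 (pastDensity α a φ w s (Q z))
      (fun _ => 0) x
    simp only [zero_mul, add_zero] at this
    rw [← this]
    congr 1; funext y; ring
  simp only [e] at j1 j2
  -- For a frozen future the gap before `n` already makes the mean small, uniformly in `z`. The gap
  -- after `n`, used in `hfin`, then permits freezing the future.
  have hκ : ∀ z, |∫ x in Set.Ioc (0 : ℝ) 1,
      f n x * transferIter (shift α s) (n - s) (pastDensity α a φ w s (Q z)) x|
      ≤ C * (b * (2 * B)) * rate β K := fun z => by
    have h1 := h.abs_integral_pastDensity_mul_le hβ0 hβ hC (hψ (Q z))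
    rw [integral_mul_comp hσ ((hψ (Q z)).integrableOn hβ1) (h.measurable n) (h.bound n)] at h1
    simpa only [mul_comm (f n _)] using h1
  have hfin := hC.2 (shift α n) K _ _
    (fun z x => f n x * transferIter (shift α s) (n - s) (pastDensity α a φ w s (Q z)) x)
    (h.admissible.shift n)
    (fun z => h.isConeDiff_mul hβ0 hβ ((hψ (Q z)).transferIter hβ hσ (n - s)) n) hκ j1
  rw [hshift, he, ← j2]
  refine hfin.trans (le_of_eq ?_)
  ring

end Observables

end Intermittent

/-! ### Summability of the rate and the choice of the window. -/

namespace Intermittent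

section Rates

variable {β : ℝ}

lemma one_add_log_le {x : ℝ} (hx : 1 ≤ x) : 1 + Real.log x ≤ 5 * x ^ (1 / 4 : ℝ) := by
  have h1 := Real.log_le_rpow_div (zero_le_one.trans hx) (by norm_num : (0 : ℝ) < 1 / 4)
  have h2 : 1 ≤ x ^ (1 / 4 : ℝ) := Real.one_le_rpow hx (by norm_num)
  linarith

/-- The exponent `1 / β - 1` is split as `(1 / (2β) - 1) + 1 / (2β)`. The second part exceeds `3 /
2` and stays summable after paying for the logarithm; the first, at `m ≥ N ^ β`, is exactly the
factor `N ^ (β - 1 / 2)`. -/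
lemma rate_le (hβ0 : 0 < β) (hβ : β < 1 / 3) (m : ℕ) :
    rate β m ≤ ((m : ℝ) + 1) ^ (-(1 / (2 * β) - 1)) * (5 * ((m : ℝ) + 1) ^ (-(5 / 4) : ℝ)) := by
  have hm : (1 : ℝ) ≤ (m : ℝ) + 1 := by linarith [m.cast_nonneg (α := ℝ)]
  have hm0 : (0 : ℝ) < (m : ℝ) + 1 := by linarith
  have e : -(1 / β - 1) = -(1 / (2 * β) - 1) + -(1 / (2 * β)) := by
    field_simp; ring
  have hq : (3 / 2 : ℝ) ≤ 1 / (2 * β) := by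
    rw [le_div_iff₀ (by positivity)]; linarith
  unfold rate
  rw [e, Real.rpow_add hm0, mul_assoc]
  refine mul_le_mul_of_nonneg_left ?_ (by positivity)
  calc ((m : ℝ) + 1) ^ (-(1 / (2 * β))) * (1 + Real.log (m + 1))
      ≤ ((m : ℝ) + 1) ^ (-(3 / 2) : ℝ) * (5 * ((m : ℝ) + 1) ^ (1 / 4 : ℝ)) :=
        mul_le_mul (Real.rpow_le_rpow_of_exponent_le hm (by linarith)) (one_add_log_le hm)
          (by linarith [Real.log_nonneg hm]) (by positivity)
    _ = 5 * (((m : ℝ) + 1) ^ (-(3 / 2) : ℝ) * ((m : ℝ) + 1) ^ (1 / 4 : ℝ)) := by ring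
    _ = _ := by rw [← Real.rpow_add hm0]; norm_num

lemma summable_rpow_succ : Summable fun m : ℕ => 5 * ((m : ℝ) + 1) ^ (-(5 / 4) : ℝ) := by
  have h := (summable_nat_add_iff 1).2 (Real.summable_nat_rpow.2 (by norm_num : -(5 / 4 : ℝ) < -1))
  simpa using h.mul_left 5

/-- Summability of the rate, with the tail beyond `N ^ β` quantified. -/
lemma exists_sum_rate_le (hβ0 : 0 < β) (hβ : β < 1 / 3) : ∃ S : ℝ, 0 ≤ S ∧
    (∀ n, ∑ m ∈ Finset.range n, rate β m ≤ S) ∧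
    ∀ N K : ℕ, 1 ≤ N → (N : ℝ) ^ β ≤ K → ∀ n,
      ∑ m ∈ Finset.range n, (if m ≤ K then 0 else rate β m) ≤ S * (N : ℝ) ^ (β - 1 / 2) := by
  have hsum := summable_rpow_succ
  have h0 : ∀ m : ℕ, 0 ≤ 5 * ((m : ℝ) + 1) ^ (-(5 / 4) : ℝ) := fun m => by positivity
  have hq : 0 ≤ 1 / (2 * β) - 1 := by
    rw [sub_nonneg, le_div_iff₀ (by positivity)]; linarith
  set S := ∑' m : ℕ, 5 * ((m : ℝ) + 1) ^ (-(5 / 4) : ℝ)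
  refine ⟨S, tsum_nonneg h0, fun n => ?_, fun N K hN hK n => ?_⟩
  · refine (Finset.sum_le_sum fun m _ => ?_).trans (hsum.sum_le_tsum _ fun m _ => h0 m)
    refine (rate_le hβ0 hβ m).trans (mul_le_of_le_one_left (h0 m) ?_)
    exact Real.rpow_le_one_of_one_le_of_nonpos (by linarith [m.cast_nonneg (α := ℝ)]) (by linarith)
  · have hN0 : (0 : ℝ) < N := by exact_mod_cast hN
    rw [mul_comm S]
    refine le_trans ?_ (mul_le_mul_of_nonneg_left
      (hsum.sum_le_tsum (Finset.range n) fun m _ => h0 m) (Real.rpow_nonneg hN0.le _))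
    rw [Finset.mul_sum]
    refine Finset.sum_le_sum fun m _ => ?_
    split_ifs with h
    · have := h0 m
      positivity
    · refine (rate_le hβ0 hβ m).trans (mul_le_mul_of_nonneg_right ?_ (h0 m))
      have hmK : (K : ℝ) ≤ (m : ℝ) + 1 := by
        have : K ≤ m + 1 := by omega
        exact_mod_cast this
      calc ((m : ℝ) + 1) ^ (-(1 / (2 * β) - 1)) ≤ ((N : ℝ) ^ β) ^ (-(1 / (2 * β) - 1)) :=
            Real.rpow_le_rpow_of_nonpos (by positivity) (hK.trans hmK) (by linarith)
        _ = (N : ℝ) ^ (β - 1 / 2) := by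
            rw [← Real.rpow_mul hN0.le]
            congr 1
            field_simp
            ring

variable {N : ℕ}

lemma one_le_mul_log (hN : 2 ≤ N) : 1 ≤ 2 * Real.log N := by
  have h1 : Real.log 2 ≤ Real.log N := Real.log_le_log (by norm_num) (by exact_mod_cast hN)
  linarith [Real.log_two_gt_d9]

/-- The factor `2` lifts the base above `1`, since `log N` itself is below `1` at `N = 2`. -/
lemma log_le_rpow_log (hβ0 : 0 < β) (hβ : β < 1 / 3) (hN : 2 ≤ N) :
    Real.log N ≤ (2 : ℝ) ^ (1 / β) * Real.log N ^ (1 / β) := by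
  have h1 := one_le_mul_log hN
  have h2 : 0 ≤ Real.log N := by linarith
  rw [← Real.mul_rpow (by norm_num) h2]
  have h3 : (1 : ℝ) ≤ 1 / β := by rw [le_div_iff₀ hβ0]; linarith
  calc Real.log N ≤ 2 * Real.log N := by linarith
    _ = (2 * Real.log N) ^ (1 : ℝ) := (Real.rpow_one _).symm
    _ ≤ _ := Real.rpow_le_rpow_of_exponent_le h1 h3

lemma sqrt_mul_rate_le (hβ0 : 0 < β) (hβ : β < 1 / 3) (hN : 2 ≤ N) :
    √(N : ℝ) * rate β ⌈(N : ℝ) ^ β⌉₊ ≤ 4 * (N : ℝ) ^ (β - 1 / 2) * Real.log N := by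
  have hN2 : (2 : ℝ) ≤ N := by exact_mod_cast hN
  have hN0 : (0 : ℝ) < N := by linarith
  set K := ⌈(N : ℝ) ^ β⌉₊ with hK
  have hK1 : (N : ℝ) ^ β ≤ K := Nat.le_ceil _
  have hK2 : (K : ℝ) ≤ N := by
    have : K ≤ N := Nat.ceil_le.2 (by
      conv_rhs => rw [← Real.rpow_one (N : ℝ)]
      exact Real.rpow_le_rpow_of_exponent_le (by linarith) (by linarith))
    exact_mod_cast this
  have hlog : 1 + Real.log (K + 1) ≤ 4 * Real.log N := by
    have h1 : Real.log (K + 1) ≤ Real.log ((N : ℝ) ^ 2) :=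
      Real.log_le_log (by positivity) (by nlinarith)
    rw [Real.log_pow] at h1
    have := one_le_mul_log hN
    push_cast at h1
    linarith
  have hp : ((K : ℝ) + 1) ^ (-(1 / β - 1)) ≤ (N : ℝ) ^ (β - 1) := by
    have hq : 0 ≤ 1 / β - 1 := by
      rw [sub_nonneg, le_div_iff₀ hβ0]; linarith
    calc ((K : ℝ) + 1) ^ (-(1 / β - 1)) ≤ ((N : ℝ) ^ β) ^ (-(1 / β - 1)) :=
          Real.rpow_le_rpow_of_nonpos (by positivity) (by linarith) (by linarith)
      _ = _ := by
          rw [← Real.rpow_mul hN0.le]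
          congr 1
          field_simp
          ring
  have hl0 : 0 ≤ 1 + Real.log ((K : ℝ) + 1) := by
    linarith [Real.log_nonneg (by linarith [K.cast_nonneg (α := ℝ)] : (1 : ℝ) ≤ (K : ℝ) + 1)]
  calc √(N : ℝ) * rate β K ≤ √(N : ℝ) * ((N : ℝ) ^ (β - 1) * (4 * Real.log N)) :=
        mul_le_mul_of_nonneg_left (mul_le_mul hp hlog hl0 (by positivity)) (Real.sqrt_nonneg _)
    _ = 4 * ((N : ℝ) ^ (1 / 2 : ℝ) * (N : ℝ) ^ (β - 1)) * Real.log N := by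
        rw [Real.sqrt_eq_rpow]; ring
    _ = _ := by rw [← Real.rpow_add hN0]; congr 3; ring

lemma window_div_sqrt_le (hβ0 : 0 < β) (hN : 2 ≤ N) :
    2 * ((⌈(N : ℝ) ^ β⌉₊ : ℝ) + 1) / √(N : ℝ) ≤ 6 * (N : ℝ) ^ (β - 1 / 2) := by
  have hN2 : (2 : ℝ) ≤ N := by exact_mod_cast hN
  have hN0 : (0 : ℝ) < N := by linarith
  have h1 : 1 ≤ (N : ℝ) ^ β := Real.one_le_rpow (by linarith) hβ0.le
  have h2 := Nat.ceil_lt_add_one (zero_le_one.trans h1)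
  rw [Real.rpow_sub hN0, ← Real.sqrt_eq_rpow, ← mul_div_assoc]
  exact div_le_div_of_nonneg_right (by linarith) (Real.sqrt_nonneg _)

end Rates

/-! ### From the given density and observable to the cone and the centred observables. -/

section Setup

variable {β : ℝ} {α : ℕ → ℝ} {φ : ℝ → ℝ} {μ : Measure ℝ}

lemma comp_mem_Icc (hα : Admissible β α) {x : ℝ} (hx : x ∈ Set.Icc (0 : ℝ) 1) (n : ℕ) :
    comp α n x ∈ Set.Icc (0 : ℝ) 1 := by
  induction n with
  | zero => exact hx
  | succ n ih => exact map_mem_Icc (hα (n + 1) (by omega)).1 ih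

lemma HasDensity.ae_mem (hμ : HasDensity μ φ) : ∀ᵐ x ∂μ, x ∈ Set.Ioc (0 : ℝ) 1 := by
  rw [hμ]
  exact (withDensity_absolutelyContinuous _ _).ae_le (ae_restrict_mem measurableSet_Ioc)

lemma HasDensity.integral_eq (hμ : HasDensity μ φ) (hφ : InCone β φ) (H : ℝ → ℝ) :
    ∫ x, H x ∂μ = ∫ x in Set.Ioc (0 : ℝ) 1, (Set.Ioc (0 : ℝ) 1).indicator φ x * H x := by
  rw [hμ, integral_withDensity_eq_integral_toReal_smul₀
    (hφ.continuousOn.aemeasurable measurableSet_Ioc).ennreal_ofReal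
    (Eventually.of_forall fun x => ENNReal.ofReal_lt_top)]
  refine setIntegral_congr_fun measurableSet_Ioc fun x hx => ?_
  simp only [Set.indicator_of_mem hx, ENNReal.toReal_ofReal (hφ.nonneg x hx), smul_eq_mul]

lemma InCone.integral_eq_one [IsProbabilityMeasure μ] (hφ : InCone β φ) (hμ : HasDensity μ φ) :
    ∫ x in Set.Ioc (0 : ℝ) 1, (Set.Ioc (0 : ℝ) 1).indicator φ x = 1 := by
  have := hμ.integral_eq hφ fun _ => 1
  simpa using this.symm

/-- The indicator supplies a globally measurable density, and `2 ^ β * (2 + β) ≤ 6` places it in the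
larger cone. -/
lemma InCone.cone [IsProbabilityMeasure μ] (hβ0 : 0 < β) (hβ : β < 1 / 3) (hφ : InCone β φ)
    (hμ : HasDensity μ φ) : Cone β 1 ((Set.Ioc (0 : ℝ) 1).indicator φ) := by
  classical
  have heq : Set.EqOn ((Set.Ioc (0 : ℝ) 1).indicator φ) φ (Set.Ioc 0 1) :=
    fun x hx => Set.indicator_of_mem hx φ
  have hone := hφ.integral_eq_one hμ
  refine ⟨⟨?_, fun x hx => ?_, hφ.antitoneOn.congr heq.symm, ?_⟩, fun x hx => ?_, hone.le⟩
  · rw [← Set.piecewise_eq_indicator]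
    exact hφ.continuousOn.measurable_piecewise continuousOn_const measurableSet_Ioc
  · rw [heq hx]; exact hφ.nonneg x hx
  · exact hφ.monotoneOn.congr fun x hx => by simp only [heq hx]
  · rw [heq hx]
    have h1 := hφ.le_rpow x hx
    rw [← setIntegral_congr_fun measurableSet_Ioc heq, hone, mul_one] at h1
    refine h1.trans (mul_le_mul_of_nonneg_right ?_ (Real.rpow_nonneg hx.1.le _))
    have h2 : (2 : ℝ) ^ β ≤ 2 ^ (1 : ℝ) :=
      Real.rpow_le_rpow_of_exponent_le (by norm_num) (by linarith)
    rw [Real.rpow_one] at h2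
    nlinarith

/-- The observable `f` extended from `[0,1]` by its boundary values and centred at time `i`. -/
noncomputable def centredObs (α : ℕ → ℝ) (μ : Measure ℝ) (f : ℝ → ℝ) (i : ℕ) (x : ℝ) : ℝ :=
  f (max (min x 1) 0) - ∫ y, f (comp α i y) ∂μ

lemma centredObs_of_mem (f : ℝ → ℝ) (i : ℕ) {x : ℝ} (hx : x ∈ Set.Icc (0 : ℝ) 1) :
    centredObs α μ f i x = f x - ∫ y, f (comp α i y) ∂μ := by
  unfold centredObs
  rw [min_eq_left hx.2, max_eq_left hx.1]

lemma observables_centredObs [IsProbabilityMeasure μ] (hβ0 : 0 < β) (hβ : β < 1 / 3)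
    (hα : Admissible β α) (hφ : InCone β φ) (hμ : HasDensity μ φ) {f : ℝ → ℝ} {L : NNReal}
    (hf : LipschitzOnWith L f (Set.Icc 0 1)) :
    Observables β (2 * (|f 0| + L)) L α ((Set.Ioc (0 : ℝ) 1).indicator φ) (centredObs α μ f) := by
  have hclip : ∀ x : ℝ, max (min x 1) 0 ∈ Set.Icc (0 : ℝ) 1 := fun x =>
    ⟨le_max_right _ _, max_le (min_le_right _ _) zero_le_one⟩
  have hclip_lip : ∀ x y : ℝ, |max (min x 1) 0 - max (min y 1) 0| ≤ |x - y| := fun x y => by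
    refine (abs_max_sub_max_le_abs _ _ _).trans ((abs_min_sub_min_le_max _ _ _ _).trans ?_)
    simp
  have hlip : ∀ x ∈ Set.Icc (0 : ℝ) 1, ∀ y ∈ Set.Icc (0 : ℝ) 1, |f x - f y| ≤ L * |x - y| :=
    fun x hx y hy => by simpa [Real.dist_eq] using hf.dist_le_mul x hx y hy
  have hbd : ∀ x ∈ Set.Icc (0 : ℝ) 1, |f x| ≤ |f 0| + L := fun x hx => by
    have h1 := hlip x hx 0 ⟨le_rfl, zero_le_one⟩
    rw [sub_zero, abs_of_nonneg hx.1] at h1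
    have h2 : (L : ℝ) * x ≤ L := mul_le_of_le_one_right L.2 hx.2
    have h3 := abs_sub_abs_le_abs_sub (f x) (f 0)
    linarith
  have hae : ∀ᵐ x ∂μ, x ∈ Set.Icc (0 : ℝ) 1 :=
    hμ.ae_mem.mono fun x hx => ⟨hx.1.le, hx.2⟩
  have hmean : ∀ i, |∫ y, f (comp α i y) ∂μ| ≤ |f 0| + L := fun i => by
    have := norm_integral_le_of_norm_le_const (μ := μ) (f := fun y => f (comp α i y))
      (C := |f 0| + L) (hae.mono fun x hx => hbd _ (comp_mem_Icc hα hx i))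
    simpa using this
  have hgl : ∀ x y : ℝ, |f (max (min x 1) 0) - f (max (min y 1) 0)| ≤ L * |x - y| := fun x y =>
    (hlip _ (hclip x) _ (hclip y)).trans (mul_le_mul_of_nonneg_left (hclip_lip x y) L.2)
  have hgm : Measurable fun x : ℝ => f (max (min x 1) 0) :=
    (LipschitzWith.of_dist_le_mul (K := L) fun x y => by
      simpa [Real.dist_eq] using hgl x y).continuous.measurable
  refine ⟨hα, hφ.cone hβ0 hβ hμ, hφ.integral_eq_one hμ, fun i => hgm.sub_const _, fun i x => ?_,
    L.2, fun i x y => ?_, fun i => ?_⟩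
  · have h1 := abs_sub (f (max (min x 1) 0)) (∫ y, f (comp α i y) ∂μ)
    have h2 := hbd _ (hclip x)
    have h3 := hmean i
    unfold centredObs
    linarith
  · simpa only [centredObs, sub_sub_sub_cancel_right] using hgl x y
  · rw [← hμ.integral_eq hφ fun x => centredObs α μ f i (comp α i x)]
    have h1 : ∫ x, centredObs α μ f i (comp α i x) ∂μ
        = ∫ x, (f (max (min (comp α i x) 1) 0) - ∫ y, f (comp α i y) ∂μ) ∂μ := rfl
    have h2 : ∫ x, f (max (min (comp α i x) 1) 0) ∂μ = ∫ y, f (comp α i y) ∂μ :=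
      integral_congr_ae (hae.mono fun x hx => by
        have := comp_mem_Icc hα hx i
        simp only [min_eq_left this.2, max_eq_left this.1])
    rw [h1, integral_sub, h2]
    · simp
    · refine Integrable.of_bound (hgm.comp (measurable_comp α i)).aestronglyMeasurable (|f 0| + L)
        (Eventually.of_forall fun x => hbd _ (hclip _))
    · exact integrable_const _

end Setup

end Intermittent

/-! ### Assembly of the error terms. -/

namespace Intermittent

/-- The error terms of Stein's method are of the order `N ^ (β - 1 / 2)` up to logarithms. -/
lemma stein_error_le {σ c S b E D r L R w q : ℝ} (hσ : 0 < σ) (hc : 0 ≤ c) (hS : 0 ≤ S)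
    (hb : 0 ≤ b) (hE : 0 ≤ E) (hD : 0 ≤ D) (hr : 0 ≤ r) (hL : 1 ≤ q * L)
    (hR : R ≤ r * (q * L)) (hw : w ≤ 6 * r) :
    (E * (624 + D * (26 / σ))) * R + 26 / σ * (2 * c * (S * r) + w * √(8 * c * S))
        + 26 / σ ^ 2 * (b * (c * w * (2 * S)))
      ≤ q * (E * (624 + D * 26) + 26 * (2 * c * S + 6 * √(8 * c * S))
          + 26 * (b * (c * 6 * (2 * S)))) * max 1 ((σ ^ 2)⁻¹) * r * L := by
  set M := max 1 ((σ ^ 2)⁻¹) with hM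
  have hM1 : 1 ≤ M := le_max_left _ _
  have hM2 : 1 / σ ^ 2 ≤ M := by rw [one_div]; exact le_max_right _ _
  have hMσ : 1 / σ ≤ M := by
    rcases le_total 1 σ with h | h
    · exact ((div_le_one hσ).2 h).trans hM1
    · exact (one_div_le_one_div_of_le (by positivity) (by nlinarith)).trans hM2
  have hM0 : 0 ≤ M := zero_le_one.trans hM1
  have hrL : r ≤ r * (q * L) := le_mul_of_one_le_right hr hL
  have hrL0 : 0 ≤ r * (q * L) := hr.trans hrL
  have hs := Real.sqrt_nonneg (8 * c * S)
  have e1 : 26 / σ ≤ 26 * M := by rw [div_eq_mul_one_div]; linarith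
  have e2 : 26 / σ ^ 2 ≤ 26 * M := by rw [div_eq_mul_one_div]; linarith
  have e3 : w ≤ 6 * (r * (q * L)) := by linarith
  have t1 : (E * (624 + D * (26 / σ))) * R ≤ (E * ((624 + D * 26) * M)) * (r * (q * L)) := by
    refine mul_le_mul_of_nonneg (mul_le_mul_of_nonneg_left ?_ hE) hR (by positivity) hrL0
    have := mul_le_mul_of_nonneg_left e1 hD
    nlinarith
  have t2 : 26 / σ * (2 * c * (S * r) + w * √(8 * c * S))
      ≤ 26 * M * (2 * c * (S * (r * (q * L))) + 6 * (r * (q * L)) * √(8 * c * S)) := by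
    have h1 : 2 * c * (S * r) + w * √(8 * c * S)
        ≤ 2 * c * (S * (r * (q * L))) + 6 * (r * (q * L)) * √(8 * c * S) :=
      add_le_add (mul_le_mul_of_nonneg_left (mul_le_mul_of_nonneg_left hrL hS) (by positivity))
        (mul_le_mul_of_nonneg_right e3 hs)
    exact mul_le_mul_of_nonneg e1 h1 (by positivity) (by positivity)
  have t3 : 26 / σ ^ 2 * (b * (c * w * (2 * S)))
      ≤ 26 * M * (b * (c * (6 * (r * (q * L))) * (2 * S))) := by
    refine mul_le_mul_of_nonneg e2 (mul_le_mul_of_nonneg_left (mul_le_mul_of_nonneg_right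
      (mul_le_mul_of_nonneg_left e3 hc) (by positivity)) hb) (by positivity) (by positivity)
  calc _ ≤ _ := add_le_add (add_le_add t1 t2) t3
    _ = _ := by ring

/-- The normal approximation of the sequential Birkhoff sums, with the observables extended to the
whole line. -/
lemma Observables.abs_integral_stein_le {β b l C S c : ℝ} {α : ℕ → ℝ} {φ : ℝ → ℝ} {f : ℕ → ℝ → ℝ}
    {μ : Measure ℝ} [IsProbabilityMeasure μ] (h : Observables β b l α φ f)
    (hμ : ∀ H : ℝ → ℝ, ∫ x, H x ∂μ = ∫ x in Set.Ioc (0 : ℝ) 1, φ x * H x)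
    (hβ0 : 0 < β) (hβ : β < 1 / 3) (hC : DecayBound β C)
    (hc1 : C * (b * (50 * (b + l / β))) ≤ c)
    (hc2 : C * (2 * (b ^ 2 + b ^ 3) * (50 * (b + l / β) + (50 * (b + l / β)) ^ 2)) ≤ c)
    (hc : 0 ≤ c) (hS : ∀ n, ∑ m ∈ Finset.range n, rate β m ≤ S) {N K : ℕ} (hN : 1 ≤ N) {τ : ℝ}
    (hτ : ∀ n, ∑ m ∈ Finset.range n, (if m ≤ K then 0 else rate β m) ≤ τ)
    {A A' : ℝ → ℝ} {a₀ a₁ a₂ : ℝ} (hA : ∀ x, HasDerivAt A (A' x) x) (hA0 : ∀ x, |A x| ≤ a₀)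
    (hA1 : ∀ x, |A' x| ≤ a₁) (hA2 : ∀ x y, |A' x - A' y| ≤ a₂ * |x - y|) {V : ℝ → ℝ}
    (hV : ∀ x, V x = 1 / √(N : ℝ) * ∑ i ∈ Finset.range N, f i (comp α i x)) :
    |∫ x, ((∫ y, V y ^ 2 ∂μ) * A' (V x) - V x * A (V x)) ∂μ| ≤
      √(N : ℝ) * (C * ((50 * (b + l / β) + 2 * b) * (12 * (2 * a₀) + 2 * (48 * (a₁ * l) / β)))
          * rate β K)
        + a₁ * (2 * c * τ + (2 * (K + 1)) * √(8 * c * S) / √(N : ℝ))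
        + a₂ * (b * (c * (2 * (K + 1)) * (2 * S))) / √(N : ℝ) := by
  have hβ2 : β ≤ 1 / 2 := by linarith
  have hN1 : (1 : ℝ) ≤ √(N : ℝ) := Real.one_le_sqrt.2 (by exact_mod_cast hN)
  have hr : ∀ n, 0 ≤ rate β n := rate_nonneg
  refine _root_.abs_integral_stein_le (X := fun i x => f i (comp α i x))
    (fun i => (h.measurable i).comp (measurable_comp α i)) (fun i x => h.bound i _) hN hV hr hc hS
    hτ (fun i j => ?_) (fun i j k m => ?_) hA hA0 hA1 hA2 (fun n hn => ?_)
  · rw [hμ]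
    exact (h.abs_correlation_le hβ0 hβ2 hC i j).trans (mul_le_mul_of_nonneg_right hc1 (hr _))
  · rw [hμ, hμ, hμ]
    exact (h.abs_cov_pairs_le hβ0 hβ2 hC i j k m).trans (mul_le_mul_of_nonneg_right hc2
      (by linarith [hr (Nat.dist i k), hr (Nat.dist i m), hr (Nat.dist j k), hr (Nat.dist j m)]))
  · rw [hμ]
    refine h.abs_integral_gap_le hβ0 hβ2 hC
      (continuous_iff_continuousAt.2 fun x => (hA x).continuousAt).measurable hA0
      ((abs_nonneg _).trans (hA1 0)) (fun q q' => ?_) (by positivity)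
      ((div_le_one (by linarith)).2 hN1) hn K
    have := Convex.norm_image_sub_le_of_norm_hasDerivWithin_le (f := A) (f' := A') (C := a₁)
      (s := Set.univ) (x := q') (y := q) (fun x _ => (hA x).hasDerivWithinAt)
      (fun x _ => hA1 x) convex_univ trivial trivial
    simpa using this

end Intermittent

theorem theorem2 {Ω : Type*} [MeasurableSpace Ω] (P : Measure Ω) [IsProbabilityMeasure P]
    (Z : Ω → ℝ) (hZ : HasLaw Z (gaussianReal 0 1) P)
    (β : ℝ) (hβ₀ : 0 < β) (hβ : β < 1 / 3)
    (α : ℕ → ℝ) (hα : Intermittent.Admissible β α)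
    (μ : Measure ℝ) [IsProbabilityMeasure μ]
    (φ : ℝ → ℝ) (hφ : Intermittent.InCone β φ) (hμ : Intermittent.HasDensity μ φ)
    (f : ℝ → ℝ) (hf : ∃ K, LipschitzOnWith K f (Set.Icc 0 1)) :
    ∃ C : ℝ, 0 < C ∧ ∀ N : ℕ, 2 ≤ N → 0 < Intermittent.sigma α μ f N →
      wassersteinDist (Intermittent.W α μ f N) μ
          (fun ω => Intermittent.sigma α μ f N * Z ω) P
        ≤ ENNReal.ofReal
            (C * max 1 ((Intermittent.sigma α μ f N ^ 2)⁻¹)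
              * (N : ℝ) ^ (β - 1 / 2) * Real.log N ^ (1 / β)) := by
  open Intermittent in
  obtain ⟨L, hL⟩ := hf
  have hβ2 : β ≤ 1 / 2 := by linarith
  have hobs := observables_centredObs hβ₀ hβ hα hφ hμ hL
  obtain ⟨C, hC⟩ := exists_decayBound hβ₀ hβ2
  obtain ⟨S, hS0, hS, hτ⟩ := exists_sum_rate_le hβ₀ hβ
  set b : ℝ := 2 * (|f 0| + L) with hb
  have hb0 : 0 ≤ b := by positivity
  have hC0 : 0 < C := hC.1
  set g := centredObs α μ f with hg
  set c : ℝ := C * (b * (50 * (b + L / β)))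
    + C * (2 * (b ^ 2 + b ^ 3) * (50 * (b + L / β) + (50 * (b + L / β)) ^ 2)) with hcdef
  have hc1 : 0 ≤ C * (b * (50 * (b + L / β))) := by positivity
  have hc2 : 0 ≤ C * (2 * (b ^ 2 + b ^ 3) * (50 * (b + L / β) + (50 * (b + L / β)) ^ 2)) := by
    positivity
  have hc0 : 0 ≤ c := add_nonneg hc1 hc2
  set E : ℝ := C * (50 * (b + L / β) + 2 * b) with hE
  have hE0 : 0 ≤ E := by positivity
  set D : ℝ := 96 * L / β with hD
  have hD0 : 0 ≤ D := by positivity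
  set q : ℝ := 4 * (2 : ℝ) ^ (1 / β) with hq
  set C' : ℝ := q * (E * (624 + D * 26) + 26 * (2 * c * S + 6 * √(8 * c * S))
          + 26 * (b * (c * 6 * (2 * S)))) with hC'
  -- `C'` alone may vanish, for instance when `f` is zero on `[0, 1]`.
  refine ⟨C' + 1, by positivity, fun N hN hσ => ?_⟩
  set σ := sigma α μ f N with hσdef
  set V : ℝ → ℝ := fun x => 1 / √(N : ℝ) * ∑ i ∈ Finset.range N, g i (comp α i x) with hV
  -- Orbits of almost every point stay in `[0, 1]`, where extending `f` by its boundary values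
  -- changes nothing.
  have hae : W α μ f N =ᵐ[μ] V := hμ.ae_mem.mono fun x hx => by
    simp only [hV, W, hg]
    congr 1
    exact Finset.sum_congr rfl fun i _ =>
      (centredObs_of_mem f i (comp_mem_Icc hα ⟨hx.1.le, hx.2⟩ i)).symm
  have hVm : Measurable V := (Finset.measurable_sum _ fun i _ =>
    (hobs.measurable i).comp (measurable_comp α i)).const_mul _
  have hVi : Integrable V μ :=
    (integrable_finsetSum _ fun i _ => Integrable.of_bound
      ((hobs.measurable i).comp (measurable_comp α i)).aestronglyMeasurable b
      (Eventually.of_forall fun x => hobs.bound i _)).const_mul _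
  have hσ2 : σ ^ 2 = ∫ y, V y ^ 2 ∂μ := by
    rw [hσdef, sigma, Real.sq_sqrt (integral_nonneg fun x => sq_nonneg _)]
    exact integral_congr_ae (hae.mono fun x hx => by simp only [hx])
  have hlog : 1 ≤ 2 * Real.log N := one_le_mul_log hN
  have hlogq := log_le_rpow_log hβ₀ hβ hN
  set K := ⌈(N : ℝ) ^ β⌉₊ with hK
  have hr0 : 0 ≤ (N : ℝ) ^ (β - 1 / 2) := by positivity
  refine wassersteinDist_le_of_stein hZ (hVi.congr hae.symm) hσ fun A A' hA hA0 hA1 hA2 => ?_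
  have key := hobs.abs_integral_stein_le (hμ.integral_eq hφ) hβ₀ hβ hC (c := c)
    (by linarith) (by linarith) hc0 hS (by omega)
    (hτ N K (by omega) (Nat.le_ceil _)) hA hA0 hA1 hA2 (V := V) fun x => rfl
  rw [← hσ2] at key
  have hcongr : ∫ x, (σ ^ 2 * A' (W α μ f N x) - W α μ f N x * A (W α μ f N x)) ∂μ
      = ∫ x, (σ ^ 2 * A' (V x) - V x * A (V x)) ∂μ :=
    integral_congr_ae (hae.mono fun x hx => by simp only [hx])
  rw [hcongr]
  -- The number `624 = 12 * (2 * 26)` and the factor `D = 96 * L / β` come from the cone bound of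
  -- the past density with `a₀ = 26` and `a₁ = 26 / σ`.
  have hnum := stein_error_le (R := √(N : ℝ) * rate β K) (w := 2 * ((K : ℝ) + 1) / √(N : ℝ))
    (q := q) (L := Real.log N ^ (1 / β)) hσ hc0 hS0 hb0 hE0 hD0 hr0 (by linarith)
    ((sqrt_mul_rate_le hβ₀ hβ hN).trans (by
      rw [mul_comm (4 : ℝ), mul_assoc]
      exact mul_le_mul_of_nonneg_left (by linarith) hr0))
    (window_div_sqrt_le hβ₀ hN)
  refine key.trans (le_trans (le_of_eq ?_) (hnum.trans ?_))
  · simp only [hE, hD]; ring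
  · have : 0 ≤ max 1 ((σ ^ 2)⁻¹) * (N : ℝ) ^ (β - 1 / 2) * Real.log N ^ (1 / β) := by
      have h1 : 0 ≤ Real.log N := by linarith
      have h2 : 0 ≤ max 1 ((σ ^ 2)⁻¹) := zero_le_one.trans (le_max_left _ _)
      positivity
    calc _ ≤ C' * max 1 ((σ ^ 2)⁻¹) * (N : ℝ) ^ (β - 1 / 2) * Real.log N ^ (1 / β)
          + max 1 ((σ ^ 2)⁻¹) * (N : ℝ) ^ (β - 1 / 2) * Real.log N ^ (1 / β) :=
          le_add_of_nonneg_right this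
      _ = _ := by ring
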